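/- **Problem.** Let $T>0$, $I=[x_a,x_b]$ with $x_a<x_b$, ${\sf L}=x_b-x_a$, $Q=[0,T]\times I$. Let $g\in C([0,\infty),\mathbb R)$, $f\in C(Q,\mathbb C)$ and $u_0\in C(I,\mathbb C)$ with $u_0(x_a)=u_0(x_b)=0$, and let $u:Q\to\mathbb C$ be a classical solution of $$u_t={\rm i}\,u_{xx}+{\rm i}\,g(|u|^2)\,u+f\ \text{ on }Q,\qquad u(t,x_a)=u(t,x_b)=0\ (t\in[0,T]),\qquad u(0,x)=u_0(x)\ (x\in I).$$ Assume the smoothness $u\in C^6(Q)$ and $g\in C^5([0,\infty))$ (up to the boundary). **Grid.** For integers $N,J\ge1$ put $\tau=T/N$, $t_n=n\tau$, $t^{n+\frac12}=t_n+\frac\tau2$, $h={\sf L}/(J+1)$, $x_j=x_a+jh$. For complex grid functions $v=(v_j)_{j=0}^{J+1}$ let $\|v\|_{1,h}^2=h\sum_{j=0}^{J+1}|v_j|^2+h\sum_{j=0}^{J}\big|\frac{v_{j+1}-v_j}{h}\big|^2$. Let $\mathbb C_h^\circ$ be the space of grid functions with $v_0=v_{J+1}=0$, let $\Delta_h:\mathbb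 C_h^\circ\to\mathbb C_h^\circ$ be given by $(\Delta_hv)_j=\frac{v_{j-1}-2v_j+v_{j+1}}{h^2}$ for $1\le j\le J$, and for a function $z$ on $I$ let $\mathring{\sf I}_hz\in\mathbb C_h^\circ$ have the values $z(x_j)$, $1\le j\le J$. Functions act on grid functions componentwise, $\otimes$ is the componentwise product, and $u^n=(u(t_n,x_j))_j$, $u^{n+\frac12}=(u(t^{n+\frac12},x_j))_j$. For $v\in C^2(I)$ let ${\sf R}_h[v]\in\mathbb C_h^\circ$ be defined by $\Delta_h{\sf R}_h[v]=\mathring{\sf I}_h(v'')$. **Relaxation finite difference (RFD) scheme.** $W^0={\sf R}_h[u_0]$; $W^{\frac12},W^1,\dots,W^N\in\mathbb C_h^\circ$ and the real grid functions $\Phi^{\frac12},\dots,\Phi^{N-\frac12}$ satisfy $$W^{\frac12}-W^0={\rm i}\tfrac\tau2\Delta_h\tfrac{W^{\frac12}+W^0}2+{\rm i}\tfrac\tau2\,g(|u^0|^2)\otimes\tfrac{W^{\frac12}+W^0}2+\tfrac\tau2\,\mathring{\sf I}_h\tfrac{f(t^{\frac12},\cdot)+f(t_0,\cdot)}2,$$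 $$\Phi^{\frac12}=g(|W^{\frac12}|^2),\qquad \Phi^{n+\frac12}=2g(|W^n|^2)-\Phi^{n-\frac12}\quad(1\le n\le N-1),$$ $$W^{n+1}-W^n={\rm i}\tau\Delta_h\tfrac{W^{n+1}+W^n}2+{\rm i}\tau\,\Phi^{n+\frac12}\otimes\tfrac{W^{n+1}+W^n}2+\tau\,\mathring{\sf I}_h\tfrac{f(t_{n+1},\cdot)+f(t_n,\cdot)}2\quad(0\le n\le N-1).$$ **Modified scheme.** For $\delta>0$ let $\mathfrak n_\delta:\mathbb R\to\mathbb R$ be the odd function equal to $y$ on $[0,\delta]$, to $p_\delta(y)$ on $(\delta,2\delta]$ and to $2\delta$ on $(2\delta,\infty)$, where $p_\delta$ is the polynomial of degree at most $7$ with $p_\delta(\delta)=\delta$, $p_\delta'(\delta)=1$, $p_\delta''(\delta)=p_\delta'''(\delta)=0$, $p_\delta(2\delta)=2\delta$, $p_\delta'(2\delta)=p_\delta''(2\delta)=p_\delta'''(2\delta)=0$; put $\gamma_\delta(z)=\mathfrak n_\delta({\rm Re}\,z)+{\rm i}\,\mathfrak n_\delta({\rm Im}\,z)$. The $\delta$-modified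 approximations $V^0,V^{\frac12},V^1,\dots,V^N\in\mathbb C_h^\circ$ and $\Phi_\delta^{\frac12},\dots,\Phi_\delta^{N-\frac12}$ are defined by $V^0={\sf R}_h[u_0]$, the same equation for the half step, $\Phi_\delta^{\frac12}=g(|\gamma_\delta(V^{\frac12})|^2)$, $\Phi_\delta^{n+\frac12}=2g(|\gamma_\delta(V^n)|^2)-\Phi_\delta^{n-\frac12}$ for $1\le n\le N-1$, and $$V^{n+1}-V^n={\rm i}\tau\Delta_h\tfrac{V^{n+1}+V^n}2+{\rm i}\tau\,\mathfrak n_\delta(\Phi_\delta^{n+\frac12})\otimes\gamma_\delta\big(\tfrac{V^{n+1}+V^n}2\big)+\tau\,\mathring{\sf I}_h\tfrac{f(t_{n+1},\cdot)+f(t_n,\cdot)}2\quad(0\le n\le N-1).$$ Call positive numbers ${\sf C}^{\sf A},{\sf C}^{\sf B},{\sf C}^{\sf C}$ *admissible for $\delta$* if for all $N,J\ge1$ with $\tau\,{\sf C}^{\sf A}\le\frac12$ such $\delta$-modified approximations exist and all of them satisfy $$\|u^{\frac12}-V^{\frac12}\|_{1,h}+\max_{0\le m\le N}\|u^m-V^m\|_{1,h}\le{\sf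 C}^{\sf B}(\tau^2+h^2),\qquad \max_{0\le m\le N-1}\|g(|u^{m+\frac12}|^2)-\Phi_\delta^{m+\frac12}\|_{1,h}\le{\sf C}^{\sf C}(\tau^2+h^2).$$ **Theorem (convergence of the RFD method).** Let $\delta_\star>0$ and $\delta_\star\ge2\max\{\max_Q|u|,\ \max_Q|g(|u|^2)|\}$. Then there are admissible constants for $\delta_\star$; and for all constants ${\sf C}^{\sf A},{\sf C}^{\sf B},{\sf C}^{\sf C}$ admissible for $\delta_\star$ there is a constant $C>0$, independent of $\tau$ and $h$, such that for all $N,J\ge1$ with $$\tau\,{\sf C}^{\sf A}\le\tfrac12\qquad\text{and}\qquad\max\{{\sf C}^{\sf B},{\sf C}^{\sf C}\}\,\sqrt{\sf L}\,(\tau^2+h^2)\le\tfrac{\delta_\star}2$$ the RFD approximations exist and satisfy $$\max_{0\le m\le N-1}\|g(|u^{m+\frac12}|^2)-\Phi^{m+\frac12}\|_{1,h}+\|u^{\frac12}-W^{\frac12}\|_{1,h}+\max_{0\le m\le N}\|u^m-W^m\|_{1,h}\le C\,(\tau^2+h^2).$$ -/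

import Mathlib

open Set

namespace RFD

noncomputable section

/-- The data of the initial and boundary value problem
`u_t = i u_xx + i g(|u|²) u + f` on `Q = [0,T] × [xa,xb]`, with homogeneous Dirichlet boundary
values and initial value `u₀`. Only the values of `g` on `[0,∞)`, of `f` on `Q` and of `u₀` on
`[xa,xb]` matter. -/
structure Problem where
  T : ℝ
  xa : ℝ
  xb : ℝ
  g : ℝ → ℝ
  f : ℝ → ℝ → ℂ
  u₀ : ℝ → ℂ
  T_pos : 0 < T
  xa_lt_xb : xa < xb
  g_continuous : ContinuousOn g (Ici 0)
  f_continuous : ContinuousOn (Function.uncurry f) (Icc 0 T ×ˢ Icc xa xb)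
  u₀_continuous : ContinuousOn u₀ (Icc xa xb)
  u₀_left : u₀ xa = 0
  u₀_right : u₀ xb = 0

namespace Problem

/-- The space interval. -/
def I (P : Problem) : Set ℝ := Icc P.xa P.xb

/-- The space-time cylinder. -/
def Q (P : Problem) : Set (ℝ × ℝ) := Icc 0 P.T ×ˢ Icc P.xa P.xb

/-- The length of the space interval. -/
def L (P : Problem) : ℝ := P.xb - P.xa

/-- The time step `τ = T / N`. -/
def τ (P : Problem) (N : ℕ) : ℝ := P.T / N

/-- The mesh width `h = L / (J + 1)`. -/
def h (P : Problem) (J : ℕ) : ℝ := P.L / (J + 1)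

/-- The time nodes `t_n = n τ`. -/
def t (P : Problem) (N n : ℕ) : ℝ := n * P.τ N

/-- The intermediate time nodes `t_n + τ / 2`. -/
def tmid (P : Problem) (N n : ℕ) : ℝ := P.t N n + P.τ N / 2

/-- The space nodes `x_j = xa + j h`, `j = 0, …, J + 1`. -/
def x (P : Problem) (J : ℕ) (j : Fin (J + 2)) : ℝ := P.xa + (j : ℕ) * P.h J

end Problem

/-- `u` solves the initial and boundary value problem in the classical sense (up to the boundary
of `Q`, with one-sided derivatives there). -/
structure IsSolution (P : Problem) (u : ℝ → ℝ → ℂ) : Prop where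
  pde : ∀ t ∈ Icc 0 P.T, ∀ x ∈ P.I,
    HasDerivWithinAt (fun s => u s x)
      (Complex.I * iteratedDerivWithin 2 (u t) P.I x
        + Complex.I * (P.g (‖u t x‖ ^ 2) : ℂ) * u t x + P.f t x) (Icc 0 P.T) t
  boundary : ∀ t ∈ Icc 0 P.T, u t P.xa = 0 ∧ u t P.xb = 0
  initial : ∀ x ∈ P.I, u 0 x = P.u₀ x

/-- The space `ℂ_h` of complex grid functions `(v_j)`, `j = 0, …, J + 1`. -/
abbrev Grid (J : ℕ) : Type := Fin (J + 2) → ℂ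

/-- Membership in the subspace of grid functions vanishing at both end points. -/
def VanishesAtEnds {J : ℕ} (v : Grid J) : Prop := v 0 = 0 ∧ v (Fin.last (J + 1)) = 0

/-- The grid function with the values `w` at the interior nodes `1, …, J` and `0` at both
end points. -/
def extendZero {J : ℕ} (w : Fin J → ℂ) : Grid J :=
  Fin.cons (α := fun _ => ℂ) 0 (Fin.snoc (α := fun _ => ℂ) w 0)

/-- The restriction of a function of `x` to the grid. -/
def sample (P : Problem) (J : ℕ) (z : ℝ → ℂ) : Grid J := fun j => z (P.x J j)

/-- The restriction of a function of `x` to the interior nodes, extended by `0`. -/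
def sampleInterior (P : Problem) (J : ℕ) (z : ℝ → ℂ) : Grid J :=
  extendZero fun i => z (P.x J i.succ.castSucc)

/-- The discrete Laplacian with mesh width `h`: second central difference quotients at the interior
nodes (the interior node number `i + 1` has the neighbours `i` and `i + 2`), `0` at the ends. -/
def laplacian {J : ℕ} (h : ℝ) (v : Grid J) : Grid J :=
  extendZero fun i : Fin J =>
    (v i.castSucc.castSucc - 2 * v i.succ.castSucc + v i.succ.succ) / (h : ℂ) ^ 2

/-- The forward difference quotients. -/
def diffQuot {J : ℕ} (h : ℝ) (v : Grid J) : Fin (J + 1) → ℂ :=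
  fun j => (v j.succ - v j.castSucc) / (h : ℂ)

/-- The discrete `L²` norm. -/
def normL2 {J : ℕ} (h : ℝ) (v : Grid J) : ℝ := √(h * ∑ j, ‖v j‖ ^ 2)

/-- The discrete `H¹` seminorm. -/
def seminormH1 {J : ℕ} (h : ℝ) (v : Grid J) : ℝ := √(h * ∑ j, ‖diffQuot h v j‖ ^ 2)

/-- The discrete `H¹` norm. -/
def normH1 {J : ℕ} (h : ℝ) (v : Grid J) : ℝ := √(normL2 h v ^ 2 + seminormH1 h v ^ 2)

/-- `R` is the discrete elliptic projection of `v`: it vanishes at the end points and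
its discrete Laplacian agrees with `v''` at the interior nodes. -/
def IsEllipticProjection (P : Problem) {J : ℕ} (v : ℝ → ℂ) (R : Grid J) : Prop :=
  VanishesAtEnds R ∧ laplacian (P.h J) R = sampleInterior P J (iteratedDerivWithin 2 v P.I)

/-- The average of two grid functions. -/
def avg {J : ℕ} (v w : Grid J) : Grid J := fun j => (v j + w j) / 2

/-- One linearly implicit step of length `k` from time `s` to time `s + k`:
`V₁ - V₀ = i k Δ_h((V₁ + V₀)/2) + i k M + k [f(s + k, ·) + f(s, ·)]/2`. -/
def Step (P : Problem) {J : ℕ} (s k : ℝ) (V₀ V₁ M : Grid J) : Prop :=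
  V₁ - V₀ = (Complex.I * (k : ℂ)) • laplacian (P.h J) (avg V₁ V₀)
    + (Complex.I * (k : ℂ)) • M
    + (k : ℂ) • sampleInterior P J fun x => (P.f (s + k) x + P.f s x) / 2

/-- The relaxation finite difference scheme. `W n` is `W^n` for `n ≤ N`, `Whalf` is `W^{1/2}` and
`Φ n` is `Φ^{n+1/2}` for `n < N`; the values of `W` and `Φ` at larger indices are irrelevant. -/
structure IsRFD (P : Problem) (N J : ℕ) (W : ℕ → Grid J) (Whalf : Grid J)
    (Φ : ℕ → Fin (J + 2) → ℝ) : Prop where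
  ends : ∀ n ≤ N, VanishesAtEnds (W n)
  ends_half : VanishesAtEnds Whalf
  initial : IsEllipticProjection P P.u₀ (W 0)
  half_step : Step P 0 (P.τ N / 2) (W 0) Whalf
    fun j => (P.g (‖P.u₀ (P.x J j)‖ ^ 2) : ℂ) * avg Whalf (W 0) j
  Φ_zero : ∀ j, Φ 0 j = P.g (‖Whalf j‖ ^ 2)
  Φ_succ : ∀ n, n + 1 < N → ∀ j, Φ (n + 1) j = 2 * P.g (‖W (n + 1) j‖ ^ 2) - Φ n j
  step : ∀ n < N, Step P (P.t N n) (P.τ N) (W n) (W (n + 1))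
    fun j => (Φ n j : ℂ) * avg (W (n + 1)) (W n) j

/-- The polynomial of degree at most `7` that joins the identity at `δ` to the constant `2δ`
at `2δ` with three continuous derivatives; see `mollifierPoly_spec`. -/
def mollifierPoly (δ : ℝ) : Polynomial ℝ :=
  .X + .C (15 / δ ^ 3) * (.X - .C δ) ^ 4 - .C (39 / δ ^ 4) * (.X - .C δ) ^ 5
    + .C (34 / δ ^ 5) * (.X - .C δ) ^ 6 - .C (10 / δ ^ 6) * (.X - .C δ) ^ 7

/-- The Hermite interpolation conditions at `δ` and `2δ`. -/
def IsMollifierPoly (δ : ℝ) (p : Polynomial ℝ) : Prop :=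
  p.natDegree ≤ 7 ∧
  p.eval δ = δ ∧ p.derivative.eval δ = 1 ∧ p.derivative.derivative.eval δ = 0 ∧
  p.derivative.derivative.derivative.eval δ = 0 ∧
  p.eval (2 * δ) = 2 * δ ∧ p.derivative.eval (2 * δ) = 0 ∧
  p.derivative.derivative.eval (2 * δ) = 0 ∧
  p.derivative.derivative.derivative.eval (2 * δ) = 0

theorem mollifierPoly_isMollifierPoly {δ : ℝ} (hδ : 0 < δ) :
    IsMollifierPoly δ (mollifierPoly δ) := by
  have h0 : δ ≠ 0 := hδ.ne'
  have e : 2 * δ - δ = δ := by ring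
  refine ⟨?_, ?_, ?_, ?_, ?_, ?_, ?_, ?_, ?_⟩
  · unfold mollifierPoly
    compute_degree
  all_goals
    simp [mollifierPoly, Polynomial.derivative_pow, e]
  all_goals
    try (field_simp; ring)

/-- `mollifierPoly δ` is the only polynomial with these properties. -/
theorem mollifierPoly_spec {δ : ℝ} (hδ : 0 < δ) (p : Polynomial ℝ) :
    IsMollifierPoly δ p ↔ p = mollifierPoly δ := by
  constructor
  · intro hp
    have hq := mollifierPoly_isMollifierPoly hδ
    obtain ⟨d1, a0, a1, a2, a3, b0, b1, b2, b3⟩ := hp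
    obtain ⟨d2, c0, c1, c2, c3, e0, e1, e2, e3⟩ := hq
    by_contra hne
    set r := p - mollifierPoly δ with hr
    have hr0 : r ≠ 0 := sub_ne_zero.mpr hne
    have m1 : 3 < r.rootMultiplicity δ := by
      rw [Polynomial.lt_rootMultiplicity_iff_isRoot_iterate_derivative hr0]
      intro m hm
      interval_cases m <;> simp [Polynomial.IsRoot, *]
    have m2 : 3 < r.rootMultiplicity (2 * δ) := by
      rw [Polynomial.lt_rootMultiplicity_iff_isRoot_iterate_derivative hr0]
      intro m hm
      interval_cases m <;> simp [Polynomial.IsRoot, *]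
    have hd : r.natDegree ≤ 7 := (Polynomial.natDegree_sub_le _ _).trans (max_le d1 d2)
    have hle : Multiset.replicate 4 δ + Multiset.replicate 4 (2 * δ) ≤ r.roots := by
      rw [Multiset.le_iff_count]
      intro a
      have hne' : 2 * δ ≠ δ := by linarith
      by_cases h1 : a = δ
      · subst h1
        simp only [Multiset.count_add, Multiset.count_replicate, Polynomial.count_roots]
        simp [hne']
        omega
      · by_cases h2 : a = 2 * δ
        · subst h2
          simp only [Multiset.count_add, Multiset.count_replicate, Polynomial.count_roots]
          simp [hne'.symm]
          omega
        · rw [Multiset.count_add, Multiset.count_replicate, Multiset.count_replicate,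
            if_neg (Ne.symm h1), if_neg (Ne.symm h2)]
          exact Nat.zero_le _
    have hc := Multiset.card_le_card hle
    have hc2 := r.card_roots'
    simp at hc
    omega
  · rintro rfl
    exact mollifierPoly_isMollifierPoly hδ

/-- The odd function that is the identity on `[0,δ]`, the polynomial `mollifierPoly δ` on
`(δ,2δ]` and the constant `2δ` beyond. -/
def mollifier (δ y : ℝ) : ℝ :=
  SignType.sign y *
    if |y| ≤ δ then |y| else if |y| ≤ 2 * δ then (mollifierPoly δ).eval |y| else 2 * δ

/-- The complex mollifier, acting on real and imaginary parts. -/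
def cmollifier (δ : ℝ) (z : ℂ) : ℂ := ⟨mollifier δ z.re, mollifier δ z.im⟩

/-- The modified scheme with parameter `δ`; conventions on indices as in `IsRFD`. -/
structure IsMRFD (P : Problem) (δ : ℝ) (N J : ℕ) (V : ℕ → Grid J) (Vhalf : Grid J)
    (Φ : ℕ → Fin (J + 2) → ℝ) : Prop where
  ends : ∀ n ≤ N, VanishesAtEnds (V n)
  ends_half : VanishesAtEnds Vhalf
  initial : IsEllipticProjection P P.u₀ (V 0)
  half_step : Step P 0 (P.τ N / 2) (V 0) Vhalf
    fun j => (P.g (‖P.u₀ (P.x J j)‖ ^ 2) : ℂ) * avg Vhalf (V 0) j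
  Φ_zero : ∀ j, Φ 0 j = P.g (‖cmollifier δ (Vhalf j)‖ ^ 2)
  Φ_succ : ∀ n, n + 1 < N → ∀ j,
    Φ (n + 1) j = 2 * P.g (‖cmollifier δ (V (n + 1) j)‖ ^ 2) - Φ n j
  step : ∀ n < N, Step P (P.t N n) (P.τ N) (V n) (V (n + 1))
    fun j => (mollifier δ (Φ n j) : ℂ) * cmollifier δ (avg (V (n + 1)) (V n) j)

/-- `max_{0 ≤ m ≤ N} ‖u^m - V^m‖_{1,h}`. -/
def nodeError (P : Problem) (u : ℝ → ℝ → ℂ) (N J : ℕ) (V : ℕ → Grid J) : ℝ :=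
  ⨆ m : Fin (N + 1), normH1 (P.h J) (sample P J (u (P.t N m)) - V m)

/-- `‖u^{1/2} - V^{1/2}‖_{1,h}`. -/
def halfError (P : Problem) (u : ℝ → ℝ → ℂ) (N J : ℕ) (Vhalf : Grid J) : ℝ :=
  normH1 (P.h J) (sample P J (u (P.tmid N 0)) - Vhalf)

/-- `max_{0 ≤ m ≤ N-1} ‖g(|u^{m+1/2}|²) - Φ^{m+1/2}‖_{1,h}`. -/
def relaxError (P : Problem) (u : ℝ → ℝ → ℂ) (N J : ℕ) (Φ : ℕ → Fin (J + 2) → ℝ) : ℝ :=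
  ⨆ m : Fin N, normH1 (P.h J)
    fun j => ((P.g (‖u (P.tmid N m) (P.x J j)‖ ^ 2) - Φ m j : ℝ) : ℂ)

/-- `CA`, `CB`, `CC` are constants (independent of the mesh) with which the modified scheme with
parameter `δ` converges: if `τ CA ≤ 1/2`, the modified approximations exist and satisfy
second order error bounds with the constants `CB` and `CC`. -/
def IsMRFDConstants (P : Problem) (u : ℝ → ℝ → ℂ) (δ CA CB CC : ℝ) : Prop :=
  0 < CA ∧ 0 < CB ∧ 0 < CC ∧
  ∀ N J : ℕ, 1 ≤ N → 1 ≤ J → P.τ N * CA ≤ 1 / 2 →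
    (∃ V Vhalf Φ, IsMRFD P δ N J V Vhalf Φ) ∧
    ∀ V Vhalf Φ, IsMRFD P δ N J V Vhalf Φ →
      halfError P u N J Vhalf + nodeError P u N J V ≤ CB * (P.τ N ^ 2 + P.h J ^ 2) ∧
      relaxError P u N J Φ ≤ CC * (P.τ N ^ 2 + P.h J ^ 2)

/-- `max_Q |u|`. -/
def uMax (P : Problem) (u : ℝ → ℝ → ℂ) : ℝ :=
  sSup ((fun q : ℝ × ℝ => ‖u q.1 q.2‖) '' P.Q)

/-- `max_Q |g(|u|²)|`. -/
def gMax (P : Problem) (u : ℝ → ℝ → ℂ) : ℝ :=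
  sSup ((fun q : ℝ × ℝ => |P.g (‖u q.1 q.2‖ ^ 2)|) '' P.Q)

end

end RFD

/-! Write η = τ² + h², e = u − W, and ε^n = g(|u^{n+1/2}|²) − Φ^{n+1/2}. The relaxation equation
gives ε^{n+1} + ε^n = 2(g(|u^{n+1}|²) − g(|W^{n+1}|²)) + O(η). The factor −1 in front of ε^n means
that this recursion, iterated naively, adds N terms without a factor τ. Subtracting two consecutive
relations helps: ε^{n+2} − ε^n is controlled by time differences of e and by differences of
consistency errors, so it suffices to show that e^{n+1} − e^n is O(τη).

The differenced Schrödinger equation, however, is forced by ε^{n+1} − ε^n, which may oscillate at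
full size. The remedy is to follow θ + (iτ/2) W ε, where θ = u + ρ − W and u + ρ is the elliptic
projection of u. In the equation for this combination the forcing contains ε^{n+1} + ε^n
(`ErrorSystem.corrDiff_eq`), whose time difference is the harmless ε^{n+2} − ε^n. The price is a
perturbation of size τ inside the discrete Laplacian. `seminormH1_step_le` absorbs it at the cost of
its H¹ seminorm, so no derivative and no power of h is lost.

All quantities are measured in `gridNorm`, maximum norm plus H¹ seminorm. It is submultiplicative,
compositions with smooth functions are Lipschitz in it (`exists_nonlin_bounds`), and for functions
vanishing at the ends it is equivalent to the H¹ seminorm, always with constants independent of the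
mesh. The coupled inequalities close in the quantity `ErrorSystem.size`
(`ErrorSystem.scalar_recursion`). A Gronwall induction, in which the bound just proved keeps W in a
fixed ball, yields second order convergence of the unmodified scheme for small τ and η
(`exists_rfd_bound`).

Admissible constants follow from this. On fine meshes the relaxation approximations are so close to
u that the cut-offs are inactive; they are then modified approximations, and these are unique for
small τ (`exists_mrfd_bound_fine`). If τ is small but h ≥ h₀, the Laplacian is bounded uniformly and
any bound E of the errors is at most (E/h₀²)h² (`exists_mrfd_bound_coarse`).

Conversely, for arbitrary admissible constants the mesh condition and the discrete Sobolev
inequality make all errors at most δ/2 in the maximum norm. The modified approximations are then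
relaxation approximations (`IsMRFD.isRFD`). Each relaxation step is linear with a real potential and
hence uniquely solvable for every τ (`IsRFD.unique`), so W inherits the bounds, with C = CB + CC. -/

namespace RFD

open scoped ComplexConjugate

/-! ### Grid functions -/

section Grid

variable {J : ℕ} {h : ℝ}

@[simp] theorem extendZero_zero (w : Fin J → ℂ) : extendZero w 0 = 0 := rfl

@[simp] theorem extendZero_last (w : Fin J → ℂ) : extendZero w (Fin.last (J + 1)) = 0 := by
  rw [extendZero, ← Fin.succ_last, Fin.cons_succ, Fin.snoc_last]

@[simp] theorem extendZero_castSucc_succ (w : Fin J → ℂ) (i : Fin J) :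
    extendZero w i.castSucc.succ = w i := by
  rw [extendZero, Fin.cons_succ, Fin.snoc_castSucc]

theorem extendZero_interior (w : Fin J → ℂ) (i : Fin J) :
    extendZero w i.succ.castSucc = w i := extendZero_castSucc_succ w i

theorem sum_grid {M : Type*} [AddCommMonoid M] (F : Fin (J + 2) → M) :
    ∑ j, F j = F 0 + (∑ i : Fin J, F i.succ.castSucc) + F (Fin.last (J + 1)) := by
  rw [Fin.sum_univ_castSucc, Fin.sum_univ_succ]
  rfl

theorem forall_grid {p : Fin (J + 2) → Prop} :
    (∀ j, p j) ↔ p 0 ∧ (∀ i : Fin J, p i.succ.castSucc) ∧ p (Fin.last (J + 1)) := by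
  refine ⟨fun H => ⟨H _, fun i => H _, H _⟩, fun ⟨h0, hi, hl⟩ j => ?_⟩
  refine Fin.lastCases hl (fun k => ?_) j
  exact Fin.cases h0 hi k

theorem grid_ext {v w : Grid J} (h0 : v 0 = w 0)
    (hi : ∀ i : Fin J, v i.succ.castSucc = w i.succ.castSucc)
    (hl : v (Fin.last (J + 1)) = w (Fin.last (J + 1))) : v = w :=
  funext (forall_grid.2 ⟨h0, hi, hl⟩)

theorem vanishesAtEnds_extendZero (w : Fin J → ℂ) : VanishesAtEnds (extendZero w) :=
  ⟨extendZero_zero w, extendZero_last w⟩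

theorem VanishesAtEnds.add {v w : Grid J} (hv : VanishesAtEnds v) (hw : VanishesAtEnds w) :
    VanishesAtEnds (v + w) := by simp [VanishesAtEnds, hv.1, hv.2, hw.1, hw.2]

theorem VanishesAtEnds.sub {v w : Grid J} (hv : VanishesAtEnds v) (hw : VanishesAtEnds w) :
    VanishesAtEnds (v - w) := by simp [VanishesAtEnds, hv.1, hv.2, hw.1, hw.2]

theorem VanishesAtEnds.smul {v : Grid J} (c : ℂ) (hv : VanishesAtEnds v) :
    VanishesAtEnds (c • v) := by simp [VanishesAtEnds, hv.1, hv.2]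

theorem VanishesAtEnds.mul {v : Grid J} (w : Grid J) (hv : VanishesAtEnds v) :
    VanishesAtEnds (v * w) := by simp [VanishesAtEnds, hv.1, hv.2]

theorem vanishesAtEnds_laplacian (v : Grid J) : VanishesAtEnds (laplacian h v) :=
  vanishesAtEnds_extendZero _

/-- The grid functions vanishing at both end points, as a submodule. -/
def zeroEnds (J : ℕ) : Submodule ℂ (Grid J) where
  carrier := {v | VanishesAtEnds v}
  add_mem' := VanishesAtEnds.add
  zero_mem' := ⟨rfl, rfl⟩
  smul_mem' c _ := VanishesAtEnds.smul c

theorem avg_eq (v w : Grid J) : avg v w = (1 / 2 : ℂ) • (v + w) := by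
  ext j; simp [avg]; ring

@[simp] theorem laplacian_castSucc_succ (v : Grid J) (i : Fin J) :
    laplacian h v i.castSucc.succ
      = (v i.castSucc.castSucc - 2 * v i.castSucc.succ + v i.succ.succ) / (h : ℂ) ^ 2 := by
  simp [laplacian]

@[simp] theorem laplacian_zero_node (v : Grid J) : laplacian h v 0 = 0 := rfl

@[simp] theorem laplacian_last_node (v : Grid J) : laplacian h v (Fin.last (J + 1)) = 0 := by
  simp [laplacian]

/-- The discrete Laplacian as a linear map. -/
noncomputable def laplacianL (h : ℝ) (J : ℕ) : Grid J →ₗ[ℂ] Grid J where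
  toFun := laplacian h
  map_add' v w := grid_ext (by simp) (fun i => by simp; ring) (by simp)
  map_smul' c v := grid_ext (by simp) (fun i => by simp; ring) (by simp)

theorem laplacian_add (v w : Grid J) : laplacian h (v + w) = laplacian h v + laplacian h w :=
  (laplacianL h J).map_add v w

theorem laplacian_sub (v w : Grid J) : laplacian h (v - w) = laplacian h v - laplacian h w :=
  (laplacianL h J).map_sub v w

theorem laplacian_smul (c : ℂ) (v : Grid J) : laplacian h (c • v) = c • laplacian h v :=
  (laplacianL h J).map_smul c v

/-- Forward difference quotients, scaled so that their Euclidean norm is the `H¹` seminorm. -/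
noncomputable def gradL (h : ℝ) (J : ℕ) : Grid J →ₗ[ℂ] EuclideanSpace ℂ (Fin (J + 1)) where
  toFun v := WithLp.toLp 2 fun j => (√h : ℂ) * diffQuot h v j
  map_add' v w := by ext j; simp [diffQuot]; ring
  map_smul' c v := by ext j; simp [diffQuot]; ring

theorem gradL_apply (v : Grid J) (j : Fin (J + 1)) : gradL h J v j = (√h : ℂ) * diffQuot h v j :=
  rfl

theorem norm_gradL (hh : 0 ≤ h) (v : Grid J) : ‖gradL h J v‖ = seminormH1 h v := by
  rw [EuclideanSpace.norm_eq, seminormH1, Finset.mul_sum]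
  congr 1
  refine Finset.sum_congr rfl fun j _ => ?_
  rw [gradL_apply, norm_mul, mul_pow, Complex.norm_real, Real.norm_eq_abs, sq_abs, Real.sq_sqrt hh]

theorem seminormH1_nonneg (v : Grid J) : 0 ≤ seminormH1 h v := Real.sqrt_nonneg _

theorem seminormH1_add_le (hh : 0 ≤ h) (v w : Grid J) :
    seminormH1 h (v + w) ≤ seminormH1 h v + seminormH1 h w := by
  simp only [← norm_gradL hh, map_add]; exact norm_add_le _ _

theorem seminormH1_sub_le (hh : 0 ≤ h) (v w : Grid J) :
    seminormH1 h (v - w) ≤ seminormH1 h v + seminormH1 h w := by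
  simp only [← norm_gradL hh, map_sub]; exact norm_sub_le _ _

theorem seminormH1_smul (hh : 0 ≤ h) (c : ℂ) (v : Grid J) :
    seminormH1 h (c • v) = ‖c‖ * seminormH1 h v := by
  simp only [← norm_gradL hh, map_smul, norm_smul]

/-- Pointwise bounds of difference quotients give bounds of seminorms. -/
theorem seminormH1_le_of_diffQuot (hh : 0 ≤ h) {a b : ℝ} (ha : 0 ≤ a) (hb : 0 ≤ b)
    {v w z : Grid J}
    (H : ∀ j, ‖diffQuot h v j‖ ≤ a * ‖diffQuot h w j‖ + b * ‖diffQuot h z j‖) :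
    seminormH1 h v ≤ a * seminormH1 h w + b * seminormH1 h z := by
  -- Minkowski's inequality for the Euclidean vectors of scaled moduli of difference quotients.
  let A : EuclideanSpace ℝ (Fin (J + 1)) := WithLp.toLp 2 fun j => √h * ‖diffQuot h w j‖
  let B : EuclideanSpace ℝ (Fin (J + 1)) := WithLp.toLp 2 fun j => √h * ‖diffQuot h z j‖
  have key : ∀ x : Grid J, ‖(WithLp.toLp 2 fun j => √h * ‖diffQuot h x j‖ :
      EuclideanSpace ℝ (Fin (J + 1)))‖ = seminormH1 h x := by
    intro x
    rw [← norm_gradL hh, EuclideanSpace.norm_eq, EuclideanSpace.norm_eq]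
    simp [gradL_apply]
  have h1 : seminormH1 h v ≤ ‖a • A + b • B‖ := by
    rw [← norm_gradL hh, EuclideanSpace.norm_eq, EuclideanSpace.norm_eq]
    refine Real.sqrt_le_sqrt (Finset.sum_le_sum fun j _ => ?_)
    refine pow_le_pow_left₀ (norm_nonneg _) ?_ 2
    have e : (a • A + b • B) j
        = √h * (a * ‖diffQuot h w j‖ + b * ‖diffQuot h z j‖) := by
      simp [A, B]; ring
    rw [e, gradL_apply, norm_mul, Complex.norm_real, Real.norm_eq_abs, Real.norm_eq_abs,
      abs_of_nonneg (Real.sqrt_nonneg _), abs_of_nonneg (by positivity)]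
    exact mul_le_mul_of_nonneg_left (H j) (Real.sqrt_nonneg _)
  refine h1.trans ((norm_add_le _ _).trans ?_)
  rw [norm_smul, norm_smul, key, key, Real.norm_of_nonneg ha, Real.norm_of_nonneg hb]

theorem seminormH1_le_of_bound {L M : ℝ} (hh : 0 ≤ h) (hL : h * (J + 1) = L) (hM : 0 ≤ M)
    {v : Grid J} (H : ∀ j, ‖diffQuot h v j‖ ≤ M) : seminormH1 h v ≤ √L * M := by
  have : h * ∑ j, ‖diffQuot h v j‖ ^ 2 ≤ L * M ^ 2 := by
    calc h * ∑ j, ‖diffQuot h v j‖ ^ 2 ≤ h * ∑ _j : Fin (J + 1), M ^ 2 := by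
          gcongr with j; exact H j
      _ = L * M ^ 2 := by simp [← hL]; ring
  rw [seminormH1]
  refine (Real.sqrt_le_sqrt this).trans (le_of_eq ?_)
  rw [Real.sqrt_mul (by rw [← hL]; positivity), Real.sqrt_sq hM]

theorem norm_diffQuot_mul_le (v w : Grid J) (j : Fin (J + 1)) :
    ‖diffQuot h (v * w) j‖ ≤ ‖w‖ * ‖diffQuot h v j‖ + ‖v‖ * ‖diffQuot h w j‖ := by
  have e : diffQuot h (v * w) j
      = w j.succ * diffQuot h v j + v j.castSucc * diffQuot h w j := by
    simp [diffQuot]; ring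
  rw [e]
  refine (norm_add_le _ _).trans ?_
  rw [norm_mul, norm_mul]
  gcongr
  · exact norm_le_pi_norm w _
  · exact norm_le_pi_norm v _

theorem seminormH1_mul_le (hh : 0 ≤ h) (v w : Grid J) :
    seminormH1 h (v * w) ≤ ‖w‖ * seminormH1 h v + ‖v‖ * seminormH1 h w :=
  seminormH1_le_of_diffQuot hh (norm_nonneg _) (norm_nonneg _) (norm_diffQuot_mul_le v w)

/-- Maximum norm plus `H¹` seminorm. -/
noncomputable def gridNorm (h : ℝ) (v : Grid J) : ℝ := ‖v‖ + seminormH1 h v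

theorem gridNorm_nonneg (v : Grid J) : 0 ≤ gridNorm h v :=
  add_nonneg (norm_nonneg _) (seminormH1_nonneg _)

theorem norm_le_gridNorm (v : Grid J) : ‖v‖ ≤ gridNorm h v :=
  le_add_of_nonneg_right (seminormH1_nonneg _)

theorem norm_apply_le_gridNorm (v : Grid J) (j) : ‖v j‖ ≤ gridNorm h v :=
  (norm_le_pi_norm v j).trans (norm_le_gridNorm v)

theorem seminormH1_le_gridNorm (v : Grid J) : seminormH1 h v ≤ gridNorm h v :=
  le_add_of_nonneg_left (norm_nonneg _)

/-- The linear embedding whose norm is `gridNorm`. -/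
noncomputable def gridEmb (h : ℝ) (J : ℕ) :
    Grid J →ₗ[ℂ] WithLp 1 (Grid J × EuclideanSpace ℂ (Fin (J + 1))) :=
  (WithLp.linearEquiv 1 ℂ (Grid J × EuclideanSpace ℂ (Fin (J + 1)))).symm.toLinearMap ∘ₗ
    (LinearMap.id.prod (gradL h J))

theorem norm_gridEmb (hh : 0 ≤ h) (v : Grid J) : ‖gridEmb h J v‖ = gridNorm h v := by
  rw [WithLp.prod_norm_eq_of_L1, gridNorm, ← norm_gradL hh]
  rfl

theorem gridNorm_add_le (hh : 0 ≤ h) (v w : Grid J) :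
    gridNorm h (v + w) ≤ gridNorm h v + gridNorm h w := by
  simp only [← norm_gridEmb hh, map_add]; exact norm_add_le _ _

theorem gridNorm_sub_le (hh : 0 ≤ h) (v w : Grid J) :
    gridNorm h (v - w) ≤ gridNorm h v + gridNorm h w := by
  simp only [← norm_gridEmb hh, map_sub]; exact norm_sub_le _ _

theorem gridNorm_sub_comm (hh : 0 ≤ h) (v w : Grid J) :
    gridNorm h (v - w) = gridNorm h (w - v) := by
  simp only [← norm_gridEmb hh, map_sub]; exact norm_sub_rev _ _

theorem gridNorm_smul (hh : 0 ≤ h) (c : ℂ) (v : Grid J) :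
    gridNorm h (c • v) = ‖c‖ * gridNorm h v := by
  simp only [← norm_gridEmb hh, map_smul, norm_smul]

@[simp] theorem gridNorm_zero : gridNorm h (0 : Grid J) = 0 := by
  simp [gridNorm, seminormH1, diffQuot]

/-- By the Leibniz rule the seminorm of a product is bounded by the two mixed products of maximum
norm and seminorm, which are terms of the expanded right-hand side. Submultiplicativity with
constant 1, for grid functions with any end values, is the reason for working with `gridNorm`. -/
theorem gridNorm_mul_le (hh : 0 ≤ h) (v w : Grid J) :
    gridNorm h (v * w) ≤ gridNorm h v * gridNorm h w := by
  have h1 := seminormH1_mul_le hh v w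
  have h2 : ‖v * w‖ ≤ ‖v‖ * ‖w‖ := norm_mul_le v w
  have h3 := mul_nonneg (seminormH1_nonneg (h := h) v) (seminormH1_nonneg (h := h) w)
  unfold gridNorm
  nlinarith

theorem gridNorm_avg_le (hh : 0 ≤ h) (v w : Grid J) :
    gridNorm h (avg v w) ≤ (gridNorm h v + gridNorm h w) / 2 := by
  rw [avg_eq, gridNorm_smul hh]
  have := gridNorm_add_le hh v w
  norm_num
  linarith

theorem gridNorm_conj (v : Grid J) : gridNorm h (fun j => conj (v j)) = gridNorm h v := by
  have e : ∀ j, ‖diffQuot h (fun j => conj (v j)) j‖ = ‖diffQuot h v j‖ := by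
    intro j
    rw [← Complex.norm_conj]
    simp [diffQuot]
  have e2 : ‖(fun j => conj (v j) : Grid J)‖ = ‖v‖ := by
    simp [Pi.norm_def]
  simp only [gridNorm, seminormH1, e, e2]

/-- The mean value inequality for grid functions. -/
theorem gridNorm_sub_le_of_hasDerivWithinAt (hh : 0 ≤ h) {φ φ' : ℝ → Grid J} {a b C : ℝ}
    (hφ : ∀ t ∈ Icc a b, ∀ j, HasDerivWithinAt (fun s => φ s j) (φ' t j) (Icc a b) t)
    (hC : ∀ t ∈ Icc a b, gridNorm h (φ' t) ≤ C) {s t : ℝ} (hs : s ∈ Icc a b) (ht : t ∈ Icc a b) :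
    gridNorm h (φ t - φ s) ≤ C * |t - s| := by
  -- `gridNorm` is the norm pulled back along a linear embedding into a normed space, where the
  -- usual mean value inequality applies.
  let E : Grid J →L[ℝ] WithLp 1 (Grid J × EuclideanSpace ℂ (Fin (J + 1))) :=
    LinearMap.toContinuousLinearMap ((gridEmb h J).restrictScalars ℝ)
  have hE : ∀ v, E v = gridEmb h J v := fun _ => rfl
  have := (convex_Icc a b).norm_image_sub_le_of_norm_hasDerivWithin_le
    (f := fun s => E (φ s)) (f' := fun s => E (φ' s)) (C := C)
    (fun x hx => E.hasFDerivAt.comp_hasDerivWithinAt x (hasDerivWithinAt_pi.2 (hφ x hx)))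
    (fun x hx => by rw [hE, norm_gridEmb hh]; exact hC x hx) hs ht
  rw [hE, hE, ← map_sub, norm_gridEmb hh] at this
  exact this

/-- The discrete Sobolev inequality. -/
theorem norm_apply_le_sqrt_mul_seminormH1 {L : ℝ} (hh : 0 < h) (hL : h * (J + 1) = L)
    {v : Grid J} (hv : v 0 = 0) (j : Fin (J + 2)) : ‖v j‖ ≤ √L * seminormH1 h v := by
  -- Telescoping from the left end, the only place where a boundary value is needed; Cauchy–Schwarz
  -- then finishes.
  have h1 : ∀ j : Fin (J + 2), ‖v j‖ ≤ ∑ k : Fin (J + 1), if (k : ℕ) < j then h * ‖diffQuot h v k‖ else 0 := by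
    intro j
    induction j using Fin.induction with
    | zero => simp [hv]
    | succ i ih =>
      have e : v i.succ = v i.castSucc + h * diffQuot h v i := by
        have : (h : ℂ) ≠ 0 := by exact_mod_cast hh.ne'
        simp [diffQuot]; field_simp; ring
      rw [e]
      refine (norm_add_le _ _).trans ?_
      have : ∑ k : Fin (J + 1), (if (k : ℕ) < i.succ then h * ‖diffQuot h v k‖ else 0)
          = (∑ k : Fin (J + 1), (if (k : ℕ) < i.castSucc then h * ‖diffQuot h v k‖ else 0))
            + ∑ k : Fin (J + 1), (if k = i then h * ‖diffQuot h v k‖ else 0) := by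
        rw [← Finset.sum_add_distrib]
        refine Finset.sum_congr rfl fun k _ => ?_
        rcases lt_trichotomy (k : ℕ) i with hk | hk | hk
        · have : k ≠ i := by intro h; simp [h] at hk
          simp [hk, this, Nat.lt_succ_of_lt hk]
        · have : k = i := Fin.ext hk
          simp [this]
        · have : k ≠ i := by intro h; simp [h] at hk
          simp [this, hk.not_gt]
          intro h3; omega
      rw [this]
      refine add_le_add ih ?_
      simp [abs_of_pos hh]
  refine (h1 j).trans ?_
  have h2 : ∑ k : Fin (J + 1), (if (k : ℕ) < j then h * ‖diffQuot h v k‖ else 0)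
      ≤ ∑ k : Fin (J + 1), √h * (√h * ‖diffQuot h v k‖) := by
    refine Finset.sum_le_sum fun k _ => ?_
    rw [← mul_assoc, Real.mul_self_sqrt hh.le]
    split_ifs
    · exact le_rfl
    · positivity
  refine h2.trans ((Real.sum_mul_le_sqrt_mul_sqrt _ _ _).trans (le_of_eq ?_))
  rw [seminormH1, Finset.mul_sum]
  congr 2
  · simp [Real.sq_sqrt hh.le, ← hL]; ring
  · simp [mul_pow, Real.sq_sqrt hh.le]

/-- Energy estimates control only the H¹ seminorm; the Sobolev inequality upgrades them to
`gridNorm`, with a constant depending on the interval alone. -/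
theorem gridNorm_le_of_vanishesAtEnds {L : ℝ} (hh : 0 < h) (hL : h * (J + 1) = L)
    {v : Grid J} (hv : VanishesAtEnds v) : gridNorm h v ≤ (√L + 1) * seminormH1 h v := by
  have : ‖v‖ ≤ √L * seminormH1 h v :=
    (pi_norm_le_iff_of_nonneg (mul_nonneg (Real.sqrt_nonneg _) (seminormH1_nonneg _))).2
      (norm_apply_le_sqrt_mul_seminormH1 hh hL hv.1)
  unfold gridNorm; linarith

theorem seminormH1_le_normH1 (v : Grid J) : seminormH1 h v ≤ normH1 h v := by
  unfold normH1
  exact Real.le_sqrt_of_sq_le (by nlinarith [sq_nonneg (normL2 h v)])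

theorem normH1_le_gridNorm {L : ℝ} (hh : 0 < h) (hL : h * (J + 1) = L) (v : Grid J) :
    normH1 h v ≤ (√(2 * L) + 1) * gridNorm h v := by
  have hL0 : 0 < L := by rw [← hL]; positivity
  have h1 : normL2 h v ≤ √(2 * L) * ‖v‖ := by
    rw [normL2]
    -- There are J + 2 nodes, so their total weight is h(J + 2), which exceeds L but not 2L.
    have : h * ∑ j, ‖v j‖ ^ 2 ≤ 2 * L * ‖v‖ ^ 2 := by
      calc h * ∑ j, ‖v j‖ ^ 2 ≤ h * ∑ _j : Fin (J + 2), ‖v‖ ^ 2 := by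
            gcongr with j; exact norm_le_pi_norm v j
        _ = (h * (J + 2)) * ‖v‖ ^ 2 := by simp; ring
        _ ≤ 2 * L * ‖v‖ ^ 2 := by
            refine mul_le_mul_of_nonneg_right ?_ (sq_nonneg _)
            rw [← hL]; nlinarith [Nat.cast_nonneg (α := ℝ) J]
    refine (Real.sqrt_le_sqrt this).trans (le_of_eq ?_)
    rw [Real.sqrt_mul (by positivity), Real.sqrt_sq (norm_nonneg _)]
  have h2 : normH1 h v ≤ normL2 h v + seminormH1 h v := by
    unfold normH1
    refine Real.sqrt_le_iff.2 ⟨add_nonneg (Real.sqrt_nonneg _) (seminormH1_nonneg v), ?_⟩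
    have : 0 ≤ normL2 h v * seminormH1 h v :=
      mul_nonneg (Real.sqrt_nonneg _) (Real.sqrt_nonneg _)
    nlinarith
  have h3 := Real.sqrt_nonneg (2 * L)
  have h4 := seminormH1_nonneg (h := h) v
  have h5 := norm_nonneg v
  unfold gridNorm
  nlinarith

/-- Summation by parts. -/
theorem sum_conj_mul_laplacian (hh : h ≠ 0) {s : Grid J} (hs : VanishesAtEnds s) (y : Grid J) :
    ∑ j, conj (s j) * laplacian h y j = -∑ j, conj (diffQuot h s j) * diffQuot h y j := by
  have hc : (h : ℂ) ≠ 0 := by exact_mod_cast hh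
  have e1 : ∑ j, conj (s j) * laplacian h y j
      = ∑ i : Fin J, conj (s i.succ.castSucc) * ((diffQuot h y i.succ - diffQuot h y i.castSucc) / h) := by
    rw [sum_grid]
    simp only [laplacian_zero_node, laplacian_last_node, mul_zero, zero_add, add_zero]
    refine Finset.sum_congr rfl fun i _ => ?_
    simp [diffQuot]; field_simp; ring_nf; simp
  have e2 : ∑ j, conj (diffQuot h s j) * diffQuot h y j
      = (∑ j : Fin (J + 1), conj (s j.succ) * diffQuot h y j) / h
        - (∑ j : Fin (J + 1), conj (s j.castSucc) * diffQuot h y j) / h := by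
    rw [Finset.sum_div, Finset.sum_div, ← Finset.sum_sub_distrib]
    refine Finset.sum_congr rfl fun i _ => ?_
    simp [diffQuot]; field_simp
  rw [e1, e2, Fin.sum_univ_castSucc, Fin.sum_univ_succ (fun j : Fin (J + 1) => conj (s j.castSucc) * _)]
  have z1 : s (Fin.last J).succ = 0 := hs.2
  have z2 : s (0 : Fin (J + 1)).castSucc = 0 := hs.1
  simp only [z1, z2, map_zero, zero_mul, add_zero, zero_add]
  rw [Finset.sum_div, Finset.sum_div, ← Finset.sum_sub_distrib, ← Finset.sum_neg_distrib]
  refine Finset.sum_congr rfl fun i _ => ?_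
  rw [← Fin.succ_castSucc]
  ring

theorem inner_gradL (hh : 0 < h) {s : Grid J} (hs : VanishesAtEnds s) (y : Grid J) :
    inner ℂ (gradL h J s) (gradL h J y) = -(h * ∑ j, conj (s j) * laplacian h y j) := by
  rw [sum_conj_mul_laplacian hh.ne' hs, PiLp.inner_apply, mul_neg, neg_neg, Finset.mul_sum]
  refine Finset.sum_congr rfl fun j _ => ?_
  have : (√h : ℂ) * √h = h := by exact_mod_cast Real.mul_self_sqrt hh.le
  simp only [gradL_apply, RCLike.inner_apply, map_mul, Complex.conj_ofReal]
  rw [← this]; ring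

/-- Stability of the Crank-Nicolson step in the `H¹` seminorm, with two kinds of perturbation. -/
theorem seminormH1_step_le (hh : 0 < h) {κ : ℝ} {z z' b p : Grid J}
    (H : z' - z - b = (Complex.I * κ) • laplacian h (avg z' z - p)) :
    seminormH1 h z' ≤ seminormH1 h z + seminormH1 h b + 2 * seminormH1 h p := by
  set s := z' - z - b with hs
  -- The argument of the Laplacian is m + s/2, and s is iκ times its Laplacian. Summation by parts
  -- makes Re⟨∇s, ∇(m + s/2)⟩ vanish, that is |m + s| = |m| in the H¹ seminorm. Since z' = (m + s) +
  -- b/2 + p, the perturbation b is paid for once and p twice.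
  set m := z + (1 / 2 : ℂ) • b - p with hm
  -- Being a multiple of a discrete Laplacian, s vanishes at the ends; nothing of the kind is
  -- required of z, z', b or p.
  have hsX : VanishesAtEnds s := by
    rw [H]; exact (vanishesAtEnds_laplacian _).smul _
  have hy : avg z' z - p = m + (1 / 2 : ℂ) • s := by
    rw [avg_eq, hm, hs]; module
  have hre : (inner ℂ (gradL h J s) (gradL h J (m + (1 / 2 : ℂ) • s))).re = 0 := by
    rw [← hy, inner_gradL hh hsX]
    have : ∀ j, conj (s j) * laplacian h (avg z' z - p) j
        = ((-κ * ‖laplacian h (avg z' z - p) j‖ ^ 2 : ℝ) : ℂ) * Complex.I := by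
      intro j
      rw [H]
      simp only [Pi.smul_apply, smul_eq_mul, map_mul, Complex.conj_I, Complex.conj_ofReal]
      push_cast
      rw [← Complex.conj_mul']
      ring
    simp only [this]
    rw [← Finset.sum_mul, ← Complex.ofReal_sum, ← mul_assoc, ← Complex.ofReal_mul]
    rw [Complex.neg_re, Complex.re_ofReal_mul, Complex.I_re, mul_zero, neg_zero]
  have hnorm : ‖gradL h J (s + m)‖ = ‖gradL h J m‖ := by
    have h1 : ‖gradL h J (s + m)‖ ^ 2 = ‖gradL h J m‖ ^ 2 := by
      rw [map_add, norm_add_sq (𝕜 := ℂ)]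
      rw [map_add, map_smul, inner_add_right, inner_smul_right, inner_self_eq_norm_sq_to_K] at hre
      have e : ((1 / 2 : ℂ) * ((‖gradL h J s‖ : ℝ) : ℂ) ^ 2).re = ‖gradL h J s‖ ^ 2 / 2 := by
        rw [show (1 / 2 : ℂ) * ((‖gradL h J s‖ : ℝ) : ℂ) ^ 2
          = ((‖gradL h J s‖ ^ 2 / 2 : ℝ) : ℂ) by push_cast; ring, Complex.ofReal_re]
      have hre' : (inner ℂ (gradL h J s) (gradL h J m)).re + ‖gradL h J s‖ ^ 2 / 2 = 0 := by
        rw [← e, ← Complex.add_re]; exact hre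
      change ‖gradL h J s‖ ^ 2 + 2 * (inner ℂ (gradL h J s) (gradL h J m)).re + _ = _
      linarith
    exact (sq_eq_sq₀ (norm_nonneg _) (norm_nonneg _)).1 h1
  rw [norm_gradL hh.le, norm_gradL hh.le] at hnorm
  have e : z' = (s + m) + ((1 / 2 : ℂ) • b + p) := by rw [hm, hs]; module
  have t1 : seminormH1 h z' ≤ seminormH1 h m + seminormH1 h ((1 / 2 : ℂ) • b + p) := by
    rw [← hnorm]; conv_lhs => rw [e]
    exact seminormH1_add_le hh.le _ _
  have t2 := seminormH1_add_le hh.le ((1 / 2 : ℂ) • b) p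
  have t3 := seminormH1_sub_le hh.le (z + (1 / 2 : ℂ) • b) p
  have t4 := seminormH1_add_le hh.le z ((1 / 2 : ℂ) • b)
  have t5 : seminormH1 h ((1 / 2 : ℂ) • b) = 1 / 2 * seminormH1 h b := by
    rw [seminormH1_smul hh.le]; norm_num
  rw [hm] at t1
  linarith

/-- The discrete elliptic estimate. -/
theorem seminormH1_le_laplacian {L q : ℝ} (hh : 0 < h) (hL : h * (J + 1) = L) (hq : 0 ≤ q)
    {v : Grid J} (hv : VanishesAtEnds v) (H : ∀ i : Fin J, ‖laplacian h v i.succ.castSucc‖ ≤ q) :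
    seminormH1 h v ≤ L * √L * q := by
  have hL0 : 0 < L := by rw [← hL]; positivity
  -- Testing the Laplacian with v itself; the Sobolev inequality bounds v pointwise, and one factor
  -- of the seminorm is divided out at the end.
  have h1 : seminormH1 h v ^ 2 ≤ L * √L * q * seminormH1 h v := by
    have e : ((seminormH1 h v : ℝ) : ℂ) ^ 2 = -(h * ∑ j, conj (v j) * laplacian h v j) := by
      rw [← inner_gradL hh hv, ← norm_gradL hh.le]
      exact (inner_self_eq_norm_sq_to_K (𝕜 := ℂ) (gradL h J v)).symm
    have e2 : seminormH1 h v ^ 2 = ‖-((h : ℂ) * ∑ j, conj (v j) * laplacian h v j)‖ := by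
      rw [← e, norm_pow, Complex.norm_real, Real.norm_of_nonneg (seminormH1_nonneg _)]
    rw [e2, norm_neg, norm_mul, Complex.norm_real, Real.norm_of_nonneg hh.le, sum_grid]
    simp only [laplacian_zero_node, laplacian_last_node, mul_zero, zero_add, add_zero]
    have h3 : ‖∑ i : Fin J, conj (v i.succ.castSucc) * laplacian h v i.succ.castSucc‖
        ≤ ∑ _i : Fin J, (√L * seminormH1 h v) * q := by
      refine norm_sum_le_of_le _ fun i _ => ?_
      rw [norm_mul, Complex.norm_conj]
      exact mul_le_mul (norm_apply_le_sqrt_mul_seminormH1 hh hL hv.1 _) (H i) (norm_nonneg _)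
        (mul_nonneg (Real.sqrt_nonneg _) (seminormH1_nonneg _))
    have h4 : 0 ≤ (√L * seminormH1 h v) * q :=
      mul_nonneg (mul_nonneg (Real.sqrt_nonneg _) (seminormH1_nonneg _)) hq
    calc _ ≤ h * ∑ _i : Fin J, (√L * seminormH1 h v) * q := by gcongr
      _ = h * J * ((√L * seminormH1 h v) * q) := by simp; ring
      _ ≤ L * ((√L * seminormH1 h v) * q) := by
          gcongr; rw [← hL]; linarith
      _ = _ := by ring
  rcases (seminormH1_nonneg (h := h) v).eq_or_lt with h0 | h0
  · rw [← h0]; positivity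
  · nlinarith

end Grid

/-! ### Composition with smooth functions -/

/-- A `C^k` function on `[0,∞)` extends to a `C^k` function on the real line. -/
theorem exists_contDiff_extension (k : ℕ) : ∀ g : ℝ → ℝ, ContDiffOn ℝ k g (Ici 0) →
    ∃ G : ℝ → ℝ, ContDiff ℝ k G ∧ ∀ x, 0 ≤ x → G x = g x := by
  induction k with
  | zero =>
    intro g hg
    refine ⟨fun x => g (max x 0), ?_, fun x hx => by simp [hx]⟩
    have h0 : ContinuousOn g (Ici 0) := hg.continuousOn
    refine contDiff_zero.2 (h0.comp_continuous (by fun_prop) fun x => ?_)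
    exact mem_Ici.2 (le_max_right x 0)
  | succ k ih =>
    intro g hg
    have hu : UniqueDiffOn ℝ (Ici (0 : ℝ)) := uniqueDiffOn_Ici 0
    have hd := (contDiffOn_succ_iff_derivWithin (n := (k : WithTop ℕ∞)) (f := g) hu).1
      (by exact_mod_cast hg)
    -- The derivative is extended first, by induction; the primitive of its extension with value
    -- g(0) at 0 agrees with g on the half line because the difference has zero derivative there.
    obtain ⟨H, hH, hHg⟩ := ih _ hd.2.2
    have hHc : Continuous H := hH.continuous
    have hder : ∀ x, HasDerivAt (fun x => g 0 + ∫ s in (0 : ℝ)..x, H s) (H x) x := fun x =>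
      (intervalIntegral.integral_hasDerivAt_right (hHc.intervalIntegrable _ _)
        hHc.stronglyMeasurable.stronglyMeasurableAtFilter hHc.continuousAt).const_add _
    refine ⟨fun x => g 0 + ∫ s in (0 : ℝ)..x, H s, ?_, fun x hx => ?_⟩
    · have : ContDiff ℝ ((k : WithTop ℕ∞) + 1) (fun x => g 0 + ∫ s in (0 : ℝ)..x, H s) := by
        refine contDiff_succ_iff_deriv.2 ⟨fun x => (hder x).differentiableAt, by simp, ?_⟩
        rw [show deriv (fun x => g 0 + ∫ s in (0 : ℝ)..x, H s) = H from
          funext fun x => (hder x).deriv]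
        exact hH
      exact_mod_cast this
    · have h1 : ∀ y ∈ Ici (0 : ℝ), HasDerivWithinAt
          (fun x => (g 0 + ∫ s in (0 : ℝ)..x, H s) - g x) 0 (Ici 0) y := by
        intro y hy
        have := (hder y).hasDerivWithinAt.sub (s := Ici 0) (hd.1 y hy).hasDerivWithinAt
        rwa [hHg y hy, sub_self] at this
      have h2 := (convex_Ici (0 : ℝ)).norm_image_sub_le_of_norm_hasDerivWithin_le (C := 0)
        h1 (fun y _ => by simp) (mem_Ici.2 le_rfl) (mem_Ici.2 hx)
      simp at h2
      linarith

/-- A four point estimate for differences of differences. -/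
theorem abs_sub_sub_sub_le {g g' : ℝ → ℝ} {K A B : ℝ}
    (hg : ∀ x, HasDerivAt g (g' x) x) (hA : ∀ x ∈ Icc (-K) K, |g' x| ≤ A)
    (hB : ∀ x ∈ Icc (-K) K, ∀ y ∈ Icc (-K) K, |g' x - g' y| ≤ B * |x - y|) (hB0 : 0 ≤ B)
    {a a' b b' : ℝ} (ha : a ∈ Icc (-K) K) (ha' : a' ∈ Icc (-K) K) (hb : b ∈ Icc (-K) K)
    (hb' : b' ∈ Icc (-K) K) :
    |g a' - g a - (g b' - g b)|
      ≤ A * |(a' - a) - (b' - b)| + B * |b' - b| * (|a - b| + |a' - b'|) := by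
  -- The double difference is the increment of this function of s. Its derivative splits into g'
  -- times the difference of the two increments, plus a difference of values of g' times b' − b.
  have hd : ∀ s ∈ Icc (0 : ℝ) 1, HasDerivWithinAt
      (fun s => g (a + s * (a' - a)) - g (b + s * (b' - b)))
      (g' (a + s * (a' - a)) * (a' - a) - g' (b + s * (b' - b)) * (b' - b)) (Icc 0 1) s := by
    intro s _
    have l : ∀ c d : ℝ, HasDerivAt (fun s => c + s * d) d s := fun c d => by
      simpa using ((hasDerivAt_id s).mul_const d).const_add c
    exact (((hg _).comp s (l a (a' - a))).sub ((hg _).comp s (l b (b' - b)))).hasDerivWithinAt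
  have hmem : ∀ s ∈ Icc (0 : ℝ) 1, ∀ c ∈ Icc (-K) K, ∀ c' ∈ Icc (-K) K,
      c + s * (c' - c) ∈ Icc (-K) K := by
    intro s hs c hc c' hc'
    have := (convex_Icc (-K) K).add_smul_sub_mem hc hc' hs
    simpa [smul_eq_mul] using this
  have hbound : ∀ s ∈ Icc (0 : ℝ) 1,
      ‖g' (a + s * (a' - a)) * (a' - a) - g' (b + s * (b' - b)) * (b' - b)‖
        ≤ A * |(a' - a) - (b' - b)| + B * |b' - b| * (|a - b| + |a' - b'|) := by
    intro s hs
    have e : g' (a + s * (a' - a)) * (a' - a) - g' (b + s * (b' - b)) * (b' - b)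
        = g' (a + s * (a' - a)) * ((a' - a) - (b' - b))
          + (g' (a + s * (a' - a)) - g' (b + s * (b' - b))) * (b' - b) := by ring
    rw [e, Real.norm_eq_abs]
    refine (abs_add_le _ _).trans ?_
    rw [abs_mul, abs_mul]
    have h1 := hA _ (hmem s hs a ha a' ha')
    have h2 := hB _ (hmem s hs a ha a' ha') _ (hmem s hs b hb b' hb')
    have h3 : |a + s * (a' - a) - (b + s * (b' - b))| ≤ |a - b| + |a' - b'| := by
      have e : a + s * (a' - a) - (b + s * (b' - b)) = (1 - s) * (a - b) + s * (a' - b') := by ring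
      rw [e]
      refine (abs_add_le _ _).trans ?_
      rw [abs_mul, abs_mul, abs_of_nonneg hs.1, abs_of_nonneg (sub_nonneg.2 hs.2)]
      nlinarith [abs_nonneg (a - b), abs_nonneg (a' - b'), hs.1, hs.2]
    have h4 : |g' (a + s * (a' - a)) - g' (b + s * (b' - b))| * |b' - b|
        ≤ B * |b' - b| * (|a - b| + |a' - b'|) := by
      calc _ ≤ (B * (|a - b| + |a' - b'|)) * |b' - b| := by
            gcongr; exact h2.trans (by gcongr)
        _ = _ := by ring
    exact add_le_add (by gcongr) h4
  have := (convex_Icc (0 : ℝ) 1).norm_image_sub_le_of_norm_hasDerivWithin_le hd hbound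
    (left_mem_Icc.2 zero_le_one) (right_mem_Icc.2 zero_le_one)
  simp only [one_mul, zero_mul, add_zero, Real.norm_eq_abs, sub_zero, abs_one, mul_one] at this
  refine le_trans (le_of_eq ?_) this
  congr 1
  ring_nf

variable {J : ℕ} {h : ℝ}

/-- A real grid function as a complex one. -/
def toGrid (a : Fin (J + 2) → ℝ) : Grid J := fun j => (a j : ℂ)

theorem mem_Icc_of_gridNorm_le {a : Fin (J + 2) → ℝ} {R : ℝ} (ha : gridNorm h (toGrid a) ≤ R)
    (j : Fin (J + 2)) : a j ∈ Icc (-R) R := by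
  have := (norm_apply_le_gridNorm (h := h) (toGrid a) j).trans ha
  rw [toGrid, Complex.norm_real, Real.norm_eq_abs, abs_le] at this
  exact this

theorem gridNorm_const (c : ℂ) : gridNorm h (fun _ => c : Grid J) = ‖c‖ := by
  have : seminormH1 h (fun _ => c : Grid J) = 0 := by simp [seminormH1, diffQuot]
  rw [gridNorm, this, add_zero]
  exact pi_norm_const c

/-- Composition with a `C^{1,1}` function is Lipschitz on bounded sets. -/
theorem gridNorm_comp_sub_le (hh : 0 < h) {g g' : ℝ → ℝ} {R A B : ℝ}
    (hg : ∀ x, HasDerivAt g (g' x) x) (hA : ∀ x ∈ Icc (-R) R, |g' x| ≤ A)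
    (hB : ∀ x ∈ Icc (-R) R, ∀ y ∈ Icc (-R) R, |g' x - g' y| ≤ B * |x - y|) (hB0 : 0 ≤ B)
    (hA0 : 0 ≤ A) {a b : Fin (J + 2) → ℝ} (ha : gridNorm h (toGrid a) ≤ R)
    (hb : gridNorm h (toGrid b) ≤ R) :
    gridNorm h (toGrid (fun j => g (a j)) - toGrid (fun j => g (b j)))
      ≤ (A + 2 * B * R) * gridNorm h (toGrid a - toGrid b) := by
  have ha' := mem_Icc_of_gridNorm_le ha
  have hb' := mem_Icc_of_gridNorm_le hb
  set d := toGrid a - toGrid b with hd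
  have hdj : ∀ j, |a j - b j| ≤ ‖d‖ := fun j => by
    have := norm_le_pi_norm d j
    rwa [hd, Pi.sub_apply, toGrid, toGrid, ← Complex.ofReal_sub, Complex.norm_real] at this
  have hsup : ‖toGrid (fun j => g (a j)) - toGrid (fun j => g (b j))‖ ≤ A * ‖d‖ := by
    refine (pi_norm_le_iff_of_nonneg (by positivity)).2 fun j => ?_
    rw [Pi.sub_apply, toGrid, toGrid, ← Complex.ofReal_sub, Complex.norm_real]
    have := (convex_Icc (-R) R).norm_image_sub_le_of_norm_hasDerivWithin_le (f := g)
      (fun x _ => (hg x).hasDerivWithinAt) hA (hb' j) (ha' j)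
    exact this.trans (mul_le_mul_of_nonneg_left (hdj j) hA0)
  -- The four point estimate at two neighbouring nodes, divided by h: a and b supply the rows, the
  -- two nodes the columns.
  have hsem : seminormH1 h (toGrid (fun j => g (a j)) - toGrid (fun j => g (b j)))
      ≤ A * seminormH1 h d + (2 * B * ‖d‖) * seminormH1 h (toGrid b) := by
    refine seminormH1_le_of_diffQuot hh.le hA0 (by positivity) fun j => ?_
    have h4 := abs_sub_sub_sub_le hg hA hB hB0 (ha' j.castSucc) (ha' j.succ) (hb' j.castSucc)
      (hb' j.succ)
    have e1 : ∀ x : ℝ, ‖((x : ℝ) : ℂ) / (h : ℂ)‖ = |x| / h := fun x => by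
      rw [norm_div, Complex.norm_real, Complex.norm_real, Real.norm_eq_abs, Real.norm_eq_abs,
        abs_of_pos hh]
    have n1 : diffQuot h (toGrid (fun j => g (a j)) - toGrid (fun j => g (b j))) j
        = ((g (a j.succ) - g (a j.castSucc) - (g (b j.succ) - g (b j.castSucc)) : ℝ) : ℂ) / h := by
      simp [diffQuot, toGrid]; ring
    have n2 : diffQuot h d j
        = (((a j.succ - a j.castSucc) - (b j.succ - b j.castSucc) : ℝ) : ℂ) / h := by
      simp [diffQuot, toGrid, hd]; ring
    have n3 : diffQuot h (toGrid b) j = ((b j.succ - b j.castSucc : ℝ) : ℂ) / h := by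
      simp [diffQuot, toGrid]
    rw [n1, n2, n3, e1, e1, e1, ← mul_div_assoc, ← mul_div_assoc, ← add_div]
    gcongr
    refine h4.trans (add_le_add le_rfl ?_)
    have := hdj j.succ
    have := hdj j.castSucc
    have := mul_nonneg hB0 (abs_nonneg (b j.succ - b j.castSucc))
    nlinarith
  have h5 : seminormH1 h (toGrid b) ≤ R := (seminormH1_le_gridNorm _).trans hb
  have h6 : (2 * B * ‖d‖) * seminormH1 h (toGrid b) ≤ 2 * B * R * ‖d‖ := by
    calc _ ≤ (2 * B * ‖d‖) * R := by gcongr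
      _ = _ := by ring
  have h7 : 0 ≤ 2 * B * R * seminormH1 h d := by
    have : 0 ≤ R := (gridNorm_nonneg _).trans hb
    have := seminormH1_nonneg (h := h) d
    positivity
  unfold gridNorm
  nlinarith

theorem exists_bound_on_Icc {g : ℝ → ℝ} (hg : Continuous g) (R : ℝ) :
    ∃ A, 0 ≤ A ∧ ∀ x ∈ Icc (-R) R, |g x| ≤ A := by
  obtain ⟨A, hA⟩ := isCompact_Icc.exists_bound_of_continuousOn (s := Icc (-R) R) hg.continuousOn
  exact ⟨max A 0, le_max_right _ _, fun x hx => (hA x hx).trans (le_max_left _ _)⟩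

theorem exists_lipschitz_on_Icc {g g' : ℝ → ℝ} (hg : ∀ x, HasDerivAt g (g' x) x)
    (hc : Continuous g') (R : ℝ) :
    ∃ B, 0 ≤ B ∧ ∀ x ∈ Icc (-R) R, ∀ y ∈ Icc (-R) R, |g x - g y| ≤ B * |x - y| := by
  obtain ⟨B, hB0, hB⟩ := exists_bound_on_Icc hc R
  exact ⟨B, hB0, fun x hx y hy => (convex_Icc (-R) R).norm_image_sub_le_of_norm_hasDerivWithin_le
      (fun z _ => (hg z).hasDerivWithinAt) hB hy hx⟩

theorem gridNorm_segment_le (hh : 0 ≤ h) {v w : Grid J} {R : ℝ} (hv : gridNorm h v ≤ R)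
    (hw : gridNorm h w ≤ R) {s : ℝ} (hs : s ∈ Icc (0 : ℝ) 1) :
    gridNorm h ((1 - s : ℂ) • v + (s : ℂ) • w) ≤ R := by
  refine (gridNorm_add_le hh _ _).trans ?_
  rw [gridNorm_smul hh, gridNorm_smul hh, ← Complex.ofReal_one, ← Complex.ofReal_sub,
    Complex.norm_real, Complex.norm_real, Real.norm_of_nonneg hs.1,
    Real.norm_of_nonneg (sub_nonneg.2 hs.2)]
  nlinarith [hs.1, hs.2]

/-- Composition with a `C^3` function: Lipschitz bounds for the function and for differences, on
bounded sets of real grid functions. -/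
theorem exists_comp_bounds {g : ℝ → ℝ} (hg : ContDiff ℝ 3 g) (R : ℝ) :
    ∃ M, 0 ≤ M ∧ ∀ (J : ℕ) (h : ℝ), 0 < h →
      (∀ a b : Fin (J + 2) → ℝ, gridNorm h (toGrid a) ≤ R → gridNorm h (toGrid b) ≤ R →
        gridNorm h (toGrid (fun j => g (a j)) - toGrid (fun j => g (b j)))
          ≤ M * gridNorm h (toGrid a - toGrid b)) ∧
      ∀ a a' b b' : Fin (J + 2) → ℝ, gridNorm h (toGrid a) ≤ R → gridNorm h (toGrid a') ≤ R →
        gridNorm h (toGrid b) ≤ R → gridNorm h (toGrid b') ≤ R →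
        gridNorm h (toGrid (fun j => g (a' j)) - toGrid (fun j => g (a j))
            - (toGrid (fun j => g (b' j)) - toGrid (fun j => g (b j))))
          ≤ M * (gridNorm h (toGrid a' - toGrid a - (toGrid b' - toGrid b))
            + gridNorm h (toGrid a' - toGrid a)
              * (gridNorm h (toGrid a - toGrid b) + gridNorm h (toGrid a' - toGrid b'))) := by
  have c1 : ContDiff ℝ 2 (deriv g) := by
    have : ContDiff ℝ (2 + 1) g := by norm_num; exact hg
    exact (contDiff_succ_iff_deriv.1 this).2.2
  have c2 : ContDiff ℝ 1 (deriv (deriv g)) := by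
    have : ContDiff ℝ (1 + 1) (deriv g) := by norm_num; exact c1
    exact (contDiff_succ_iff_deriv.1 this).2.2
  have d0 : ∀ x, HasDerivAt g (deriv g x) x := fun x =>
    (hg.differentiable (by norm_num) x).hasDerivAt
  have d1 : ∀ x, HasDerivAt (deriv g) (deriv (deriv g) x) x := fun x =>
    (c1.differentiable (by norm_num) x).hasDerivAt
  have d2 : ∀ x, HasDerivAt (deriv (deriv g)) (deriv (deriv (deriv g)) x) x := fun x =>
    (c2.differentiable (by norm_num) x).hasDerivAt
  obtain ⟨A, hA0, hA⟩ := exists_bound_on_Icc c1.continuous R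
  obtain ⟨A', hA'0, hA'⟩ := exists_bound_on_Icc c2.continuous R
  obtain ⟨B, hB0, hB⟩ := exists_lipschitz_on_Icc d1 c2.continuous R
  obtain ⟨B', hB'0, hB'⟩ := exists_lipschitz_on_Icc d2 (c2.continuous_deriv (by norm_num)) R
  -- For negative R there are no admissible grid functions; below, 0 has to lie in [−R, R].
  rcases lt_or_ge R 0 with hR | hR
  · exact ⟨0, le_rfl, fun J h _ => ⟨fun a b ha _ =>
        absurd (ha.trans_lt hR) (not_lt.2 (gridNorm_nonneg _)), fun a _ _ _ ha _ _ _ =>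
        absurd (ha.trans_lt hR) (not_lt.2 (gridNorm_nonneg _))⟩⟩
  set K := A' + 2 * B' * R with hK
  have hK0 : 0 ≤ K := by positivity
  set M₀ := A + 2 * B * R with hM₀
  have hM₀0 : 0 ≤ M₀ := by positivity
  refine ⟨M₀ + K + (K * R + A), by positivity, fun J h hh => ⟨fun a b ha hb => ?_, ?_⟩⟩
  · refine (gridNorm_comp_sub_le hh d0 hA hB hB0 hA0 ha hb).trans ?_
    refine mul_le_mul_of_nonneg_right ?_ (gridNorm_nonneg _)
    have : 0 ≤ K * R + A := by positivity
    linarith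
  intro a a' b b' ha ha' hb hb'
  -- The second bound is the mean value inequality in `gridNorm` along the two segments. The
  -- derivative contains g'(pa) − g'(pb), and estimating this in `gridNorm` takes a Lipschitz bound
  -- for g'', whence the C³ assumption.
  let pa : ℝ → Fin (J + 2) → ℝ := fun s j => a j + s * (a' j - a j)
  let pb : ℝ → Fin (J + 2) → ℝ := fun s j => b j + s * (b' j - b j)
  have seg : ∀ c c' : Fin (J + 2) → ℝ, ∀ s : ℝ,
      toGrid (fun j => c j + s * (c' j - c j)) = (1 - s : ℂ) • toGrid c + (s : ℂ) • toGrid c' := by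
    intro c c' s; ext j; simp [toGrid]; ring
  have hpa : ∀ s ∈ Icc (0 : ℝ) 1, gridNorm h (toGrid (pa s)) ≤ R := fun s hs => by
    rw [seg]; exact gridNorm_segment_le hh.le ha ha' hs
  have hpb : ∀ s ∈ Icc (0 : ℝ) 1, gridNorm h (toGrid (pb s)) ≤ R := fun s hs => by
    rw [seg]; exact gridNorm_segment_le hh.le hb hb' hs
  let φ : ℝ → Grid J := fun s => toGrid (fun j => g (pa s j)) - toGrid (fun j => g (pb s j))
  let φ' : ℝ → Grid J := fun s => toGrid (fun j => deriv g (pa s j)) * (toGrid a' - toGrid a)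
    - toGrid (fun j => deriv g (pb s j)) * (toGrid b' - toGrid b)
  set D := gridNorm h (toGrid a' - toGrid a - (toGrid b' - toGrid b))
  set δ := gridNorm h (toGrid a' - toGrid a)
  set E := gridNorm h (toGrid a - toGrid b) + gridNorm h (toGrid a' - toGrid b')
  have hE0 : 0 ≤ E := add_nonneg (gridNorm_nonneg _) (gridNorm_nonneg _)
  have hδ0 : 0 ≤ δ := gridNorm_nonneg _
  have hD0 : 0 ≤ D := gridNorm_nonneg _
  have hder : ∀ s ∈ Icc (0 : ℝ) 1, ∀ j,
      HasDerivWithinAt (fun s => φ s j) (φ' s j) (Icc 0 1) s := by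
    intro s _ j
    have l : ∀ c d : ℝ, HasDerivAt (fun s => c + s * d) d s := fun c d => by
      simpa using ((hasDerivAt_id s).mul_const d).const_add c
    have h1 := ((d0 _).comp s (l (a j) (a' j - a j))).ofReal_comp
    have h2 := ((d0 _).comp s (l (b j) (b' j - b j))).ofReal_comp
    refine (h1.sub h2).hasDerivWithinAt.congr_deriv ?_
    simp [φ', toGrid, pa, pb]
  have hbd : ∀ s ∈ Icc (0 : ℝ) 1, gridNorm h (φ' s) ≤ K * E * δ + (K * R + A) * D := by
    intro s hs
    have e : φ' s = (toGrid (fun j => deriv g (pa s j)) - toGrid (fun j => deriv g (pb s j)))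
          * (toGrid a' - toGrid a)
        + toGrid (fun j => deriv g (pb s j)) * (toGrid a' - toGrid a - (toGrid b' - toGrid b)) := by
      simp only [φ']; ring
    rw [e]
    refine (gridNorm_add_le hh.le _ _).trans (add_le_add ?_ ?_)
    · refine (gridNorm_mul_le hh.le _ _).trans ?_
      refine mul_le_mul_of_nonneg_right ?_ hδ0
      refine (gridNorm_comp_sub_le hh d1 hA' hB' hB'0 hA'0 (hpa s hs) (hpb s hs)).trans ?_
      refine mul_le_mul_of_nonneg_left ?_ hK0
      have e2 : toGrid (pa s) - toGrid (pb s) = (1 - s : ℂ) • (toGrid a - toGrid b)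
          + (s : ℂ) • (toGrid a' - toGrid b') := by
        rw [seg, seg]; module
      rw [e2]
      refine (gridNorm_add_le hh.le _ _).trans ?_
      rw [gridNorm_smul hh.le, gridNorm_smul hh.le, ← Complex.ofReal_one, ← Complex.ofReal_sub,
        Complex.norm_real, Complex.norm_real, Real.norm_of_nonneg hs.1,
        Real.norm_of_nonneg (sub_nonneg.2 hs.2)]
      have := gridNorm_nonneg (h := h) (toGrid a - toGrid b)
      have := gridNorm_nonneg (h := h) (toGrid a' - toGrid b')
      simp only [E]
      nlinarith [hs.1, hs.2]
    · refine (gridNorm_mul_le hh.le _ _).trans ?_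
      refine mul_le_mul_of_nonneg_right ?_ hD0
      -- Comparison with the zero grid function bounds g'(pb) itself: g'(0) plus a Lipschitz term.
      have z : gridNorm h (toGrid (fun _ => 0 : Fin (J + 2) → ℝ)) ≤ R := by
        have : (toGrid (fun _ => 0 : Fin (J + 2) → ℝ)) = 0 := by ext j; simp [toGrid]
        rw [this, gridNorm_zero]; exact hR
      have h1 := gridNorm_comp_sub_le hh d1 hA' hB' hB'0 hA'0 (hpb s hs) z
      have h2 : gridNorm h (toGrid (fun _ => deriv g 0 : Fin (J + 2) → ℝ)) ≤ A := by
        have := gridNorm_const (J := J) (h := h) ((deriv g 0 : ℝ) : ℂ)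
        rw [Complex.norm_real] at this
        exact this.le.trans (hA 0 ⟨by linarith, hR⟩)
      have h3 : toGrid (pb s) - toGrid (fun _ => 0 : Fin (J + 2) → ℝ) = toGrid (pb s) := by
        ext j; simp [toGrid]
      rw [h3] at h1
      have h4 := gridNorm_add_le hh.le (toGrid (fun j => deriv g (pb s j))
        - toGrid (fun _ => deriv g 0 : Fin (J + 2) → ℝ))
        (toGrid (fun _ => deriv g 0 : Fin (J + 2) → ℝ))
      rw [sub_add_cancel] at h4
      have h5 := mul_le_mul_of_nonneg_left (hpb s hs) hK0
      linarith
  have := gridNorm_sub_le_of_hasDerivWithinAt hh.le hder hbd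
    (left_mem_Icc.2 zero_le_one) (right_mem_Icc.2 zero_le_one)
  have e : φ 1 - φ 0 = toGrid (fun j => g (a' j)) - toGrid (fun j => g (a j))
      - (toGrid (fun j => g (b' j)) - toGrid (fun j => g (b j))) := by
    simp only [φ, pa, pb, one_mul, zero_mul, add_zero, add_sub_cancel]
    abel
  rw [e] at this
  have q1 : 0 ≤ (M₀ + K) * D := by positivity
  have q2 : 0 ≤ (M₀ + (K * R + A)) * (δ * E) := by positivity
  simp only [sub_zero, abs_one, mul_one] at this
  nlinarith

/-- The grid function `g(|v|²)`. -/
noncomputable def nonlin (g : ℝ → ℝ) (v : Grid J) : Grid J := toGrid fun j => g (‖v j‖ ^ 2)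

theorem toGrid_norm_sq (v : Grid J) :
    toGrid (fun j => ‖v j‖ ^ 2) = v * fun j => conj (v j) := by
  ext j
  simp [toGrid, Complex.mul_conj']

/-- Lipschitz bounds for `v ↦ g(|v|²)` and for its differences. -/
theorem exists_nonlin_bounds {g : ℝ → ℝ} (hg : ContDiffOn ℝ 3 g (Ici 0)) (R : ℝ) :
    ∃ M, 0 ≤ M ∧ ∀ (J : ℕ) (h : ℝ), 0 < h →
      (∀ u v : Grid J, gridNorm h u ≤ R → gridNorm h v ≤ R →
        gridNorm h (nonlin g u - nonlin g v) ≤ M * gridNorm h (u - v)) ∧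
      ∀ u u' v v' : Grid J, gridNorm h u ≤ R → gridNorm h u' ≤ R →
        gridNorm h v ≤ R → gridNorm h v' ≤ R →
        gridNorm h (nonlin g u' - nonlin g v' - (nonlin g u - nonlin g v))
          ≤ M * (gridNorm h (u' - v' - (u - v))
            + gridNorm h (u' - u) * (gridNorm h (u - v) + gridNorm h (u' - v'))) := by
  obtain ⟨G, hG, hGg⟩ := exists_contDiff_extension 3 g hg
  rcases lt_or_ge R 0 with hR | hR
  · exact ⟨0, le_rfl, fun J h _ => ⟨fun a b ha _ =>
        absurd (ha.trans_lt hR) (not_lt.2 (gridNorm_nonneg _)), fun a _ _ _ ha _ _ _ =>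
        absurd (ha.trans_lt hR) (not_lt.2 (gridNorm_nonneg _))⟩⟩
  obtain ⟨M, hM0, hM⟩ := exists_comp_bounds hG (R ^ 2)
  refine ⟨2 * M * R + (2 * M + 4 * M * R ^ 2), by positivity, fun J h hh => ?_⟩
  obtain ⟨H1, H2⟩ := hM J h hh
  let q : Grid J → Fin (J + 2) → ℝ := fun v j => ‖v j‖ ^ 2
  let c : Grid J → Grid J := fun v j => conj (v j)
  have hc : ∀ v, gridNorm h (c v) = gridNorm h v := gridNorm_conj
  have hcs : ∀ v w, c (v - w) = c v - c w := fun v w => by ext j; simp [c]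
  have hq : ∀ v, toGrid (q v) = v * c v := toGrid_norm_sq
  have hnl : ∀ v : Grid J, nonlin g v = toGrid fun j => G (q v j) := fun v => by
    ext j; simp [nonlin, toGrid, q, hGg _ (sq_nonneg ‖v j‖)]
  have hqR : ∀ v, gridNorm h v ≤ R → gridNorm h (toGrid (q v)) ≤ R ^ 2 := fun v hv => by
    rw [hq]
    refine (gridNorm_mul_le hh.le _ _).trans ?_
    rw [hc, sq]
    exact mul_le_mul hv hv (gridNorm_nonneg _) hR
  have hqd : ∀ v w, gridNorm h v ≤ R → gridNorm h w ≤ R →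
      gridNorm h (toGrid (q v) - toGrid (q w)) ≤ 2 * R * gridNorm h (v - w) := fun v w hv hw => by
    have e : toGrid (q v) - toGrid (q w) = (v - w) * c v + w * c (v - w) := by
      rw [hq, hq, hcs]; ring
    rw [e]
    refine (gridNorm_add_le hh.le _ _).trans ?_
    have h1 := gridNorm_mul_le hh.le (v - w) (c v)
    have h2 := gridNorm_mul_le hh.le w (c (v - w))
    rw [hc] at h1 h2
    have := mul_le_mul_of_nonneg_left hv (gridNorm_nonneg (h := h) (v - w))
    have := mul_le_mul_of_nonneg_right hw (gridNorm_nonneg (h := h) (v - w))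
    linarith
  refine ⟨fun u v hu hv => ?_, fun u u' v v' hu hu' hv hv' => ?_⟩
  · rw [hnl, hnl]
    refine (H1 _ _ (hqR u hu) (hqR v hv)).trans ?_
    have h1 := mul_le_mul_of_nonneg_left (hqd u v hu hv) hM0
    have h2 : 0 ≤ (2 * M + 4 * M * R ^ 2) * gridNorm h (u - v) :=
      mul_nonneg (by positivity) (gridNorm_nonneg _)
    nlinarith
  · have e0 : nonlin g u' - nonlin g v' - (nonlin g u - nonlin g v)
        = nonlin g u' - nonlin g u - (nonlin g v' - nonlin g v) := by abel
    rw [e0, hnl, hnl, hnl, hnl]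
    refine (H2 _ _ _ _ (hqR u hu) (hqR u' hu') (hqR v hv) (hqR v' hv')).trans ?_
    have h1 := hqd u' u hu' hu
    have h2 := hqd u v hu hv
    have h3 := hqd u' v' hu' hv'
    set D := gridNorm h (u' - v' - (u - v)) with hD
    set a := gridNorm h (u' - u)
    set b := gridNorm h (u - v)
    set b' := gridNorm h (u' - v')
    have ha0 : 0 ≤ a := gridNorm_nonneg _
    have hb0 : 0 ≤ b := gridNorm_nonneg _
    have hb'0 : 0 ≤ b' := gridNorm_nonneg _
    have hD0 : 0 ≤ D := gridNorm_nonneg _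
    have h4 : gridNorm h (toGrid (q u') - toGrid (q u) - (toGrid (q v') - toGrid (q v)))
        ≤ 2 * R * D + a * (b + b') := by
      -- Product rule for the double difference of v·v̄: every term contains either the mixed
      -- difference or two first differences.
      have e : toGrid (q u') - toGrid (q u) - (toGrid (q v') - toGrid (q v))
          = ((u' - v' - (u - v)) * c v' + (u' - u) * c (u' - v'))
            + (v * c (u' - v' - (u - v)) + (u - v) * c (u' - u)) := by
        rw [hq, hq, hq, hq, hcs, hcs, hcs, hcs, hcs]; ring
      rw [e]
      have t1 := gridNorm_mul_le hh.le (u' - v' - (u - v)) (c v')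
      have t2 := gridNorm_mul_le hh.le (u' - u) (c (u' - v'))
      have t3 := gridNorm_mul_le hh.le v (c (u' - v' - (u - v)))
      have t4 := gridNorm_mul_le hh.le (u - v) (c (u' - u))
      rw [hc] at t1 t2 t3 t4
      have s1 := mul_le_mul_of_nonneg_left hv' hD0
      have s2 := mul_le_mul_of_nonneg_right hv hD0
      refine (gridNorm_add_le hh.le _ _).trans ((add_le_add (gridNorm_add_le hh.le _ _)
        (gridNorm_add_le hh.le _ _)).trans ?_)
      nlinarith
    have h5 : gridNorm h (toGrid (q u') - toGrid (q u))
        * (gridNorm h (toGrid (q u) - toGrid (q v)) + gridNorm h (toGrid (q u') - toGrid (q v')))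
        ≤ (2 * R * a) * (2 * R * b + 2 * R * b') :=
      mul_le_mul h1 (add_le_add h2 h3) (add_nonneg (gridNorm_nonneg _) (gridNorm_nonneg _))
        (by positivity)
    have h6 := mul_le_mul_of_nonneg_left (add_le_add h4 h5) hM0
    refine h6.trans ?_
    have p1 : 0 ≤ M * (a * (b + b')) := by positivity
    have p2 : 0 ≤ (2 * M + 4 * M * R ^ 2) * D := by positivity
    have p3 : 0 ≤ 2 * M * R * (a * (b + b')) := by positivity
    nlinarith

/-! ### The error recursion -/

variable {J : ℕ} {h : ℝ}

/-- Grid functions related like exact solution `U`, `φ`, numerical solution `V`, `φ - ε`,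
elliptic projection `U + ρ`, and consistency errors `r`, `c`, with the natural bounds. -/
structure ErrorSystem (g : ℝ → ℝ) (J : ℕ) (h K τ η : ℝ) (N : ℕ)
    (U V ρ φ ε c r : ℕ → Grid J) : Prop where
  h_pos : 0 < h
  τ_pos : 0 < τ
  η_nonneg : 0 ≤ η
  norm_le : ∀ v : Grid J, VanishesAtEnds v → gridNorm h v ≤ K * seminormH1 h v
  V_mem : ∀ n ≤ N, VanishesAtEnds (V n)
  θ_mem : ∀ n ≤ N, VanishesAtEnds (U n + ρ n - V n)
  U_le : ∀ n ≤ N, gridNorm h (U n) ≤ K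
  U_diff : ∀ n < N, gridNorm h (U (n + 1) - U n) ≤ K * τ
  φ_le : ∀ n < N, gridNorm h (φ n) ≤ K
  φ_diff : ∀ n, n + 1 < N → gridNorm h (φ (n + 1) - φ n) ≤ K * τ
  ρ_le : ∀ n ≤ N, gridNorm h (ρ n) ≤ K * η
  ρ_diff : ∀ n < N, gridNorm h (ρ (n + 1) - ρ n) ≤ K * (τ * η)
  r_le : ∀ n < N, gridNorm h (r n) ≤ K * η
  r_diff : ∀ n, n + 1 < N → gridNorm h (r (n + 1) - r n) ≤ K * (τ * η)
  c_le : ∀ n, n + 1 < N → gridNorm h (c n) ≤ K * η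
  c_diff : ∀ n, n + 2 < N → gridNorm h (c (n + 1) - c n) ≤ K * (τ * η)
  step : ∀ n < N, U (n + 1) + ρ (n + 1) - V (n + 1) - (U n + ρ n - V n)
    = (Complex.I * τ) • laplacian h (avg (U (n + 1) + ρ (n + 1) - V (n + 1)) (U n + ρ n - V n))
      + (Complex.I * τ) • (φ n * avg (U (n + 1)) (U n) - (φ n - ε n) * avg (V (n + 1)) (V n))
      + (τ : ℂ) • r n
  relax : ∀ n, n + 1 < N → ε (n + 1) + ε n
    = (2 : ℂ) • (nonlin g (U (n + 1)) - nonlin g (V (n + 1))) + c n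
  initial : U 0 + ρ 0 - V 0 = 0
  initial_relax : gridNorm h (ε 0) ≤ K * η

namespace ErrorSystem

variable {g : ℝ → ℝ} {K τ η : ℝ} {N : ℕ} {U V ρ φ ε c r : ℕ → Grid J}

theorem norm_I_mul (hτ : 0 < τ) : ‖Complex.I * (τ : ℂ)‖ = τ := by
  rw [norm_mul, Complex.norm_I, one_mul, Complex.norm_real, Real.norm_of_nonneg hτ.le]

/-- The forcing φ·avg U − (φ − ε)·avg V is rewritten as ε·avg U + (φ − ε)·avg(U − V), so that only
errors occur. The bound on ε keeps φ − ε below K + 1. -/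
theorem seminormH1_θ_succ_le (S : ErrorSystem g J h K τ η N U V ρ φ ε c r) {n : ℕ} (hn : n < N)
    (hε : gridNorm h (ε n) ≤ 1) :
    seminormH1 h (U (n + 1) + ρ (n + 1) - V (n + 1)) ≤ seminormH1 h (U n + ρ n - V n)
      + τ * (K * gridNorm h (ε n)
        + (K + 1) * ((gridNorm h (U n - V n) + gridNorm h (U (n + 1) - V (n + 1))) / 2)
        + K * η) := by
  have hh := S.h_pos.le
  have hK : 0 ≤ K := (gridNorm_nonneg _).trans (S.U_le n hn.le)
  set b := (Complex.I * τ) • (φ n * avg (U (n + 1)) (U n)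
      - (φ n - ε n) * avg (V (n + 1)) (V n)) + (τ : ℂ) • r n with hb
  have h1 := seminormH1_step_le S.h_pos (κ := τ) (z := U n + ρ n - V n)
    (z' := U (n + 1) + ρ (n + 1) - V (n + 1)) (b := b) (p := 0) (by
      rw [sub_zero, hb, sub_eq_iff_eq_add, S.step n hn]; abel)
  have hz : seminormH1 h (0 : Grid J) = 0 := by simp [seminormH1, diffQuot]
  rw [hz, mul_zero, add_zero] at h1
  refine h1.trans (add_le_add le_rfl ((seminormH1_le_gridNorm _).trans ?_))
  have e : φ n * avg (U (n + 1)) (U n) - (φ n - ε n) * avg (V (n + 1)) (V n)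
      = ε n * avg (U (n + 1)) (U n)
        + (φ n - ε n) * avg (U (n + 1) - V (n + 1)) (U n - V n) := by
    ext j; simp [avg]; ring
  rw [hb, e]
  refine (gridNorm_add_le hh _ _).trans ?_
  rw [gridNorm_smul hh, gridNorm_smul hh, norm_I_mul S.τ_pos, Complex.norm_real,
    Real.norm_of_nonneg S.τ_pos.le, ← mul_add]
  refine mul_le_mul_of_nonneg_left ?_ S.τ_pos.le
  refine add_le_add ((gridNorm_add_le hh _ _).trans (add_le_add ?_ ?_)) (S.r_le n hn)
  · refine (gridNorm_mul_le hh _ _).trans ?_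
    rw [mul_comm K]
    refine mul_le_mul_of_nonneg_left ?_ (gridNorm_nonneg _)
    refine (gridNorm_avg_le hh _ _).trans ?_
    linarith [S.U_le n hn.le, S.U_le (n + 1) hn]
  · refine (gridNorm_mul_le hh _ _).trans ?_
    refine mul_le_mul ?_ ?_ (gridNorm_nonneg _) (by linarith)
    · exact (gridNorm_sub_le hh _ _).trans (add_le_add (S.φ_le n hn) hε)
    · exact (gridNorm_avg_le hh _ _).trans (by linarith)

/-- A crude step that multiplies the errors by a constant and therefore cannot be iterated. It
serves to keep V bounded at a new time level before the fine estimate is available there, and to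
reach the last node. -/
theorem gridNorm_error_succ_le (S : ErrorSystem g J h K τ η N U V ρ φ ε c r) (hK : 1 ≤ K)
    {n : ℕ} (hn : n < N) (hτ : τ * (K * (K + 1)) ≤ 1) (hε : gridNorm h (ε n) ≤ 1) :
    gridNorm h (U (n + 1) - V (n + 1))
      ≤ 6 * K ^ 2 * (gridNorm h (U n - V n) + gridNorm h (ε n) + η) := by
  have hh := S.h_pos.le
  have h1 := S.seminormH1_θ_succ_le hn hε
  set e := gridNorm h (U n - V n)
  set e' := gridNorm h (U (n + 1) - V (n + 1)) with he'
  set x := gridNorm h (ε n)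
  have he0 : 0 ≤ e := gridNorm_nonneg _
  have he'0 : 0 ≤ e' := gridNorm_nonneg _
  have hx0 : 0 ≤ x := gridNorm_nonneg _
  have hη := S.η_nonneg
  have hτ0 := S.τ_pos
  have h2 : seminormH1 h (U n + ρ n - V n) ≤ e + K * η := by
    have : U n + ρ n - V n = (U n - V n) + ρ n := by abel
    rw [this]
    exact (seminormH1_le_gridNorm _).trans
      ((gridNorm_add_le hh _ _).trans (add_le_add le_rfl (S.ρ_le n hn.le)))
  have h3 : e' ≤ K * seminormH1 h (U (n + 1) + ρ (n + 1) - V (n + 1)) + K * η := by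
    have : U (n + 1) - V (n + 1) = (U (n + 1) + ρ (n + 1) - V (n + 1)) - ρ (n + 1) := by abel
    rw [he', this]
    exact (gridNorm_sub_le hh _ _).trans
      (add_le_add (S.norm_le _ (S.θ_mem _ hn)) (S.ρ_le _ hn))
  have h4 := mul_le_mul_of_nonneg_left (h1.trans (add_le_add h2 le_rfl)) (by linarith : 0 ≤ K)
  have h5 : K * τ ≤ 1 := by nlinarith [mul_pos hτ0 (by linarith : 0 < K)]
  have t1 : K * τ * (K * x) ≤ K * x := by
    have := mul_le_mul_of_nonneg_right h5 (by positivity : 0 ≤ K * x); linarith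
  have t2 : K * τ * (K * η) ≤ K * η := by
    have := mul_le_mul_of_nonneg_right h5 (by positivity : 0 ≤ K * η); linarith
  -- Half of the new error remains on the right and is absorbed on the left; this doubles the other
  -- constants.
  have t3 : τ * (K * (K + 1)) * ((e + e') / 2) ≤ (e + e') / 2 := by
    have := mul_le_mul_of_nonneg_right hτ (by positivity : 0 ≤ (e + e') / 2); linarith
  have h6 : e' ≤ (2 * K + 1) * e + 2 * K * x + (2 * K ^ 2 + 4 * K) * η := by nlinarith
  have k1 : K ≤ K ^ 2 := by nlinarith
  have k2 : (1 : ℝ) ≤ K ^ 2 := by nlinarith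
  have s1 : (2 * K + 1) * e ≤ 6 * K ^ 2 * e := mul_le_mul_of_nonneg_right (by linarith) he0
  have s2 : 2 * K * x ≤ 6 * K ^ 2 * x := mul_le_mul_of_nonneg_right (by linarith) hx0
  have s3 : (2 * K ^ 2 + 4 * K) * η ≤ 6 * K ^ 2 * η := mul_le_mul_of_nonneg_right (by linarith) hη
  linarith

/-- The time difference of `θ + (iτ/2) V ε`, a combination of the errors in which the forcing does
not oscillate. -/
noncomputable def corrDiff (τ : ℝ) (U V ρ ε : ℕ → Grid J) (n : ℕ) : Grid J :=
  (U (n + 1) + ρ (n + 1) - V (n + 1) + (Complex.I * τ / 2) • (V (n + 1) * ε (n + 1)))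
    - (U n + ρ n - V n + (Complex.I * τ / 2) • (V n * ε n))

/-- The oscillating part of the forcing is ε_n (V_{n+1} + V_n)/2. Adding the increment (V_{n+1}
ε_{n+1} − V_n ε_n)/2 of the correction turns it into V_{n+1}(ε_{n+1} + ε_n)/2, and the sum ε_{n+1} +
ε_n no longer oscillates. What is added under the Laplacian is subtracted again as a perturbation of
its argument. -/
theorem corrDiff_eq (S : ErrorSystem g J h K τ η N U V ρ φ ε c r) {n : ℕ} (hn : n < N) :
    corrDiff τ U V ρ ε n = (Complex.I * τ) • laplacian h
        (avg (U (n + 1) + ρ (n + 1) - V (n + 1) + (Complex.I * τ / 2) • (V (n + 1) * ε (n + 1)))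
          (U n + ρ n - V n + (Complex.I * τ / 2) • (V n * ε n))
          - (Complex.I * τ / 4) • (V (n + 1) * ε (n + 1) + V n * ε n))
      + (Complex.I * τ) • ((1 / 2 : ℂ) • (V (n + 1) * (ε (n + 1) + ε n))
        + φ n * avg (U (n + 1) - V (n + 1)) (U n - V n) - Complex.I • r n) := by
  have e1 : avg (U (n + 1) + ρ (n + 1) - V (n + 1) + (Complex.I * τ / 2) • (V (n + 1) * ε (n + 1)))
          (U n + ρ n - V n + (Complex.I * τ / 2) • (V n * ε n))
          - (Complex.I * τ / 4) • (V (n + 1) * ε (n + 1) + V n * ε n)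
      = avg (U (n + 1) + ρ (n + 1) - V (n + 1)) (U n + ρ n - V n) := by
    rw [avg_eq, avg_eq]; module
  have e2 : corrDiff τ U V ρ ε n
      = (U (n + 1) + ρ (n + 1) - V (n + 1) - (U n + ρ n - V n))
        + (Complex.I * τ / 2) • (V (n + 1) * ε (n + 1) - V n * ε n) := by
    rw [corrDiff]; module
  rw [e1, e2, S.step n hn]
  ext j
  simp [avg]
  linear_combination ((τ : ℂ) * r n j) * Complex.I_mul_I

/-- Two consecutive instances of `corrDiff_eq` are subtracted and the stability estimate is applied
to the difference. Apart from products with increments of V, ε enters only through ε_{n+2} − ε_n. -/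
theorem seminormH1_corrDiff_succ_le (S : ErrorSystem g J h K τ η N U V ρ φ ε c r) {R : ℝ}
    {n : ℕ} (hn : n + 1 < N) (hV : gridNorm h (V (n + 2)) ≤ R) :
    seminormH1 h (corrDiff τ U V ρ ε (n + 1)) ≤ seminormH1 h (corrDiff τ U V ρ ε n)
      + τ * (R * gridNorm h (ε (n + 2) - ε n) / 2
        + gridNorm h (V (n + 2) - V (n + 1)) * (gridNorm h (ε (n + 1)) + gridNorm h (ε n)) / 2
        + K * (gridNorm h (U (n + 1) - V (n + 1) - (U n - V n))
          + gridNorm h (U (n + 2) - V (n + 2) - (U (n + 1) - V (n + 1)))) / 2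
        + K * τ * (gridNorm h (U n - V n) + gridNorm h (U (n + 1) - V (n + 1))) / 2
        + K * (τ * η))
      + τ / 2 * (R * gridNorm h (ε (n + 2) - ε n)
        + gridNorm h (V (n + 2) - V n) * gridNorm h (ε n)) := by
  have hh := S.h_pos.le
  have hτ := S.τ_pos
  set b := (Complex.I * (τ : ℂ)) • ((1 / 2 : ℂ) • (V (n + 2) * (ε (n + 2) - ε n))
    + (1 / 2 : ℂ) • ((V (n + 2) - V (n + 1)) * (ε (n + 1) + ε n))
    + φ (n + 1) * avg (U (n + 1) - V (n + 1) - (U n - V n))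
        (U (n + 2) - V (n + 2) - (U (n + 1) - V (n + 1)))
    + (φ (n + 1) - φ n) * avg (U n - V n) (U (n + 1) - V (n + 1))
    - Complex.I • (r (n + 1) - r n)) with hb
  -- The perturbation inside the Laplacian. It could not be moved into b without losing a factor
  -- h⁻².
  set p := (Complex.I * τ / 4) • (V (n + 2) * (ε (n + 2) - ε n) + (V (n + 2) - V n) * ε n) with hp
  have key : corrDiff τ U V ρ ε (n + 1) - corrDiff τ U V ρ ε n - b
      = (Complex.I * τ) • laplacian h
        (avg (corrDiff τ U V ρ ε (n + 1)) (corrDiff τ U V ρ ε n) - p) := by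
    have e1 : avg (corrDiff τ U V ρ ε (n + 1)) (corrDiff τ U V ρ ε n) - p
        = (avg (U (n + 1 + 1) + ρ (n + 1 + 1) - V (n + 1 + 1)
              + (Complex.I * τ / 2) • (V (n + 1 + 1) * ε (n + 1 + 1)))
            (U (n + 1) + ρ (n + 1) - V (n + 1) + (Complex.I * τ / 2) • (V (n + 1) * ε (n + 1)))
            - (Complex.I * τ / 4) • (V (n + 1 + 1) * ε (n + 1 + 1) + V (n + 1) * ε (n + 1)))
          - (avg (U (n + 1) + ρ (n + 1) - V (n + 1)
              + (Complex.I * τ / 2) • (V (n + 1) * ε (n + 1)))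
            (U n + ρ n - V n + (Complex.I * τ / 2) • (V n * ε n))
            - (Complex.I * τ / 4) • (V (n + 1) * ε (n + 1) + V n * ε n)) := by
      ext j; simp [avg, corrDiff, hp]; ring
    rw [e1, laplacian_sub]
    have h1 := S.corrDiff_eq hn
    have h0 := S.corrDiff_eq (by omega : n < N)
    rw [smul_sub]
    rw [← sub_eq_iff_eq_add] at h1 h0
    rw [← h1, ← h0]
    ext j; simp [avg, hb]; ring
  have h1 := seminormH1_step_le S.h_pos key
  have hbn : seminormH1 h b ≤ τ * (R * gridNorm h (ε (n + 2) - ε n) / 2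
        + gridNorm h (V (n + 2) - V (n + 1)) * (gridNorm h (ε (n + 1)) + gridNorm h (ε n)) / 2
        + K * (gridNorm h (U (n + 1) - V (n + 1) - (U n - V n))
          + gridNorm h (U (n + 2) - V (n + 2) - (U (n + 1) - V (n + 1)))) / 2
        + K * τ * (gridNorm h (U n - V n) + gridNorm h (U (n + 1) - V (n + 1))) / 2
        + K * (τ * η)) := by
    refine (seminormH1_le_gridNorm _).trans ?_
    rw [hb, gridNorm_smul hh, norm_I_mul hτ]
    refine mul_le_mul_of_nonneg_left ?_ hτ.le
    have hhalf : ∀ v : Grid J, gridNorm h ((1 / 2 : ℂ) • v) = gridNorm h v / 2 := fun v => by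
      rw [gridNorm_smul hh]; norm_num; ring
    refine (gridNorm_sub_le hh _ _).trans (add_le_add ((gridNorm_add_le hh _ _).trans
      (add_le_add ((gridNorm_add_le hh _ _).trans (add_le_add ((gridNorm_add_le hh _ _).trans
      (add_le_add ?_ ?_)) ?_)) ?_)) ?_)
    · rw [hhalf]
      have := (gridNorm_mul_le hh (V (n + 2)) (ε (n + 2) - ε n)).trans
        (mul_le_mul_of_nonneg_right hV (gridNorm_nonneg _))
      linarith
    · rw [hhalf]
      have := (gridNorm_mul_le hh (V (n + 2) - V (n + 1)) (ε (n + 1) + ε n)).trans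
        (mul_le_mul_of_nonneg_left (gridNorm_add_le hh _ _) (gridNorm_nonneg _))
      linarith
    · refine (gridNorm_mul_le hh _ _).trans ((mul_le_mul (S.φ_le _ hn) (gridNorm_avg_le hh _ _)
        (gridNorm_nonneg _) ((gridNorm_nonneg _).trans (S.φ_le _ hn))).trans (by linarith))
    · refine (gridNorm_mul_le hh _ _).trans ((mul_le_mul (S.φ_diff _ hn) (gridNorm_avg_le hh _ _)
        (gridNorm_nonneg _) ((gridNorm_nonneg _).trans (S.φ_diff _ hn))).trans (by linarith))
    · rw [gridNorm_smul hh, Complex.norm_I, one_mul]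
      exact S.r_diff _ hn
  have hpn : 2 * seminormH1 h p ≤ τ / 2 * (R * gridNorm h (ε (n + 2) - ε n)
        + gridNorm h (V (n + 2) - V n) * gridNorm h (ε n)) := by
    have e : ‖Complex.I * (τ : ℂ) / 4‖ = τ / 4 := by
      rw [norm_div, norm_I_mul hτ]; norm_num
    have h2 : seminormH1 h p ≤ τ / 4 * (R * gridNorm h (ε (n + 2) - ε n)
        + gridNorm h (V (n + 2) - V n) * gridNorm h (ε n)) := by
      refine (seminormH1_le_gridNorm _).trans ?_
      rw [hp, gridNorm_smul hh, e]
      refine mul_le_mul_of_nonneg_left ?_ (by positivity)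
      refine (gridNorm_add_le hh _ _).trans (add_le_add ?_ (gridNorm_mul_le hh _ _))
      exact (gridNorm_mul_le hh _ _).trans (mul_le_mul_of_nonneg_right hV (gridNorm_nonneg _))
    linarith
  linarith

/-- Undoes the correction and the elliptic projection. The correction contributes τ times the size
of ε rather than an increment of ε, which is harmless because only O(τ) smallness of the error
increments is needed. -/
theorem gridNorm_errorDiff_le (S : ErrorSystem g J h K τ η N U V ρ φ ε c r) {R : ℝ}
    {n : ℕ} (hn : n < N) (hV : gridNorm h (V n) ≤ R) (hV' : gridNorm h (V (n + 1)) ≤ R) :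
    gridNorm h (U (n + 1) - V (n + 1) - (U n - V n))
      ≤ K * seminormH1 h (corrDiff τ U V ρ ε n)
        + τ / 2 * (R * gridNorm h (ε (n + 1)) + R * gridNorm h (ε n)) + K * (τ * η) := by
  have hh := S.h_pos.le
  have hτ := S.τ_pos
  have e : U (n + 1) - V (n + 1) - (U n - V n) = corrDiff τ U V ρ ε n
      - (Complex.I * τ / 2) • (V (n + 1) * ε (n + 1) - V n * ε n) - (ρ (n + 1) - ρ n) := by
    ext j; simp [corrDiff]; ring
  have hm : VanishesAtEnds (corrDiff τ U V ρ ε n) :=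
    ((S.θ_mem _ hn).add (((S.V_mem _ hn).mul _).smul _)).sub
      ((S.θ_mem _ hn.le).add (((S.V_mem _ hn.le).mul _).smul _))
  rw [e]
  refine (gridNorm_sub_le hh _ _).trans (add_le_add ((gridNorm_sub_le hh _ _).trans
    (add_le_add (S.norm_le _ hm) ?_)) (S.ρ_diff _ hn))
  have e : ‖Complex.I * (τ : ℂ) / 2‖ = τ / 2 := by
    rw [norm_div, norm_I_mul hτ]; norm_num
  rw [gridNorm_smul hh, e]
  refine mul_le_mul_of_nonneg_left ?_ (by positivity)
  refine (gridNorm_sub_le hh _ _).trans (add_le_add ?_ ?_)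
  · exact (gridNorm_mul_le hh _ _).trans (mul_le_mul_of_nonneg_right hV' (gridNorm_nonneg _))
  · exact (gridNorm_mul_le hh _ _).trans (mul_le_mul_of_nonneg_right hV (gridNorm_nonneg _))

/-- The size of the errors at two consecutive steps. -/
noncomputable def size (h τ : ℝ) (U V ρ ε : ℕ → Grid J) (n : ℕ) : ℝ :=
  seminormH1 h (corrDiff τ U V ρ ε n) / τ + (gridNorm h (ε n) + gridNorm h (ε (n + 1)))
    + (gridNorm h (U n - V n) + gridNorm h (U (n + 1) - V (n + 1)))

/-- Here d stands for the seminorm of `corrDiff`, x for ε, e for U − V, w for increments of U − V,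
dx for ε_{n+2} − ε_n, and v1, v2 for increments of V. The common unit is S = τ(F + η): the
increments w0, w1 and dx are O(S), while d grows only by τ·O(S), so every part of F grows by O(S).
The bounds for w1, dx and d1 are mutually implicit and are separated by the smallness of Q³τ. -/
theorem scalar_recursion {K R M Q τ η d0 d1 x0 x1 x2 e0 e1 e2 w0 w1 dx v1 v2 : ℝ}
    (hτ : 0 < τ) (hη : 0 ≤ η) (hQ : 1 ≤ Q) (hK : K ≤ Q) (hR : R ≤ Q) (hM : 2 * M ≤ Q)
    (hK0 : 0 ≤ K) (hτQ : 16 * Q ^ 3 * τ ≤ 1)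
    (hd0 : 0 ≤ d0) (hd1 : 0 ≤ d1) (hx0 : 0 ≤ x0) (hx1 : 0 ≤ x1) (he0 : 0 ≤ e0)
    (he1 : 0 ≤ e1) (he2 : 0 ≤ e2) (hw0 : 0 ≤ w0) (hw1 : 0 ≤ w1) (hdx : 0 ≤ dx)
    (hF : d0 / τ + (x0 + x1) + (e0 + e1) ≤ 1)
    (i0 : w0 ≤ K * d0 + τ / 2 * (R * x1 + R * x0) + K * (τ * η))
    (i1 : w1 ≤ K * d1 + τ / 2 * (R * x2 + R * x1) + K * (τ * η))
    (i2 : dx ≤ 2 * M * (w1 + K * τ * (e1 + e2)) + K * (τ * η))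
    (i3 : d1 ≤ d0 + τ * (R * dx / 2 + v1 * (x1 + x0) / 2 + K * (w0 + w1) / 2
        + K * τ * (e0 + e1) / 2 + K * (τ * η)) + τ / 2 * (R * dx + v2 * x0))
    (j1 : v1 ≤ K * τ + w1) (j2 : v2 ≤ 2 * K * τ + w0 + w1)
    (i4 : x2 ≤ x0 + dx) (hx2 : 0 ≤ x2) (i5 : e2 ≤ e1 + w1) (i6 : e1 ≤ e0 + w0) :
    d1 / τ + (x1 + x2) + (e1 + e2) ≤ d0 / τ + (x0 + x1) + (e0 + e1)
      + 200 * Q ^ 3 * τ * (d0 / τ + (x0 + x1) + (e0 + e1) + η) := by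
  set F := d0 / τ + (x0 + x1) + (e0 + e1) with hFdef
  set S := τ * (F + η) with hS
  have hd0' : d0 / τ * τ = d0 := div_mul_cancel₀ _ hτ.ne'
  have hSe : S = d0 + τ * (x0 + x1) + τ * (e0 + e1) + τ * η := by
    rw [hS, hFdef]; linear_combination hd0'
  have px0 : 0 ≤ τ * x0 := by positivity
  have px1 : 0 ≤ τ * x1 := by positivity
  have pe0 : 0 ≤ τ * e0 := by positivity
  have pe1 : 0 ≤ τ * e1 := by positivity
  have pη : 0 ≤ τ * η := by positivity
  have hS0 : 0 ≤ S := by rw [hSe]; linarith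
  have hd0τ : 0 ≤ d0 / τ := by positivity
  have hx01 : x0 + x1 ≤ 1 := by linarith
  have Q0 : 0 ≤ Q := by linarith
  have Q2 : Q ≤ Q ^ 2 := le_self_pow₀ hQ (by norm_num)
  have Q3 : Q ^ 2 ≤ Q ^ 3 := pow_le_pow_right₀ hQ (by norm_num)
  have t3 : τ * Q ^ 3 ≤ 1 / 16 := by linarith
  have t2 : τ * Q ^ 2 ≤ 1 / 16 := (mul_le_mul_of_nonneg_left Q3 hτ.le).trans t3
  have t1 : τ * Q ≤ 1 / 16 := (mul_le_mul_of_nonneg_left Q2 hτ.le).trans t2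
  have a0 : w0 ≤ 3 * Q * S := by
    have m1 : K * d0 ≤ Q * d0 := mul_le_mul_of_nonneg_right hK hd0
    have m2 : R * (τ * (x1 + x0)) ≤ Q * (τ * (x1 + x0)) :=
      mul_le_mul_of_nonneg_right hR (by linarith)
    have m3 : K * (τ * η) ≤ Q * (τ * η) := mul_le_mul_of_nonneg_right hK pη
    have m4 : Q * S = Q * d0 + Q * (τ * (x1 + x0)) + Q * (τ * (e0 + e1)) + Q * (τ * η) := by
      rw [hSe]; ring
    have n1 : 0 ≤ Q * d0 := by positivity
    have n2 : 0 ≤ Q * (τ * (x1 + x0)) := by positivity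
    have n3 : 0 ≤ Q * (τ * (e0 + e1)) := by positivity
    have n4 : 0 ≤ Q * (τ * η) := by positivity
    linarith
  have a1 : w1 ≤ Q * d1 + 2 * Q * S + τ * Q * dx := by
    have m1 : K * d1 ≤ Q * d1 := mul_le_mul_of_nonneg_right hK hd1
    have m2 : R * (τ * (x2 + x1)) ≤ Q * (τ * (x2 + x1)) :=
      mul_le_mul_of_nonneg_right hR (by positivity)
    have m2' : Q * (τ * (x2 + x1)) ≤ Q * (τ * (x0 + dx + x1)) := by gcongr
    have m3 : K * (τ * η) ≤ Q * (τ * η) := mul_le_mul_of_nonneg_right hK pη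
    have m4 : Q * S = Q * d0 + Q * (τ * (x1 + x0)) + Q * (τ * (e0 + e1)) + Q * (τ * η) := by
      rw [hSe]; ring
    have n1 : 0 ≤ Q * d0 := by positivity
    have n2 : 0 ≤ Q * (τ * (x1 + x0)) := by positivity
    have n3 : 0 ≤ Q * (τ * (e0 + e1)) := by positivity
    have n4 : 0 ≤ Q * (τ * η) := by positivity
    have n5 : 0 ≤ Q * (τ * dx) := by positivity
    linarith
  have a2 : dx ≤ 2 * Q * w1 + 3 * Q ^ 2 * S := by
    have m1 : 2 * M * (w1 + K * τ * (e1 + e2)) ≤ Q * (w1 + Q * τ * (e1 + (e1 + w1))) := by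
      have p : 0 ≤ w1 + K * τ * (e1 + e2) := by positivity
      calc _ ≤ Q * (w1 + K * τ * (e1 + e2)) := mul_le_mul_of_nonneg_right hM p
        _ ≤ _ := by gcongr
    have m3 : K * (τ * η) ≤ Q ^ 2 * (τ * η) := mul_le_mul_of_nonneg_right (hK.trans Q2) pη
    have m4 : Q ^ 2 * S
        = Q ^ 2 * d0 + Q ^ 2 * (τ * (x1 + x0)) + Q ^ 2 * (τ * (e0 + e1)) + Q ^ 2 * (τ * η) := by
      rw [hSe]; ring
    have n1 : 0 ≤ Q ^ 2 * d0 := by positivity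
    have n2 : 0 ≤ Q ^ 2 * (τ * (x1 + x0)) := by positivity
    have n3 : 0 ≤ Q ^ 2 * (τ * e0) := by positivity
    have n4 : 0 ≤ Q ^ 2 * (τ * η) := by positivity
    have n5 : 0 ≤ Q ^ 2 * (τ * e1) := by positivity
    have m5 : τ * Q ^ 2 * w1 ≤ Q * w1 := mul_le_mul_of_nonneg_right (by linarith) hw1
    linarith
  -- Inserting the bound for dx brings back w1 with a small factor τQ².
  have a3 : w1 ≤ 2 * Q * d1 + 4 * Q * S := by
    have m1 : τ * Q * dx ≤ τ * Q * (2 * Q * w1 + 3 * Q ^ 2 * S) := by gcongr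
    have m2 : τ * Q ^ 2 * w1 ≤ 1 / 16 * w1 := mul_le_mul_of_nonneg_right t2 hw1
    have m3 : τ * Q ^ 3 * S ≤ 1 / 16 * S := mul_le_mul_of_nonneg_right t3 hS0
    have m4 : S ≤ Q * S := le_mul_of_one_le_left hS0 hQ
    have m5 : 0 ≤ Q * d1 := by positivity
    linarith
  have a4 : dx ≤ 4 * Q ^ 2 * d1 + 11 * Q ^ 2 * S := by
    have := mul_le_mul_of_nonneg_left a3 (by positivity : 0 ≤ 2 * Q)
    linarith
  have a5 : d1 ≤ d0 + τ * (Q * dx + 2 * Q * w1 + Q * w0 + 3 * Q * S) := by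
    have m1 : R * dx ≤ Q * dx := mul_le_mul_of_nonneg_right hR hdx
    -- Here the quadratic term w1·x arises. It becomes linear because F ≤ 1 bounds x0 + x1 by 1.
    have m2 : v1 * (x1 + x0) ≤ Q * S + w1 := by
      have p1 : v1 * (x1 + x0) ≤ (K * τ + w1) * (x1 + x0) :=
        mul_le_mul_of_nonneg_right j1 (by linarith)
      have p2 : K * (τ * (x1 + x0)) ≤ Q * S := by
        refine mul_le_mul hK ?_ (by positivity) Q0
        rw [hSe]; linarith
      have p3 : w1 * (x1 + x0) ≤ w1 * 1 := mul_le_mul_of_nonneg_left (by linarith) hw1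
      linarith
    have m3 : K * (w0 + w1) ≤ Q * (w0 + w1) := mul_le_mul_of_nonneg_right hK (by positivity)
    have m4 : K * τ * (e0 + e1) ≤ Q * S := by
      rw [mul_assoc]
      refine mul_le_mul hK ?_ (by positivity) Q0
      rw [hSe]; linarith
    have m5 : K * (τ * η) ≤ Q * S := by
      refine mul_le_mul hK ?_ (by positivity) Q0
      rw [hSe]; linarith
    have m6 : v2 * x0 ≤ 2 * (Q * S) + w0 + w1 := by
      have p1 : v2 * x0 ≤ (2 * K * τ + w0 + w1) * x0 := mul_le_mul_of_nonneg_right j2 hx0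
      have p2 : K * (τ * x0) ≤ Q * S := by
        refine mul_le_mul hK ?_ (by positivity) Q0
        rw [hSe]; linarith
      have p3 : (w0 + w1) * x0 ≤ (w0 + w1) * 1 :=
        mul_le_mul_of_nonneg_left (by linarith) (by positivity)
      linarith
    have q0 : w0 ≤ Q * w0 := le_mul_of_one_le_left hw0 hQ
    have q1 : w1 ≤ Q * w1 := le_mul_of_one_le_left hw1 hQ
    have m7 : (R * dx / 2 + v1 * (x1 + x0) / 2 + K * (w0 + w1) / 2
        + K * τ * (e0 + e1) / 2 + K * (τ * η)) + 1 / 2 * (R * dx + v2 * x0)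
        ≤ Q * dx + 2 * Q * w1 + Q * w0 + 3 * Q * S := by linarith
    have := mul_le_mul_of_nonneg_left m7 hτ.le
    linarith
  have a6 : d1 ≤ d0 + τ * (8 * Q ^ 3 * d1 + 25 * Q ^ 3 * S) := by
    refine a5.trans (add_le_add le_rfl (mul_le_mul_of_nonneg_left ?_ hτ.le))
    have m1 := mul_le_mul_of_nonneg_left a4 Q0
    have m2 := mul_le_mul_of_nonneg_left a3 (by positivity : 0 ≤ 2 * Q)
    have m3 := mul_le_mul_of_nonneg_left a0 Q0
    have m4 : Q ^ 2 * d1 ≤ Q ^ 3 * d1 := mul_le_mul_of_nonneg_right Q3 hd1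
    have m5 : Q ^ 2 * S ≤ Q ^ 3 * S := mul_le_mul_of_nonneg_right Q3 hS0
    have m6 : Q * S ≤ Q ^ 3 * S := mul_le_mul_of_nonneg_right (Q2.trans Q3) hS0
    linarith
  have hd0S : d0 ≤ S := by rw [hSe]; linarith
  -- A first, rough bound for d1; inserted into the previous estimate it leaves d1 − d0 with a full
  -- factor τ.
  have a7 : d1 ≤ 9 * S := by
    have m1 : τ * Q ^ 3 * d1 ≤ 1 / 16 * d1 := mul_le_mul_of_nonneg_right t3 hd1
    have m2 : τ * Q ^ 3 * S ≤ 1 / 16 * S := mul_le_mul_of_nonneg_right t3 hS0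
    linarith
  have a8 : d1 ≤ d0 + τ * (97 * Q ^ 3 * S) := by
    refine a6.trans (add_le_add le_rfl (mul_le_mul_of_nonneg_left ?_ hτ.le))
    have := mul_le_mul_of_nonneg_left a7 (by positivity : 0 ≤ 8 * Q ^ 3)
    linarith
  have a9 : d1 / τ ≤ d0 / τ + 97 * Q ^ 3 * S := by
    rw [div_le_iff₀ hτ, add_mul, hd0']; linarith
  have b1 : w0 + w1 ≤ 25 * (Q ^ 3 * S) := by
    have m1 := mul_le_mul_of_nonneg_left a7 (by positivity : 0 ≤ 2 * Q)
    have m6 : Q * S ≤ Q ^ 3 * S := mul_le_mul_of_nonneg_right (Q2.trans Q3) hS0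
    linarith
  have b2 : dx ≤ 47 * (Q ^ 3 * S) := by
    have m1 := mul_le_mul_of_nonneg_left a7 (by positivity : 0 ≤ 4 * Q ^ 2)
    have m5 : Q ^ 2 * S ≤ Q ^ 3 * S := mul_le_mul_of_nonneg_right Q3 hS0
    linarith
  have b3 : 0 ≤ Q ^ 3 * S := by positivity
  have e : 200 * Q ^ 3 * τ * (F + η) = 200 * (Q ^ 3 * S) := by rw [hS]; ring
  rw [e]
  linarith

/-- The hypothesis that the size is at most 1 is the bootstrap: it puts V at levels n, n+1 and,
through the crude step, n+2 into the ball of radius R, where M is a Lipschitz constant for the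
nonlinearity. -/
theorem size_succ_le (S : ErrorSystem g J h K τ η N U V ρ φ ε c r) {R M Q : ℝ} (hK : 1 ≤ K)
    (hR : 19 * K ^ 2 ≤ R) (hRQ : R ≤ Q) (hMQ : 2 * M ≤ Q) (hM : 0 ≤ M)
    (hη : η ≤ 1) (hτQ : 16 * Q ^ 3 * τ ≤ 1)
    (hG : ∀ u u' v v' : Grid J, gridNorm h u ≤ R → gridNorm h u' ≤ R →
        gridNorm h v ≤ R → gridNorm h v' ≤ R →
        gridNorm h (nonlin g u' - nonlin g v' - (nonlin g u - nonlin g v))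
          ≤ M * (gridNorm h (u' - v' - (u - v))
            + gridNorm h (u' - u) * (gridNorm h (u - v) + gridNorm h (u' - v'))))
    {n : ℕ} (hn : n + 2 < N) (hF : size h τ U V ρ ε n ≤ 1) :
    size h τ U V ρ ε (n + 1)
      ≤ size h τ U V ρ ε n + 200 * Q ^ 3 * τ * (size h τ U V ρ ε n + η) := by
  have hh := S.h_pos.le
  have hτ := S.τ_pos
  have hη0 := S.η_nonneg
  have kk : K ≤ K ^ 2 := by nlinarith
  have k1 : (1 : ℝ) ≤ K ^ 2 := by nlinarith
  have hKR : K ≤ R := by linarith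
  have hQ : 1 ≤ Q := by linarith
  have hτK : τ * (K * (K + 1)) ≤ 1 := by
    have : K * (K + 1) ≤ 16 * Q ^ 3 := by
      have : Q ≤ Q ^ 3 := by nlinarith [sq_nonneg Q, mul_nonneg (sq_nonneg Q) (by linarith : 0 ≤ Q - 1)]
      nlinarith
    nlinarith
  have pd : 0 ≤ seminormH1 h (corrDiff τ U V ρ ε n) / τ :=
    div_nonneg (seminormH1_nonneg _) hτ.le
  have px0 := gridNorm_nonneg (h := h) (ε n)
  have px1 := gridNorm_nonneg (h := h) (ε (n + 1))
  have pe0 := gridNorm_nonneg (h := h) (U n - V n)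
  have pe1 := gridNorm_nonneg (h := h) (U (n + 1) - V (n + 1))
  have hF' := hF
  rw [size] at hF'
  -- Together with the bound K for U this explains the radius 19K².
  have he2 : gridNorm h (U (n + 2) - V (n + 2)) ≤ 18 * K ^ 2 := by
    refine (S.gridNorm_error_succ_le hK (by omega : n + 1 < N) hτK (by linarith)).trans ?_
    nlinarith
  have hVb : ∀ m ≤ N, gridNorm h (V m) ≤ K + gridNorm h (U m - V m) := fun m hm => by
    have : V m = U m - (U m - V m) := by abel
    conv_lhs => rw [this]
    exact (gridNorm_sub_le hh _ _).trans (add_le_add (S.U_le m hm) le_rfl)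
  have hV0 : gridNorm h (V n) ≤ R := (hVb n (by omega)).trans (by linarith)
  have hV1 : gridNorm h (V (n + 1)) ≤ R := (hVb (n + 1) (by omega)).trans (by linarith)
  have hV2 : gridNorm h (V (n + 2)) ≤ R := (hVb (n + 2) (by omega)).trans (by linarith)
  have hvd : ∀ m < N, gridNorm h (V (m + 1) - V m)
      ≤ K * τ + gridNorm h (U (m + 1) - V (m + 1) - (U m - V m)) := fun m hm => by
    have : V (m + 1) - V m = (U (m + 1) - U m) - (U (m + 1) - V (m + 1) - (U m - V m)) := by abel
    conv_lhs => rw [this]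
    exact (gridNorm_sub_le hh _ _).trans (add_le_add (S.U_diff m hm) le_rfl)
  unfold size
  refine scalar_recursion (K := K) (R := R) (M := M)
    (w0 := gridNorm h (U (n + 1) - V (n + 1) - (U n - V n)))
    (w1 := gridNorm h (U (n + 2) - V (n + 2) - (U (n + 1) - V (n + 1))))
    (dx := gridNorm h (ε (n + 2) - ε n)) (v1 := gridNorm h (V (n + 2) - V (n + 1)))
    (v2 := gridNorm h (V (n + 2) - V n))
    hτ hη0 hQ (hKR.trans hRQ) hRQ hMQ (by linarith) hτQ (seminormH1_nonneg _)
    (seminormH1_nonneg _) px0 px1 pe0 pe1 (gridNorm_nonneg _) (gridNorm_nonneg _)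
    (gridNorm_nonneg _) (gridNorm_nonneg _) hF'
    (S.gridNorm_errorDiff_le (by omega) hV0 hV1)
    (S.gridNorm_errorDiff_le (by omega) hV1 hV2) ?_
    (S.seminormH1_corrDiff_succ_le (by omega) hV2) (hvd _ (by omega)) ?_ ?_
    (gridNorm_nonneg _) ?_ ?_
  · have e : ε (n + 2) - ε n = (2 : ℂ) • (nonlin g (U (n + 2)) - nonlin g (V (n + 2))
        - (nonlin g (U (n + 1)) - nonlin g (V (n + 1)))) + (c (n + 1) - c n) := by
      have h1 := S.relax n (by omega)
      have h2 := S.relax (n + 1) (by omega)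
      have : ε (n + 2) - ε n = (ε (n + 1 + 1) + ε (n + 1)) - (ε (n + 1) + ε n) := by abel
      rw [this, h1, h2]; module
    rw [e]
    refine (gridNorm_add_le hh _ _).trans (add_le_add ?_ (S.c_diff n hn))
    rw [gridNorm_smul hh, Complex.norm_ofNat, mul_assoc]
    refine mul_le_mul_of_nonneg_left ?_ (by norm_num)
    refine (hG _ _ _ _ ((S.U_le (n + 1) (by omega)).trans hKR)
      ((S.U_le (n + 2) (by omega)).trans hKR) hV1 hV2).trans ?_
    refine mul_le_mul_of_nonneg_left (add_le_add le_rfl ?_) hM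
    exact mul_le_mul_of_nonneg_right (S.U_diff (n + 1) (by omega))
      (add_nonneg (gridNorm_nonneg _) (gridNorm_nonneg _))
  · have : V (n + 2) - V n = (V (n + 2) - V (n + 1)) + (V (n + 1) - V n) := by abel
    rw [this]
    have h1 := hvd (n + 1) (by omega)
    have h2 := hvd n (by omega)
    have := gridNorm_add_le hh (V (n + 2) - V (n + 1)) (V (n + 1) - V n)
    linarith
  · have : ε (n + 2) = ε n + (ε (n + 2) - ε n) := by abel
    conv_lhs => rw [show ε (n + 1 + 1) = ε (n + 2) from rfl, this]
    exact gridNorm_add_le hh _ _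
  · have : U (n + 2) - V (n + 2) = (U (n + 1) - V (n + 1))
        + (U (n + 2) - V (n + 2) - (U (n + 1) - V (n + 1))) := by abel
    conv_lhs => rw [show U (n + 1 + 1) - V (n + 1 + 1) = U (n + 2) - V (n + 2) from rfl, this]
    exact gridNorm_add_le hh _ _
  · have : U (n + 1) - V (n + 1) = (U n - V n) + (U (n + 1) - V (n + 1) - (U n - V n)) := by abel
    conv_lhs => rw [this]
    exact gridNorm_add_le hh _ _

/-- Since θ vanishes exactly at the initial time, θ_1 is O(τη), so the first corrected difference
divided by τ is O(η). A starting error of mere size O(η) would not suffice here. The factor 12 adds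
up the bounds of the individual terms. -/
theorem size_zero_le (S : ErrorSystem g J h K τ η N U V ρ φ ε c r) {R M Q : ℝ} (hK : 1 ≤ K)
    (hR : 19 * K ^ 2 ≤ R) (hRQ : R ≤ Q) (hMQ : 2 * M ≤ Q)
    (hη : 12 * Q ^ 4 * η ≤ 1) (hτQ : 16 * Q ^ 3 * τ ≤ 1)
    (hG : ∀ u v : Grid J, gridNorm h u ≤ R → gridNorm h v ≤ R →
        gridNorm h (nonlin g u - nonlin g v) ≤ M * gridNorm h (u - v))
    (hN : 1 < N) : size h τ U V ρ ε 0 + η ≤ 12 * Q ^ 4 * η := by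
  have hh := S.h_pos.le
  have hτ := S.τ_pos
  have hη0 := S.η_nonneg
  have kk : K ≤ K ^ 2 := by nlinarith
  have k1 : (1 : ℝ) ≤ K ^ 2 := by nlinarith
  have hKR : K ≤ R := by linarith
  have hQ : 1 ≤ Q := by linarith
  have q2 : Q ≤ Q ^ 2 := by nlinarith
  have q3 : Q ^ 2 ≤ Q ^ 3 := by nlinarith [sq_nonneg Q]
  have q4 : Q ^ 3 ≤ Q ^ 4 := by nlinarith [pow_pos (by linarith : 0 < Q) 3]
  have hτK : τ * (K * (K + 1)) ≤ 1 := by nlinarith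
  have hKQ : K ≤ Q := hKR.trans hRQ
  have Q2η : Q * η ≤ Q ^ 2 * η := mul_le_mul_of_nonneg_right q2 hη0
  have Q3η : Q ^ 2 * η ≤ Q ^ 3 * η := mul_le_mul_of_nonneg_right q3 hη0
  have Q4η : Q ^ 3 * η ≤ Q ^ 4 * η := mul_le_mul_of_nonneg_right q4 hη0
  have Q1η : η ≤ Q * η := by nlinarith
  have hx0 : gridNorm h (ε 0) ≤ Q * η :=
    S.initial_relax.trans (mul_le_mul_of_nonneg_right hKQ hη0)
  have he0 : gridNorm h (U 0 - V 0) ≤ Q * η := by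
    have : U 0 - V 0 = (U 0 + ρ 0 - V 0) - ρ 0 := by abel
    rw [this, S.initial, zero_sub, ← zero_sub, gridNorm_sub_comm hh, sub_zero]
    exact (S.ρ_le 0 (by omega)).trans (mul_le_mul_of_nonneg_right hKQ hη0)
  have hx01 : gridNorm h (ε 0) ≤ 1 := by linarith
  have he1 : gridNorm h (U 1 - V 1) ≤ Q ^ 2 * η := by
    refine (S.gridNorm_error_succ_le hK (by omega : 0 < N) hτK hx01).trans ?_
    have : 6 * K ^ 2 * (gridNorm h (U 0 - V 0) + gridNorm h (ε 0) + η)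
        ≤ 6 * K ^ 2 * (3 * (Q * η)) :=
      mul_le_mul_of_nonneg_left (by linarith) (by positivity)
    have h2 : 18 * K ^ 2 * (Q * η) ≤ Q * (Q * η) :=
      mul_le_mul_of_nonneg_right (by linarith) (by positivity)
    nlinarith
  have hVb : ∀ m ≤ N, gridNorm h (V m) ≤ K + gridNorm h (U m - V m) := fun m hm => by
    have : V m = U m - (U m - V m) := by abel
    conv_lhs => rw [this]
    exact (gridNorm_sub_le hh _ _).trans (add_le_add (S.U_le m hm) le_rfl)
  have hV0 : gridNorm h (V 0) ≤ R := (hVb 0 (by omega)).trans (by linarith)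
  have hV1 : gridNorm h (V 1) ≤ R := (hVb 1 (by omega)).trans (by linarith)
  have hx1 : gridNorm h (ε 1) ≤ 3 * (Q ^ 3 * η) := by
    have e : ε 1 = (2 : ℂ) • (nonlin g (U 1) - nonlin g (V 1)) + c 0 - ε 0 := by
      rw [← S.relax 0 (by omega)]; abel
    rw [e]
    have h1 := gridNorm_sub_le hh ((2 : ℂ) • (nonlin g (U 1) - nonlin g (V 1)) + c 0) (ε 0)
    have h2 := gridNorm_add_le hh ((2 : ℂ) • (nonlin g (U 1) - nonlin g (V 1))) (c 0)
    rw [gridNorm_smul hh, Complex.norm_ofNat] at h2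
    have h3 := hG _ _ ((S.U_le 1 (by omega)).trans hKR) hV1
    have h4 : K * η ≤ Q * η := mul_le_mul_of_nonneg_right hKQ hη0
    have h5 := S.c_le 0 (by omega)
    have h6 : 2 * M * gridNorm h (U 1 - V 1) ≤ Q * (Q ^ 2 * η) :=
      mul_le_mul hMQ he1 (gridNorm_nonneg _) (by linarith)
    nlinarith
  have hθ : seminormH1 h (U 1 + ρ 1 - V 1) ≤ τ * (3 * (Q ^ 3 * η)) := by
    have h1 := S.seminormH1_θ_succ_le (by omega : 0 < N) hx01
    have hz : seminormH1 h (0 : Grid J) = 0 := by simp [seminormH1, diffQuot]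
    rw [S.initial, hz, zero_add, zero_add] at h1
    refine h1.trans (mul_le_mul_of_nonneg_left ?_ hτ.le)
    have t1 : K * gridNorm h (ε 0) ≤ Q * (Q * η) :=
      mul_le_mul hKQ hx0 (gridNorm_nonneg _) (by linarith)
    have t2 : (K + 1) * ((gridNorm h (U 0 - V 0) + gridNorm h (U 1 - V 1)) / 2)
        ≤ Q * (Q ^ 2 * η) := by
      refine mul_le_mul (by linarith) ?_ ?_ (by linarith)
      · linarith
      · exact div_nonneg (add_nonneg (gridNorm_nonneg _) (gridNorm_nonneg _)) (by norm_num)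
    have t3 : K * η ≤ Q * η := mul_le_mul_of_nonneg_right hKQ hη0
    nlinarith
  have hd : seminormH1 h (corrDiff τ U V ρ ε 0) / τ ≤ 5 * (Q ^ 4 * η) := by
    rw [div_le_iff₀ hτ]
    have e : corrDiff τ U V ρ ε 0 = (U 1 + ρ 1 - V 1)
        + (Complex.I * τ / 2) • (V 1 * ε 1 - V 0 * ε 0) := by
      rw [corrDiff, S.initial]; module
    have e2 : ‖Complex.I * (τ : ℂ) / 2‖ = τ / 2 := by
      rw [norm_div, norm_I_mul hτ]; norm_num
    rw [e]
    refine (seminormH1_add_le hh _ _).trans ?_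
    rw [seminormH1_smul hh, e2]
    have h1 : seminormH1 h (V 1 * ε 1 - V 0 * ε 0) ≤ Q * (3 * (Q ^ 3 * η)) + Q * (Q * η) := by
      refine (seminormH1_le_gridNorm _).trans ((gridNorm_sub_le hh _ _).trans (add_le_add ?_ ?_))
      · exact (gridNorm_mul_le hh _ _).trans
          (mul_le_mul (hV1.trans hRQ) hx1 (gridNorm_nonneg _) (by linarith))
      · exact (gridNorm_mul_le hh _ _).trans
          (mul_le_mul (hV0.trans hRQ) hx0 (gridNorm_nonneg _) (by linarith))
    have h2 : Q * (3 * (Q ^ 3 * η)) + Q * (Q * η) ≤ 4 * (Q ^ 4 * η) := by nlinarith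
    have h3 := mul_le_mul_of_nonneg_left (h1.trans h2) (by positivity : 0 ≤ τ / 2)
    have h4 := mul_le_mul_of_nonneg_left Q4η hτ.le
    linarith
  unfold size
  simp only [zero_add]
  linarith

end ErrorSystem

/-- Second order convergence in an error system with small parameters. -/
theorem ErrorSystem.exists_bound {g : ℝ → ℝ} (hg : ContDiffOn ℝ 3 g (Ici 0)) {K T : ℝ}
    (hK : 1 ≤ K) (hT : 0 ≤ T) :
    ∃ C τ₀ η₀ : ℝ, 0 < C ∧ 0 < τ₀ ∧ 0 < η₀ ∧
      ∀ (J : ℕ) (h τ η : ℝ) (N : ℕ) (U V ρ φ ε c r : ℕ → Grid J),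
        ErrorSystem g J h K τ η N U V ρ φ ε c r → τ ≤ τ₀ → η ≤ η₀ → N * τ ≤ T →
        (∀ n ≤ N, gridNorm h (U n - V n) ≤ C * η) ∧ ∀ n < N, gridNorm h (ε n) ≤ C * η := by
  obtain ⟨M, hM0, hM⟩ := exists_nonlin_bounds hg (19 * K ^ 2)
  set R := 19 * K ^ 2 with hR
  -- One number dominating K, R and 2M, so that all constants become powers of Q.
  set Q := R + 2 * M with hQdef
  have k1 : (1 : ℝ) ≤ K ^ 2 := by nlinarith
  have kk : K ≤ K ^ 2 := by nlinarith
  have hQ : 1 ≤ Q := by linarith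
  set G := Real.exp (200 * Q ^ 3 * T) * (12 * Q ^ 4) with hGdef
  have hexp : 1 ≤ Real.exp (200 * Q ^ 3 * T) := Real.one_le_exp (by positivity)
  have hG12 : 12 * Q ^ 4 ≤ G := le_mul_of_one_le_left (by positivity) hexp
  have hQ4 : Q ≤ Q ^ 4 := le_self_pow₀ hQ (by norm_num)
  have hG0 : 0 < G := by positivity
  -- G is the Gronwall factor; η ≤ 1/G keeps the size below 1 at every step. The extra factor 6K²(G
  -- + 1) pays for the last crude step to node N.
  refine ⟨6 * K ^ 2 * (G + 1), 1 / (16 * Q ^ 3), 1 / G, by positivity, by positivity,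
    by positivity, fun J h τ η N U V ρ φ ε c r S hτ hη hN => ?_⟩
  obtain ⟨hG1, hG2⟩ := hM J h S.h_pos
  have hτ0 := S.τ_pos
  have hη0 := S.η_nonneg
  have hτQ : 16 * Q ^ 3 * τ ≤ 1 := by
    rw [le_div_iff₀ (by positivity)] at hτ; linarith
  have hηG : G * η ≤ 1 := by
    rw [le_div_iff₀ hG0] at hη; linarith
  have hη12 : 12 * Q ^ 4 * η ≤ 1 := (mul_le_mul_of_nonneg_right hG12 hη0).trans hηG
  have hη1 : η ≤ 1 := by nlinarith
  have hpow : ∀ n ≤ N, (1 + 200 * Q ^ 3 * τ) ^ n * (12 * Q ^ 4 * η) ≤ G * η := by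
    intro n hn
    have h1 : (1 + 200 * Q ^ 3 * τ) ^ n ≤ Real.exp (200 * Q ^ 3 * T) := by
      calc (1 + 200 * Q ^ 3 * τ) ^ n ≤ (Real.exp (200 * Q ^ 3 * τ)) ^ n := by
            refine pow_le_pow_left₀ (by positivity) ?_ n
            rw [add_comm]; exact Real.add_one_le_exp _
        _ = Real.exp (n * (200 * Q ^ 3 * τ)) := (Real.exp_nat_mul _ n).symm
        _ ≤ _ := by
            refine Real.exp_le_exp.2 ?_
            have : (n : ℝ) * τ ≤ T := le_trans (by gcongr) hN
            have := mul_le_mul_of_nonneg_left this (by positivity : 0 ≤ 200 * Q ^ 3)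
            linarith
    calc _ ≤ Real.exp (200 * Q ^ 3 * T) * (12 * Q ^ 4 * η) := by gcongr
      _ = _ := by rw [hGdef]; ring
  have main : ∀ n, n + 1 < N → ErrorSystem.size h τ U V ρ ε n + η
      ≤ (1 + 200 * Q ^ 3 * τ) ^ n * (12 * Q ^ 4 * η) := by
    intro n
    induction n with
    | zero =>
      intro hn
      rw [pow_zero, one_mul]
      exact S.size_zero_le (R := R) (M := M) hK le_rfl (by linarith) (by linarith) hη12 hτQ
        hG1 hn
    | succ n ih =>
      intro hn
      have h1 := ih (by omega)
      -- The bound just proved is at most Gη ≤ 1, which is the hypothesis needed for the next step.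
      have h2 := h1.trans (hpow n (by omega))
      have h3 := S.size_succ_le (R := R) (M := M) (Q := Q) hK le_rfl (by linarith) (by linarith)
        hM0 hη1 hτQ hG2 (n := n) hn (by linarith)
      have h4 := mul_le_mul_of_nonneg_left h1 (by positivity : 0 ≤ 1 + 200 * Q ^ 3 * τ)
      rw [pow_succ]
      linarith
  -- The size at n involves ε_{n+1} and hence is available only for n + 1 < N. It reaches node N −
  -- 1; index 0 is treated apart so that N = 1 is covered.
  have hboth : ∀ n < N, gridNorm h (U n - V n) + gridNorm h (ε n) ≤ G * η := by
    intro n hn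
    rcases n with _ | n
    · have he0 : gridNorm h (U 0 - V 0) ≤ K * η := by
        have : U 0 - V 0 = (U 0 + ρ 0 - V 0) - ρ 0 := by abel
        rw [this, S.initial, gridNorm_sub_comm S.h_pos.le, sub_zero]
        exact S.ρ_le 0 (by omega)
      have := S.initial_relax
      have h2 : 2 * K * η ≤ G * η := mul_le_mul_of_nonneg_right (by linarith) hη0
      linarith
    · have h1 := (main n hn).trans (hpow n (by omega))
      unfold ErrorSystem.size at h1
      have := div_nonneg (seminormH1_nonneg (h := h) (ErrorSystem.corrDiff τ U V ρ ε n)) hτ0.le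
      have := gridNorm_nonneg (h := h) (ε n)
      have := gridNorm_nonneg (h := h) (U n - V n)
      linarith
  have hC : G ≤ 6 * K ^ 2 * (G + 1) := by nlinarith
  have hCη : G * η ≤ 6 * K ^ 2 * (G + 1) * η := mul_le_mul_of_nonneg_right hC hη0
  refine ⟨fun n hn => ?_, fun n hn => ?_⟩
  · rcases n with _ | n
    · have he0 : gridNorm h (U 0 - V 0) ≤ K * η := by
        have : U 0 - V 0 = (U 0 + ρ 0 - V 0) - ρ 0 := by abel
        rw [this, S.initial, gridNorm_sub_comm S.h_pos.le, sub_zero]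
        exact S.ρ_le 0 (by omega)
      have h2 : K * η ≤ G * η := mul_le_mul_of_nonneg_right (by linarith) hη0
      linarith
    · have h1 := hboth n hn
      have h2 := gridNorm_nonneg (h := h) (U n - V n)
      have hτK : τ * (K * (K + 1)) ≤ 1 := by
        have : K * (K + 1) ≤ 16 * Q ^ 3 := by
          have : Q ≤ Q ^ 3 := le_self_pow₀ hQ (by norm_num)
          nlinarith
        nlinarith
      refine (S.gridNorm_error_succ_le hK hn hτK (by linarith)).trans ?_
      rw [mul_assoc, mul_assoc (6 * K ^ 2)]
      rw [mul_assoc 6]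
      gcongr
      linarith
  · have h1 := hboth n hn
    have h2 := gridNorm_nonneg (h := h) (U n - V n)
    linarith

/-! ### Solvability of the linear problems, uniqueness -/

section Solve

variable {J : ℕ} {h : ℝ}

/-- An injective linear map of the space of grid functions vanishing at the ends is onto. -/
theorem exists_of_injOn (A : Grid J →ₗ[ℂ] Grid J)
    (hA : ∀ v, VanishesAtEnds v → VanishesAtEnds (A v))
    (hinj : ∀ v, VanishesAtEnds v → A v = 0 → v = 0) {f : Grid J} (hf : VanishesAtEnds f) :
    ∃ v, VanishesAtEnds v ∧ A v = f := by
  let B : zeroEnds J →ₗ[ℂ] zeroEnds J := A.restrict hA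
  have hB : Function.Injective B := by
    refine (injective_iff_map_eq_zero B).2 fun v hv => ?_
    exact Subtype.ext (hinj v v.2 (congrArg Subtype.val hv))
  obtain ⟨v, hv⟩ := LinearMap.injective_iff_surjective.1 hB ⟨f, hf⟩
  exact ⟨v, v.2, congrArg Subtype.val hv⟩

theorem eq_zero_of_seminormH1 (hh : 0 < h) {v : Grid J} (hv : VanishesAtEnds v)
    (h0 : seminormH1 h v ≤ 0) : v = 0 := by
  ext j
  have := norm_apply_le_sqrt_mul_seminormH1 hh rfl hv.1 j
  rw [le_antisymm h0 (seminormH1_nonneg _), mul_zero] at this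
  simpa using this

theorem eq_of_laplacian_eq (hh : 0 < h) {v w : Grid J} (hv : VanishesAtEnds v)
    (hw : VanishesAtEnds w) (H : laplacian h v = laplacian h w) : v = w := by
  refine sub_eq_zero.1 (eq_zero_of_seminormH1 hh (hv.sub hw) ?_)
  have := seminormH1_le_laplacian hh rfl le_rfl (hv.sub hw) (fun i => by
    rw [laplacian_sub, H, sub_self]; simp)
  simpa using this

theorem exists_laplacian_eq (hh : 0 < h) {f : Grid J} (hf : VanishesAtEnds f) :
    ∃ v, VanishesAtEnds v ∧ laplacian h v = f :=
  exists_of_injOn (laplacianL h J) (fun _ _ => vanishesAtEnds_laplacian _)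
    (fun _ hv h0 => eq_of_laplacian_eq hh hv ⟨rfl, rfl⟩
      (h0.trans ((laplacianL h J).map_zero).symm)) hf

/-- The `ℓ²` energy identity for an implicit step. -/
theorem sum_norm_sq_eq (hh : 0 < h) {κ : ℝ} {d q : Grid J} (hd : VanishesAtEnds d)
    (H : d = (Complex.I * κ) • laplacian h d + q) :
    ∑ j, ‖d j‖ ^ 2 = (∑ j, conj (d j) * q j).re := by
  have e1 : ∀ v : ℂ, conj v * v = ((‖v‖ ^ 2 : ℝ) : ℂ) := fun v => by
    rw [Complex.conj_mul']; push_cast; rfl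
  have e2 : ∑ j, conj (d j) * d j
      = Complex.I * κ * ∑ j, conj (d j) * laplacian h d j + ∑ j, conj (d j) * q j := by
    rw [Finset.mul_sum, ← Finset.sum_add_distrib]
    refine Finset.sum_congr rfl fun j _ => ?_
    conv_lhs => rw [show d j = Complex.I * κ * laplacian h d j + q j from congrFun H j]
    conv_rhs => rw [show d j = Complex.I * κ * laplacian h d j + q j from congrFun H j]
    ring
  rw [sum_conj_mul_laplacian hh.ne' hd] at e2
  simp only [e1] at e2
  rw [← Complex.ofReal_sum, ← Complex.ofReal_sum] at e2
  have := congrArg Complex.re e2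
  rw [Complex.ofReal_re, Complex.add_re] at this
  have e3 : Complex.I * κ * -((∑ i, ‖diffQuot h d i‖ ^ 2 : ℝ) : ℂ)
      = ((-κ * ∑ i, ‖diffQuot h d i‖ ^ 2 : ℝ) : ℂ) * Complex.I := by push_cast; ring
  rw [this, e3, Complex.re_ofReal_mul, Complex.I_re, mul_zero, zero_add]

theorem eq_zero_of_sum_norm_sq {d : Grid J} (H : ∑ j, ‖d j‖ ^ 2 ≤ 0) : d = 0 := by
  ext j
  have := (Finset.sum_eq_zero_iff_of_nonneg (fun j _ => sq_nonneg ‖d j‖)).1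
    (le_antisymm H (Finset.sum_nonneg fun j _ => sq_nonneg ‖d j‖)) j (Finset.mem_univ _)
  simpa using this

/-- The Laplacian contributes nothing to the real part of the energy identity, so a perturbation
below half of d forces d = 0 without any condition relating κ and h. -/
theorem eq_zero_of_small (hh : 0 < h) {κ : ℝ} {d q : Grid J} (hd : VanishesAtEnds d)
    (H : d = (Complex.I * κ) • laplacian h d + q) (hq : ∀ j, ‖q j‖ ≤ ‖d j‖ / 2) : d = 0 := by
  refine eq_zero_of_sum_norm_sq ?_
  have h1 := sum_norm_sq_eq hh hd H
  have h2 : (∑ j, conj (d j) * q j).re ≤ ∑ j, ‖d j‖ ^ 2 / 2 := by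
    rw [Complex.re_sum]
    refine Finset.sum_le_sum fun j _ => (Complex.re_le_norm _).trans ?_
    rw [norm_mul, Complex.norm_conj]
    nlinarith [hq j, norm_nonneg (d j)]
  rw [← Finset.sum_div] at h2
  linarith

/-- A real potential times i is skew-adjoint and drops out of the energy identity, however large it
is. -/
theorem eq_zero_of_real (hh : 0 < h) {κ : ℝ} {a : Fin (J + 2) → ℝ} {d : Grid J}
    (hd : VanishesAtEnds d)
    (H : d = (Complex.I * κ) • laplacian h d + fun j => Complex.I * (a j : ℂ) * d j) : d = 0 := by
  refine eq_zero_of_sum_norm_sq ?_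
  rw [sum_norm_sq_eq hh hd H, Complex.re_sum]
  refine le_of_eq (Finset.sum_eq_zero fun j _ => ?_)
  have : conj (d j) * (Complex.I * (a j : ℂ) * d j) = ((a j * ‖d j‖ ^ 2 : ℝ) : ℂ) * Complex.I := by
    push_cast; rw [← Complex.conj_mul']; ring
  rw [this, Complex.re_ofReal_mul, Complex.I_re, mul_zero]

end Solve

/-! ### Mesh parameters -/

theorem Problem.h_pos (P : Problem) (J : ℕ) : 0 < P.h J :=
  div_pos (sub_pos.2 P.xa_lt_xb) (by positivity)

theorem Problem.h_mul (P : Problem) (J : ℕ) : P.h J * (J + 1) = P.L := by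
  unfold Problem.h; field_simp

theorem Problem.L_pos (P : Problem) : 0 < P.L := sub_pos.2 P.xa_lt_xb

theorem Problem.τ_pos (P : Problem) {N : ℕ} (hN : 1 ≤ N) : 0 < P.τ N :=
  div_pos P.T_pos (by exact_mod_cast hN)

theorem Problem.mul_τ (P : Problem) {N : ℕ} (hN : 1 ≤ N) : N * P.τ N = P.T := by
  have : (N : ℝ) ≠ 0 := by positivity
  unfold Problem.τ; field_simp

/-! ### Single time steps and the two schemes -/

section Steps

variable {P : Problem} {J : ℕ} {s k : ℝ}

/-- The equation for the difference of two steps with the same initial value. -/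
theorem Step.sub_eq {V₀ V₁ V₁' M M' : Grid J} (H : Step P s k V₀ V₁ M)
    (H' : Step P s k V₀ V₁' M') :
    V₁ - V₁' = (Complex.I * ((k / 2 : ℝ) : ℂ)) • laplacian (P.h J) (V₁ - V₁')
      + (Complex.I * (k : ℂ)) • (M - M') := by
  have e : avg V₁ V₀ - avg V₁' V₀ = (1 / 2 : ℂ) • (V₁ - V₁') := by
    rw [avg_eq, avg_eq]; module
  have e1 : V₁ - V₁' = (V₁ - V₀) - (V₁' - V₀) := by abel
  have e2 : (Complex.I * ((k / 2 : ℝ) : ℂ)) • laplacian (P.h J) (V₁ - V₁')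
      = (Complex.I * (k : ℂ)) • (laplacian (P.h J) (avg V₁ V₀) - laplacian (P.h J) (avg V₁' V₀)) := by
    rw [← laplacian_sub, e, laplacian_smul, smul_smul]
    congr 1; push_cast; ring
  unfold Step at H H'
  rw [e2, e1, H, H']
  module

theorem Step.unique_linear {V₀ V₁ V₁' : Grid J} {a : Fin (J + 2) → ℝ}
    (h1 : VanishesAtEnds V₁) (h1' : VanishesAtEnds V₁')
    (H : Step P s k V₀ V₁ fun j => (a j : ℂ) * avg V₁ V₀ j)
    (H' : Step P s k V₀ V₁' fun j => (a j : ℂ) * avg V₁' V₀ j) : V₁ = V₁' := by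
  refine sub_eq_zero.1 (eq_zero_of_real (P.h_pos J) (κ := k / 2) (a := fun j => k / 2 * a j)
    (h1.sub h1') ((H.sub_eq H').trans ?_))
  congr 1
  ext j
  simp [avg]
  ring

/-- The step is a square linear system on a finite-dimensional space, injective by
`eq_zero_of_real`; hence it is solvable for every step length and every real coefficient. -/
theorem exists_linear_step {V₀ : Grid J} (h0 : VanishesAtEnds V₀) (a : Fin (J + 2) → ℝ) :
    ∃ V₁, VanishesAtEnds V₁ ∧ Step P s k V₀ V₁ fun j => (a j : ℂ) * avg V₁ V₀ j := by
  let A : Grid J →ₗ[ℂ] Grid J := LinearMap.id - (Complex.I * ((k / 2 : ℝ) : ℂ)) • laplacianL (P.h J) J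
    - (Complex.I * ((k / 2 : ℝ) : ℂ)) • LinearMap.mulLeft ℂ (toGrid a)
  have hA : ∀ v, A v = v - (Complex.I * ((k / 2 : ℝ) : ℂ)) • laplacian (P.h J) v
    - (Complex.I * ((k / 2 : ℝ) : ℂ)) • (toGrid a * v) := fun v => rfl
  have hmul : ∀ v : Grid J, VanishesAtEnds v → VanishesAtEnds (toGrid a * v) := fun v hv => by
    rw [mul_comm]; exact hv.mul _
  set F : Grid J := (k : ℂ) • sampleInterior P J fun x => (P.f (s + k) x + P.f s x) / 2
  have hF : VanishesAtEnds F := (vanishesAtEnds_extendZero _).smul _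
  have hinj : ∀ v, VanishesAtEnds v → A v = 0 → v = 0 := by
    intro v hv hz
    refine eq_zero_of_real (P.h_pos J) (κ := k / 2) (a := fun j => k / 2 * a j) hv ?_
    rw [hA, sub_sub, sub_eq_zero] at hz
    refine hz.trans ?_
    congr 1
    ext j
    simp [toGrid]
    ring
  obtain ⟨v, hv, hAv⟩ := exists_of_injOn A
    (fun v hv => (hv.sub ((vanishesAtEnds_laplacian v).smul _)).sub ((hmul v hv).smul _)) hinj
    (f := V₀ + (Complex.I * ((k / 2 : ℝ) : ℂ)) • laplacian (P.h J) V₀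
      + (Complex.I * ((k / 2 : ℝ) : ℂ)) • (toGrid a * V₀) + F)
    (((h0.add ((vanishesAtEnds_laplacian _).smul _)).add ((hmul V₀ h0).smul _)).add hF)
  refine ⟨v, hv, ?_⟩
  have e : (fun j => (a j : ℂ) * avg v V₀ j) = (1 / 2 : ℂ) • (toGrid a * v + toGrid a * V₀) := by
    ext j; simp [avg, toGrid]; ring
  rw [Step, e, avg_eq, laplacian_smul, laplacian_add]
  rw [hA] at hAv
  have e2 : (Complex.I * ((k / 2 : ℝ) : ℂ)) = (Complex.I * (k : ℂ)) * (1 / 2) := by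
    push_cast; ring
  rw [e2] at hAv
  have e3 : v = V₀ + ((Complex.I * (k : ℂ)) * (1 / 2)) • laplacian (P.h J) V₀
    + ((Complex.I * (k : ℂ)) * (1 / 2)) • (toGrid a * V₀) + F
    + ((Complex.I * (k : ℂ)) * (1 / 2)) • laplacian (P.h J) v
    + ((Complex.I * (k : ℂ)) * (1 / 2)) • (toGrid a * v) := by
    rw [← hAv]; abel
  conv_lhs => rw [e3]
  module

/-- Both schemes at once, with cut-off functions `m` and `c`. -/
structure IsScheme (P : Problem) (m : ℝ → ℝ) (c : ℂ → ℂ) (N J : ℕ) (V : ℕ → Grid J)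
    (Vhalf : Grid J) (Φ : ℕ → Fin (J + 2) → ℝ) : Prop where
  ends : ∀ n ≤ N, VanishesAtEnds (V n)
  ends_half : VanishesAtEnds Vhalf
  initial : IsEllipticProjection P P.u₀ (V 0)
  half_step : Step P 0 (P.τ N / 2) (V 0) Vhalf
    fun j => (P.g (‖P.u₀ (P.x J j)‖ ^ 2) : ℂ) * avg Vhalf (V 0) j
  Φ_zero : ∀ j, Φ 0 j = P.g (‖c (Vhalf j)‖ ^ 2)
  Φ_succ : ∀ n, n + 1 < N → ∀ j, Φ (n + 1) j = 2 * P.g (‖c (V (n + 1) j)‖ ^ 2) - Φ n j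
  step : ∀ n < N, Step P (P.t N n) (P.τ N) (V n) (V (n + 1))
    fun j => (m (Φ n j) : ℂ) * c (avg (V (n + 1)) (V n) j)

theorem isRFD_iff {N : ℕ} {V : ℕ → Grid J} {Vhalf : Grid J} {Φ : ℕ → Fin (J + 2) → ℝ} :
    IsRFD P N J V Vhalf Φ ↔ IsScheme P id id N J V Vhalf Φ :=
  ⟨fun H => ⟨H.1, H.2, H.3, H.4, H.5, H.6, H.7⟩, fun H => ⟨H.1, H.2, H.3, H.4, H.5, H.6, H.7⟩⟩

theorem isMRFD_iff {N : ℕ} {δ : ℝ} {V : ℕ → Grid J} {Vhalf : Grid J} {Φ : ℕ → Fin (J + 2) → ℝ} :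
    IsMRFD P δ N J V Vhalf Φ ↔ IsScheme P (mollifier δ) (cmollifier δ) N J V Vhalf Φ :=
  ⟨fun H => ⟨H.1, H.2, H.3, H.4, H.5, H.6, H.7⟩, fun H => ⟨H.1, H.2, H.3, H.4, H.5, H.6, H.7⟩⟩

/-- The cut-offs enter only through their values at the approximations, their averages and Φ. If the
values agree there, the same grid functions solve both schemes. -/
theorem IsScheme.congr {m m' : ℝ → ℝ} {c c' : ℂ → ℂ} {N : ℕ} {V : ℕ → Grid J} {Vhalf : Grid J}
    {Φ : ℕ → Fin (J + 2) → ℝ} (H : IsScheme P m c N J V Vhalf Φ)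
    (h1 : ∀ j, c (Vhalf j) = c' (Vhalf j)) (h2 : ∀ n ≤ N, ∀ j, c (V n j) = c' (V n j))
    (h3 : ∀ n < N, ∀ j, c (avg (V (n + 1)) (V n) j) = c' (avg (V (n + 1)) (V n) j))
    (h4 : ∀ n < N, ∀ j, m (Φ n j) = m' (Φ n j)) : IsScheme P m' c' N J V Vhalf Φ where
  ends := H.ends
  ends_half := H.ends_half
  initial := H.initial
  half_step := H.half_step
  Φ_zero j := by rw [H.Φ_zero, h1]
  Φ_succ n hn j := by rw [H.Φ_succ n hn, h2 _ hn.le]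
  step n hn := by
    have := H.step n hn
    simp only [h3 n hn, h4 n hn] at this
    exact this

theorem exists_scheme {m : ℝ → ℝ} {c : ℂ → ℂ} {N : ℕ}
    (hstep : ∀ n < N, ∀ (V₀ : Grid J) (Φ : Fin (J + 2) → ℝ), VanishesAtEnds V₀ →
      ∃ V₁, VanishesAtEnds V₁ ∧ Step P (P.t N n) (P.τ N) V₀ V₁
        fun j => (m (Φ j) : ℂ) * c (avg V₁ V₀ j)) :
    ∃ V Vhalf Φ, IsScheme P m c N J V Vhalf Φ := by
  obtain ⟨R, hR, hRlap⟩ := exists_laplacian_eq (P.h_pos J)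
    (f := sampleInterior P J (iteratedDerivWithin 2 P.u₀ P.I)) (vanishesAtEnds_extendZero _)
  obtain ⟨Vh, hVh, hVhs⟩ := exists_linear_step (P := P) (s := 0) (k := P.τ N / 2) hR
    (fun j => P.g (‖P.u₀ (P.x J j)‖ ^ 2))
  -- The one-step solution is made a total function, with the assumptions moved behind the
  -- existential, so that it can be chosen and iterated by recursion.
  have : ∀ (n : ℕ) (V₀ : Grid J) (Φ : Fin (J + 2) → ℝ), ∃ V₁, n < N → VanishesAtEnds V₀ →
      VanishesAtEnds V₁ ∧ Step P (P.t N n) (P.τ N) V₀ V₁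
        fun j => (m (Φ j) : ℂ) * c (avg V₁ V₀ j) := by
    intro n V₀ Φ
    by_cases hn : n < N ∧ VanishesAtEnds V₀
    · obtain ⟨V₁, h1⟩ := hstep n hn.1 V₀ Φ hn.2
      exact ⟨V₁, fun _ _ => h1⟩
    · exact ⟨0, fun a b => absurd ⟨a, b⟩ hn⟩
  choose next hnext using this
  let seq : ℕ → Grid J × (Fin (J + 2) → ℝ) := fun n => Nat.rec
    (R, fun j => P.g (‖c (Vh j)‖ ^ 2))
    (fun n p => (next n p.1 p.2, fun j => 2 * P.g (‖c (next n p.1 p.2 j)‖ ^ 2) - p.2 j)) n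
  have hseq : ∀ n, seq (n + 1) = (next n (seq n).1 (seq n).2,
    fun j => 2 * P.g (‖c (next n (seq n).1 (seq n).2 j)‖ ^ 2) - (seq n).2 j) := fun n => rfl
  have hmem : ∀ n ≤ N, VanishesAtEnds (seq n).1 := by
    intro n
    induction n with
    | zero => intro _; exact hR
    | succ n ih =>
      intro hn
      rw [hseq]
      exact (hnext n _ _ hn (ih (by omega))).1
  refine ⟨fun n => (seq n).1, Vh, fun n => (seq n).2, hmem, hVh, ⟨hR, hRlap⟩, hVhs,
    fun j => rfl, fun n _ j => ?_, fun n hn => ?_⟩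
  · simp only [hseq]
  · have := (hnext n (seq n).1 (seq n).2 hn (hmem n hn.le)).2
    simpa only [hseq] using this

theorem IsScheme.unique {m : ℝ → ℝ} {c : ℂ → ℂ} {N : ℕ}
    (hstep : ∀ n < N, ∀ (V₀ V₁ V₁' : Grid J) (Φ : Fin (J + 2) → ℝ),
      VanishesAtEnds V₁ → VanishesAtEnds V₁' →
      Step P (P.t N n) (P.τ N) V₀ V₁ (fun j => (m (Φ j) : ℂ) * c (avg V₁ V₀ j)) →
      Step P (P.t N n) (P.τ N) V₀ V₁' (fun j => (m (Φ j) : ℂ) * c (avg V₁' V₀ j)) → V₁ = V₁')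
    {V V' : ℕ → Grid J} {Vhalf Vhalf' : Grid J} {Φ Φ' : ℕ → Fin (J + 2) → ℝ}
    (H : IsScheme P m c N J V Vhalf Φ) (H' : IsScheme P m c N J V' Vhalf' Φ') :
    Vhalf = Vhalf' ∧ (∀ n ≤ N, V n = V' n) ∧ ∀ n < N, Φ n = Φ' n := by
  have h0 : V 0 = V' 0 := eq_of_laplacian_eq (P.h_pos J) (H.ends 0 (Nat.zero_le _))
    (H'.ends 0 (Nat.zero_le _)) (H.initial.2.trans H'.initial.2.symm)
  have hh : Vhalf = Vhalf' := by
    have h1 := H.half_step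
    have h2 := H'.half_step
    rw [h0] at h1
    exact Step.unique_linear (a := fun j => P.g (‖P.u₀ (P.x J j)‖ ^ 2)) H.ends_half H'.ends_half
      h1 h2
  have key : ∀ n < N, V n = V' n ∧ Φ n = Φ' n ∧ V (n + 1) = V' (n + 1) := by
    intro n
    induction n with
    | zero =>
      intro hn
      have hΦ : Φ 0 = Φ' 0 := by ext j; rw [H.Φ_zero, H'.Φ_zero, hh]
      refine ⟨h0, hΦ, hstep 0 hn (V 0) _ _ (Φ 0) (H.ends _ hn) (H'.ends _ hn) (H.step 0 hn) ?_⟩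
      rw [h0, hΦ]; exact H'.step 0 hn
    | succ n ih =>
      intro hn
      obtain ⟨-, hΦn, hV⟩ := ih (by omega)
      have hΦ : Φ (n + 1) = Φ' (n + 1) := by
        ext j; rw [H.Φ_succ n hn, H'.Φ_succ n hn, hV, hΦn]
      refine ⟨hV, hΦ, hstep _ hn (V (n + 1)) _ _ (Φ (n + 1)) (H.ends _ hn) (H'.ends _ hn)
        (H.step _ hn) ?_⟩
      rw [hV, hΦ]; exact H'.step _ hn
  refine ⟨hh, fun n hn => ?_, fun n hn => (key n hn).2.1⟩
  rcases n with _ | n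
  · exact h0
  · exact (key n hn).2.2

theorem exists_isRFD (P : Problem) (N J : ℕ) : ∃ W Whalf Φ, IsRFD P N J W Whalf Φ := by
  simp only [isRFD_iff]
  exact exists_scheme fun n _ V₀ Φ h0 => exists_linear_step h0 Φ

theorem IsRFD.unique {N : ℕ} {V V' : ℕ → Grid J} {Vhalf Vhalf' : Grid J}
    {Φ Φ' : ℕ → Fin (J + 2) → ℝ} (H : IsRFD P N J V Vhalf Φ) (H' : IsRFD P N J V' Vhalf' Φ') :
    Vhalf = Vhalf' ∧ (∀ n ≤ N, V n = V' n) ∧ ∀ n < N, Φ n = Φ' n :=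
  IsScheme.unique (m := id) (c := id)
    (fun _ _ V₀ V₁ V₁' Φ h1 h1' s s' =>
      Step.unique_linear (V₀ := V₀) (V₁ := V₁) (V₁' := V₁') (a := Φ) h1 h1' s s')
    (isRFD_iff.1 H) (isRFD_iff.1 H')

end Steps

/-! ### The mollifier -/

section Mollifier

variable {δ : ℝ}

theorem mollifier_of_abs_le {y : ℝ} (hy : |y| ≤ δ) : mollifier δ y = y := by
  rw [mollifier, if_pos hy, sign_mul_abs]

theorem cmollifier_of_norm_le {z : ℂ} (hz : ‖z‖ ≤ δ) : cmollifier δ z = z := by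
  rw [cmollifier, mollifier_of_abs_le ((Complex.abs_re_le_norm z).trans hz),
    mollifier_of_abs_le ((Complex.abs_im_le_norm z).trans hz)]

/-- The mollifier in terms of projections to intervals. -/
theorem mollifier_eq (hδ : 0 < δ) (y : ℝ) : mollifier δ y = max (-δ) (min δ y)
    + ((mollifierPoly δ).eval (max δ (min (2 * δ) y))
      - (mollifierPoly δ).eval (max δ (min (2 * δ) (-y)))) := by
  obtain ⟨-, p1, -, -, -, p2, -, -, -⟩ := mollifierPoly_isMollifierPoly hδ
  have key : ∀ y, 0 ≤ y → (if |y| ≤ δ then |y| else if |y| ≤ 2 * δ then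
      (mollifierPoly δ).eval |y| else 2 * δ) = max (-δ) (min δ y)
      + ((mollifierPoly δ).eval (max δ (min (2 * δ) y)) - δ) := by
    intro y hy
    rw [abs_of_nonneg hy]
    split_ifs with h1 h2
    · rw [min_eq_right h1, max_eq_right (by linarith), min_eq_right (by linarith),
        max_eq_left h1, p1]; ring
    · push Not at h1
      rw [min_eq_left h1.le, max_eq_right (by linarith), min_eq_right h2, max_eq_right h1.le]; ring
    · push Not at h1 h2
      rw [min_eq_left h1.le, max_eq_right (by linarith), min_eq_left h2.le,
        max_eq_right (by linarith), p2]; ring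
  rcases lt_trichotomy y 0 with hy | hy | hy
  · have := key (-y) (by linarith)
    rw [abs_neg] at this
    rw [mollifier, sign_neg hy, this, min_eq_right (by linarith : y ≤ 2 * δ),
      max_eq_left (by linarith : y ≤ δ), p1]
    have e : max (-δ) (min δ y) = -max (-δ) (min δ (-y)) := by
      rw [min_eq_right (by linarith : y ≤ δ)]
      rcases le_total δ (-y) with h | h
      · rw [min_eq_left h, max_eq_left (by linarith), max_eq_right (by linarith)]
      · rw [min_eq_right h, max_eq_right (by linarith), max_eq_right (by linarith), neg_neg]
    rw [e, SignType.coe_neg_one]; ring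
  · subst hy
    simp [mollifier, hδ.le]
  · rw [mollifier, sign_pos hy, key y hy.le, min_eq_right (by linarith : -y ≤ 2 * δ),
      max_eq_left (by linarith : -y ≤ δ), p1, SignType.coe_one]
    ring

/-- By `mollifier_eq` the mollifier is built from projections to intervals, which are 1-Lipschitz,
and one polynomial on the compact interval [δ, 2δ]; a global Lipschitz constant then needs no case
distinction. -/
theorem exists_mollifier_bounds (hδ : 0 < δ) : ∃ B, 1 ≤ B ∧ (∀ y, |mollifier δ y| ≤ B) ∧
    ∀ y z, |mollifier δ y - mollifier δ z| ≤ B * |y - z| := by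
  obtain ⟨A, hA⟩ := isCompact_Icc.exists_bound_of_continuousOn (s := Icc δ (2 * δ))
    (mollifierPoly δ).continuous.continuousOn
  obtain ⟨A', hA'⟩ := isCompact_Icc.exists_bound_of_continuousOn (s := Icc δ (2 * δ))
    (mollifierPoly δ).derivative.continuous.continuousOn
  have hδm : δ ∈ Icc δ (2 * δ) := ⟨le_rfl, by linarith⟩
  have hA0 : 0 ≤ A := (norm_nonneg _).trans (hA δ hδm)
  have hA'0 : 0 ≤ A' := (norm_nonneg _).trans (hA' δ hδm)
  have hmem : ∀ y, max δ (min (2 * δ) y) ∈ Icc δ (2 * δ) := fun y =>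
    ⟨le_max_left _ _, max_le (by linarith) (min_le_left _ _)⟩
  have hlip : ∀ x ∈ Icc δ (2 * δ), ∀ y ∈ Icc δ (2 * δ),
      |(mollifierPoly δ).eval x - (mollifierPoly δ).eval y| ≤ A' * |x - y| := fun x hx y hy =>
    (convex_Icc δ (2 * δ)).norm_image_sub_le_of_norm_hasDerivWithin_le
      (fun z _ => ((mollifierPoly δ).hasDerivAt z).hasDerivWithinAt) hA' hy hx
  have hcl : ∀ a b y z : ℝ, |max a (min b y) - max a (min b z)| ≤ |y - z| := fun a b y z =>
    by
    rw [max_comm a, max_comm a]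
    refine (abs_max_sub_max_le_abs _ _ _).trans ((abs_min_sub_min_le_max _ _ _ _).trans ?_)
    simp
  refine ⟨1 + δ + 2 * A + 2 * A', by linarith, fun y => ?_, fun y z => ?_⟩
  · rw [mollifier_eq hδ]
    have h1 : |max (-δ) (min δ y)| ≤ δ :=
      abs_le.2 ⟨le_max_left _ _, max_le (by linarith) (min_le_left _ _)⟩
    have h2 := hA _ (hmem y)
    have h3 := hA _ (hmem (-y))
    rw [Real.norm_eq_abs] at h2 h3
    refine (abs_add_le _ _).trans ((add_le_add h1 ((abs_sub _ _).trans (add_le_add h2 h3))).trans ?_)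
    linarith
  · rw [mollifier_eq hδ, mollifier_eq hδ]
    have h1 := hcl (-δ) δ y z
    have h2 := (hlip _ (hmem y) _ (hmem z)).trans (mul_le_mul_of_nonneg_left (hcl _ _ _ _) hA'0)
    have h3 := (hlip _ (hmem (-y)) _ (hmem (-z))).trans
      (mul_le_mul_of_nonneg_left (hcl _ _ _ _) hA'0)
    have e : |-y - -z| = |y - z| := by rw [← abs_neg]; congr 1; ring
    rw [e] at h3
    have h4 := abs_nonneg (y - z)
    rw [abs_le] at h1 h2 h3 ⊢
    constructor <;> nlinarith

theorem exists_cmollifier_bounds (hδ : 0 < δ) : ∃ B, 1 ≤ B ∧ (∀ y, |mollifier δ y| ≤ B) ∧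
    (∀ z, ‖cmollifier δ z‖ ≤ B) ∧
    ∀ y z, ‖cmollifier δ y - cmollifier δ z‖ ≤ B * ‖y - z‖ := by
  obtain ⟨B, hB, h1, h2⟩ := exists_mollifier_bounds hδ
  refine ⟨2 * B, by linarith, fun y => (h1 y).trans (by linarith), fun z => ?_, fun y z => ?_⟩
  · refine (Complex.norm_le_abs_re_add_abs_im _).trans ?_
    have := h1 z.re
    have := h1 z.im
    simp only [cmollifier]
    linarith
  · refine (Complex.norm_le_abs_re_add_abs_im _).trans ?_
    have t1 := h2 y.re z.re
    have t2 := h2 y.im z.im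
    have s1 := Complex.abs_re_le_norm (y - z)
    have s2 := Complex.abs_im_le_norm (y - z)
    simp only [cmollifier, Complex.sub_re, Complex.sub_im] at s1 s2 ⊢
    nlinarith

end Mollifier

/-! ### Curves with bounded derivatives -/

section Curves

variable {F : Type*} [NormedAddCommGroup F] [NormedSpace ℝ F]

/-- `d 0, …, d k` are successive derivatives on `[0,T]`, bounded by `C`. -/
def Curve (k : ℕ) (T C : ℝ) (d : ℕ → ℝ → F) : Prop :=
  (∀ i < k, ∀ t ∈ Icc 0 T, HasDerivWithinAt (d i) (d (i + 1) t) (Icc 0 T) t) ∧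
    ∀ i ≤ k, ∀ t ∈ Icc 0 T, ‖d i t‖ ≤ C

/-- Forward time differences. -/
def fwd (a : ℝ) (d : ℕ → ℝ → F) : ℕ → ℝ → F := fun i t => d i (t + a) - d i t

variable {k : ℕ} {T C : ℝ} {d : ℕ → ℝ → F}

theorem Curve.norm_sub_le (H : Curve (k + 1) T C d) {i : ℕ} (hi : i ≤ k) {s t : ℝ}
    (hs : s ∈ Icc 0 T) (ht : t ∈ Icc 0 T) : ‖d i t - d i s‖ ≤ C * |t - s| :=
  (convex_Icc 0 T).norm_image_sub_le_of_norm_hasDerivWithin_le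
    (fun x hx => H.1 i (by omega) x hx) (fun x hx => H.2 (i + 1) (by omega) x hx) hs ht

/-- Each forward difference costs one derivative and gains a factor a, by the mean value inequality.
Iteration gives all mixed difference bounds. -/
theorem Curve.fwd (H : Curve (k + 1) T C d) {a : ℝ} (ha : 0 ≤ a) :
    Curve k (T - a) (C * a) (fwd a d) := by
  have hmem : ∀ t ∈ Icc 0 (T - a), t ∈ Icc 0 T ∧ t + a ∈ Icc 0 T := fun t ht =>
    ⟨⟨ht.1, by linarith [ht.2]⟩, by linarith [ht.1], by linarith [ht.2]⟩
  refine ⟨fun i hi t ht => ?_, fun i hi t ht => ?_⟩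
  · refine HasDerivWithinAt.sub ?_ ((H.1 i (by omega) t (hmem t ht).1).mono
      fun x hx => (hmem x hx).1)
    have := (H.1 i (by omega) (t + a) (hmem t ht).2).scomp t
      ((hasDerivAt_id t).add_const a).hasDerivWithinAt (s := Icc 0 (T - a))
      (fun x hx => (hmem x hx).2)
    rw [one_smul] at this
    exact this
  · have := H.norm_sub_le hi (hmem t ht).1 (hmem t ht).2
    rwa [add_sub_cancel_left, abs_of_nonneg ha] at this

/-- A function with vanishing initial derivatives is small. -/
theorem norm_le_of_iterated_deriv {a C : ℝ} (ha : 0 ≤ a) (hC : 0 ≤ C) :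
    ∀ (k : ℕ) (ψ : ℕ → ℝ → F),
      (∀ i < k, ∀ s ∈ Icc 0 a, HasDerivWithinAt (ψ i) (ψ (i + 1) s) (Icc 0 a) s) →
      (∀ i < k, ψ i 0 = 0) → (∀ s ∈ Icc 0 a, ‖ψ k s‖ ≤ C) →
      ∀ s ∈ Icc 0 a, ‖ψ 0 s‖ ≤ C * a ^ k := by
  intro k
  induction k with
  | zero => intro ψ _ _ h3 s hs; simpa using h3 s hs
  | succ k ih =>
    intro ψ h1 h2 h3 s hs
    have h4 := ih (fun i => ψ (i + 1)) (fun i hi => h1 (i + 1) (by omega))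
      (fun i hi => h2 (i + 1) (by omega)) h3
    have h5 := (convex_Icc 0 a).norm_image_sub_le_of_norm_hasDerivWithin_le
      (h1 0 (by omega)) h4 (left_mem_Icc.2 ha) hs
    rw [h2 0 (by omega), sub_zero, sub_zero, Real.norm_of_nonneg hs.1] at h5
    refine h5.trans ?_
    rw [pow_succ, ← mul_assoc]
    exact mul_le_mul_of_nonneg_left hs.2 (by positivity)

/-- The error of the trapezoidal rule. -/
theorem Curve.trapezoid (H : Curve 3 T C d) (hC : 0 ≤ C) {t a : ℝ} (ht : 0 ≤ t) (ha : 0 ≤ a)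
    (hta : t + a ≤ T) :
    ‖d 0 (t + a) - d 0 t - (a / 2) • (d 1 (t + a) + d 1 t)‖ ≤ C * a ^ 3 := by
  have hmem : ∀ s ∈ Icc 0 a, t + s ∈ Icc 0 T := fun s hs =>
    ⟨by linarith [hs.1], by linarith [hs.2]⟩
  have hd : ∀ i < 3, ∀ s ∈ Icc 0 a,
      HasDerivWithinAt (fun s => d i (t + s)) (d (i + 1) (t + s)) (Icc 0 a) s := by
    intro i hi s hs
    have := (H.1 i hi (t + s) (hmem s hs)).scomp s
      ((hasDerivAt_id s).const_add t).hasDerivWithinAt (s := Icc 0 a) (fun x hx => hmem x hx)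
    rw [one_smul] at this
    exact this
  have hl : ∀ s, HasDerivWithinAt (fun s : ℝ => s / 2) (1 / 2) (Icc 0 a) s := fun s =>
    ((hasDerivAt_id s).div_const 2).hasDerivWithinAt
  -- The quadrature defect as a function of the step length s, with its first two derivatives.
  -- Levels 0 and 1 vanish at s = 0, and level 2 carries a further factor s, which makes the order
  -- three.
  let ψ : ℕ → ℝ → F := fun i s => match i with
    | 0 => d 0 (t + s) - d 0 t - (s / 2) • (d 1 (t + s) + d 1 t)
    | 1 => (1 / 2 : ℝ) • (d 1 (t + s) - d 1 t) - (s / 2) • d 2 (t + s)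
    | _ => -(s / 2) • d 3 (t + s)
  have h1 : ∀ i < 2, ∀ s ∈ Icc 0 a, HasDerivWithinAt (ψ i) (ψ (i + 1) s) (Icc 0 a) s := by
    intro i hi s hs
    interval_cases i
    · refine (((hd 0 (by norm_num) s hs).sub_const (d 0 t)).sub
        ((hl s).smul ((hd 1 (by norm_num) s hs).add_const (d 1 t)))).congr_deriv ?_
      simp only [ψ]; module
    · refine ((((hd 1 (by norm_num) s hs).sub_const (d 1 t)).const_smul (1 / 2 : ℝ)).sub
        ((hl s).smul (hd 2 (by norm_num) s hs))).congr_deriv ?_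
      simp only [ψ]; module
  have h2 : ∀ i < 2, ψ i 0 = 0 := by
    intro i hi
    interval_cases i <;> simp [ψ]
  have h3 : ∀ s ∈ Icc 0 a, ‖ψ 2 s‖ ≤ C * a := by
    intro s hs
    simp only [ψ]
    rw [norm_smul, norm_neg, Real.norm_of_nonneg (by linarith [hs.1])]
    have := H.2 3 le_rfl (t + s) (hmem s hs)
    have := mul_le_mul (by linarith [hs.2, hs.1] : s / 2 ≤ a) this (norm_nonneg _) ha
    linarith
  have := norm_le_of_iterated_deriv ha (by positivity) 2 ψ h1 h2 h3 a ⟨ha, le_rfl⟩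
  simp only [ψ] at this
  refine this.trans (le_of_eq (by ring))

end Curves

/-! ### Derivatives on the space-time cylinder -/

section Derivatives

variable {P : Problem}

/-- The time derivative on `Q`. -/
noncomputable def Dt (P : Problem) (w : ℝ → ℝ → ℂ) : ℝ → ℝ → ℂ := fun t x =>
  fderivWithin ℝ (Function.uncurry w) P.Q (t, x) (1, 0)

/-- The space derivative on `Q`. -/
noncomputable def Dx (P : Problem) (w : ℝ → ℝ → ℂ) : ℝ → ℝ → ℂ := fun t x =>
  fderivWithin ℝ (Function.uncurry w) P.Q (t, x) (0, 1)

theorem uniqueDiffOn_Q (P : Problem) : UniqueDiffOn ℝ P.Q :=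
  (uniqueDiffOn_Icc P.T_pos).prod (uniqueDiffOn_Icc P.xa_lt_xb)

theorem isCompact_Q (P : Problem) : IsCompact P.Q := isCompact_Icc.prod isCompact_Icc

variable {w : ℝ → ℝ → ℂ} {k : ℕ}

theorem contDiffOn_Dt (hw : ContDiffOn ℝ (k + 1 : ℕ) (Function.uncurry w) P.Q) :
    ContDiffOn ℝ k (Function.uncurry (Dt P w)) P.Q :=
  (hw.fderivWithin (uniqueDiffOn_Q P) (m := k) (by push_cast; exact le_rfl)).clm_apply
    contDiffOn_const

theorem contDiffOn_Dx (hw : ContDiffOn ℝ (k + 1 : ℕ) (Function.uncurry w) P.Q) :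
    ContDiffOn ℝ k (Function.uncurry (Dx P w)) P.Q :=
  (hw.fderivWithin (uniqueDiffOn_Q P) (m := k) (by push_cast; exact le_rfl)).clm_apply
    contDiffOn_const

theorem contDiffOn_iterate_Dt : ∀ (i : ℕ) {k : ℕ} {w : ℝ → ℝ → ℂ},
    ContDiffOn ℝ (k + i : ℕ) (Function.uncurry w) P.Q →
    ContDiffOn ℝ k (Function.uncurry ((Dt P)^[i] w)) P.Q
  | 0, _, _, hw => hw
  | i + 1, k, w, hw => by
    rw [Function.iterate_succ_apply]
    exact contDiffOn_iterate_Dt i (contDiffOn_Dt (k := k + i) hw)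

theorem contDiffOn_iterate_Dx : ∀ (i : ℕ) {k : ℕ} {w : ℝ → ℝ → ℂ},
    ContDiffOn ℝ (k + i : ℕ) (Function.uncurry w) P.Q →
    ContDiffOn ℝ k (Function.uncurry ((Dx P)^[i] w)) P.Q
  | 0, _, _, hw => hw
  | i + 1, k, w, hw => by
    rw [Function.iterate_succ_apply]
    exact contDiffOn_iterate_Dx i (contDiffOn_Dx (k := k + i) hw)

theorem hasDerivWithinAt_Dt (hw : ContDiffOn ℝ (k + 1 : ℕ) (Function.uncurry w) P.Q) {t x : ℝ}
    (ht : t ∈ Icc 0 P.T) (hx : x ∈ P.I) :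
    HasDerivWithinAt (fun s => w s x) (Dt P w t x) (Icc 0 P.T) t := by
  have h1 : HasFDerivWithinAt (Function.uncurry w) (fderivWithin ℝ (Function.uncurry w) P.Q (t, x))
      P.Q (t, x) :=
    (hw.differentiableOn (by simp) (t, x) ⟨ht, hx⟩).hasFDerivWithinAt
  have h2 : HasDerivWithinAt (fun s : ℝ => (s, x)) ((1 : ℝ), (0 : ℝ)) (Icc 0 P.T) t :=
    ((hasDerivAt_id t).prodMk (hasDerivAt_const t x)).hasDerivWithinAt
  exact h1.comp_hasDerivWithinAt t h2 (fun s hs => mk_mem_prod (s := Icc 0 P.T) (t := Icc P.xa P.xb) hs hx)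

theorem hasDerivWithinAt_Dx (hw : ContDiffOn ℝ (k + 1 : ℕ) (Function.uncurry w) P.Q) {t x : ℝ}
    (ht : t ∈ Icc 0 P.T) (hx : x ∈ P.I) :
    HasDerivWithinAt (w t) (Dx P w t x) P.I x := by
  have h1 : HasFDerivWithinAt (Function.uncurry w) (fderivWithin ℝ (Function.uncurry w) P.Q (t, x))
      P.Q (t, x) :=
    (hw.differentiableOn (by simp) (t, x) ⟨ht, hx⟩).hasFDerivWithinAt
  have h2 : HasDerivWithinAt (fun y : ℝ => (t, y)) ((0 : ℝ), (1 : ℝ)) P.I x :=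
    ((hasDerivAt_const x t).prodMk (hasDerivAt_id x)).hasDerivWithinAt
  exact h1.comp_hasDerivWithinAt x h2 (fun s hs => mk_mem_prod (s := Icc 0 P.T) (t := Icc P.xa P.xb) ht hs)

theorem exists_bound_on_Q (hw : ContDiffOn ℝ k (Function.uncurry w) P.Q) :
    ∃ C, 0 ≤ C ∧ ∀ t ∈ Icc 0 P.T, ∀ x ∈ P.I, ‖w t x‖ ≤ C := by
  obtain ⟨C, hC⟩ := (isCompact_Q P).exists_bound_of_continuousOn hw.continuousOn
  exact ⟨max C 0, le_max_right _ _, fun t ht x hx =>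
    (hC (t, x) (mk_mem_prod ht hx)).trans (le_max_left _ _)⟩

theorem x_mem (P : Problem) (J : ℕ) (j : Fin (J + 2)) : P.x J j ∈ P.I := by
  have h0 := P.h_pos J
  have h1 := P.h_mul J
  have h2 : ((j : ℕ) : ℝ) ≤ J + 1 := by exact_mod_cast Nat.lt_succ_iff.1 j.2
  have h3 : (0 : ℝ) ≤ ((j : ℕ) : ℝ) := by positivity
  refine ⟨?_, ?_⟩
  · unfold Problem.x; nlinarith
  · unfold Problem.x
    have : ((j : ℕ) : ℝ) * P.h J ≤ (J + 1) * P.h J := mul_le_mul_of_nonneg_right h2 h0.le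
    unfold Problem.L at h1
    linarith

theorem x_zero (P : Problem) (J : ℕ) : P.x J 0 = P.xa := by simp [Problem.x]

theorem x_last (P : Problem) (J : ℕ) : P.x J (Fin.last (J + 1)) = P.xb := by
  have h1 := P.h_mul J
  unfold Problem.L at h1
  simp only [Problem.x, Fin.val_last]; push_cast; linarith

theorem x_succ (P : Problem) (J : ℕ) (j : Fin (J + 1)) :
    P.x J j.succ = P.x J j.castSucc + P.h J := by
  simp [Problem.x]; ring

/-- Difference quotients of samples are bounded by the space derivative, so the H¹ part costs
exactly one derivative. -/
theorem exists_gridNorm_sample_le (hw : ContDiffOn ℝ (k + 1 : ℕ) (Function.uncurry w) P.Q) :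
    ∃ C, 0 ≤ C ∧ ∀ J, ∀ t ∈ Icc 0 P.T, gridNorm (P.h J) (sample P J (w t)) ≤ C := by
  obtain ⟨A, hA0, hA⟩ := exists_bound_on_Q hw
  obtain ⟨B, hB0, hB⟩ := exists_bound_on_Q (contDiffOn_Dx hw)
  refine ⟨A + √P.L * B, by positivity, fun J t ht => add_le_add ?_ ?_⟩
  · exact (pi_norm_le_iff_of_nonneg hA0).2 fun j => hA t ht _ (x_mem P J j)
  · refine seminormH1_le_of_bound (P.h_pos J).le (P.h_mul J) hB0 fun j => ?_
    have := (convex_Icc P.xa P.xb).norm_image_sub_le_of_norm_hasDerivWithin_le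
      (fun x hx => hasDerivWithinAt_Dx hw ht hx) (fun x hx => hB t ht x hx)
      (x_mem P J j.castSucc) (x_mem P J j.succ)
    rw [x_succ, add_sub_cancel_left, Real.norm_of_nonneg (P.h_pos J).le, ← x_succ] at this
    rw [diffQuot, norm_div, Complex.norm_real, Real.norm_of_nonneg (P.h_pos J).le,
      div_le_iff₀ (P.h_pos J)]
    exact this

/-- The samples of the time derivatives of `w`, in the normed space of `gridNorm`. -/
noncomputable def sampleCurve (P : Problem) (J : ℕ) (w : ℝ → ℝ → ℂ) :
    ℕ → ℝ → WithLp 1 (Grid J × EuclideanSpace ℂ (Fin (J + 1))) :=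
  fun i t => gridEmb (P.h J) J (sample P J ((Dt P)^[i] w t))

theorem exists_curve_sample (k : ℕ) (hw : ContDiffOn ℝ (k + 1 : ℕ) (Function.uncurry w) P.Q) :
    ∃ C, 0 ≤ C ∧ ∀ J, Curve k P.T C (sampleCurve P J w) := by
  have hi : ∀ i ≤ k, ContDiffOn ℝ (k - i + 1 : ℕ) (Function.uncurry ((Dt P)^[i] w)) P.Q :=
    fun i hi => contDiffOn_iterate_Dt i (by rwa [show k - i + 1 + i = k + 1 by omega])
  have : ∀ i, ∃ C, 0 ≤ C ∧ (i ≤ k → ∀ J, ∀ t ∈ Icc 0 P.T,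
      gridNorm (P.h J) (sample P J ((Dt P)^[i] w t)) ≤ C) := by
    intro i
    by_cases h : i ≤ k
    · obtain ⟨C, h0, hC⟩ := exists_gridNorm_sample_le (hi i h)
      exact ⟨C, h0, fun _ => hC⟩
    · exact ⟨0, le_rfl, fun h' => absurd h' h⟩
  choose C hC0 hC using this
  refine ⟨∑ i ∈ Finset.range (k + 1), C i, Finset.sum_nonneg fun i _ => hC0 i, fun J =>
    ⟨fun i hik t ht => ?_, fun i hik t ht => ?_⟩⟩
  · let E : Grid J →L[ℝ] WithLp 1 (Grid J × EuclideanSpace ℂ (Fin (J + 1))) :=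
      LinearMap.toContinuousLinearMap ((gridEmb (P.h J) J).restrictScalars ℝ)
    refine E.hasFDerivAt.comp_hasDerivWithinAt t (hasDerivWithinAt_pi.2 fun j => ?_)
    have := hasDerivWithinAt_Dt (hi i hik.le) ht (x_mem P J j)
    rw [Function.iterate_succ_apply']
    exact this
  · rw [sampleCurve, norm_gridEmb (P.h_pos J).le]
    exact (hC i hik J t ht).trans (Finset.single_le_sum (fun i _ => hC0 i)
      (Finset.mem_range.2 (Nat.lt_succ_of_le hik)))

theorem exists_curve_apply (k : ℕ) (hw : ContDiffOn ℝ k (Function.uncurry w) P.Q) :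
    ∃ C, 0 ≤ C ∧ ∀ x ∈ P.I, Curve k P.T C (fun i t => (Dt P)^[i] w t x) := by
  have hi : ∀ i ≤ k, ContDiffOn ℝ (k - i : ℕ) (Function.uncurry ((Dt P)^[i] w)) P.Q :=
    fun i hi => contDiffOn_iterate_Dt i (by rwa [show k - i + i = k by omega])
  have : ∀ i, ∃ C, 0 ≤ C ∧ (i ≤ k → ∀ t ∈ Icc 0 P.T, ∀ x ∈ P.I, ‖(Dt P)^[i] w t x‖ ≤ C) := by
    intro i
    by_cases h : i ≤ k
    · obtain ⟨C, h0, hC⟩ := exists_bound_on_Q (hi i h)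
      exact ⟨C, h0, fun _ => hC⟩
    · exact ⟨0, le_rfl, fun h' => absurd h' h⟩
  choose C hC0 hC using this
  refine ⟨∑ i ∈ Finset.range (k + 1), C i, Finset.sum_nonneg fun i _ => hC0 i, fun x hx =>
    ⟨fun i hik t ht => ?_, fun i hik t ht => ?_⟩⟩
  · have := hasDerivWithinAt_Dt (k := k - i - 1)
      (by rw [show k - i - 1 + 1 = k - i by omega]; exact hi i hik.le) ht hx
    simp only [Function.iterate_succ_apply']
    exact this
  · exact (hC i hik t ht x hx).trans (Finset.single_le_sum (fun i _ => hC0 i)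
      (Finset.mem_range.2 (Nat.lt_succ_of_le hik)))

/-- Consistency of the second central difference quotient. -/
theorem norm_centralDiff_le {v : ℕ → ℝ → ℂ} {M : ℝ} (hM : 0 ≤ M)
    (hv : ∀ i < 4, ∀ x ∈ P.I, HasDerivWithinAt (v i) (v (i + 1) x) P.I x)
    (hv4 : ∀ x ∈ P.I, ‖v 4 x‖ ≤ M) {x h : ℝ} (hh : 0 ≤ h) (h1 : x - h ∈ P.I) (h2 : x + h ∈ P.I) :
    ‖v 0 (x + h) + v 0 (x - h) - 2 * v 0 x - (h : ℂ) ^ 2 * v 2 x‖ ≤ 2 * M * h ^ 4 := by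
  have hp : ∀ s ∈ Icc 0 h, x + s ∈ P.I := fun s hs =>
    ⟨by linarith [h1.1, hs.1], by linarith [h2.2, hs.2]⟩
  have hm : ∀ s ∈ Icc 0 h, x - s ∈ P.I := fun s hs =>
    ⟨by linarith [h1.1, hs.2], by linarith [h2.2, hs.1]⟩
  have dp : ∀ i < 4, ∀ s ∈ Icc 0 h,
      HasDerivWithinAt (fun s => v i (x + s)) (v (i + 1) (x + s)) (Icc 0 h) s := by
    intro i hi s hs
    have := (hv i hi (x + s) (hp s hs)).scomp s
      ((hasDerivAt_id s).const_add x).hasDerivWithinAt (s := Icc 0 h) hp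
    rw [one_smul] at this
    exact this
  have dm : ∀ i < 4, ∀ s ∈ Icc 0 h,
      HasDerivWithinAt (fun s => v i (x - s)) (-v (i + 1) (x - s)) (Icc 0 h) s := by
    intro i hi s hs
    have := (hv i hi (x - s) (hm s hs)).scomp s
      ((hasDerivAt_id s).const_sub x).hasDerivWithinAt (s := Icc 0 h) hm
    rw [neg_smul, one_smul] at this
    exact this
  have ds : ∀ s : ℝ, HasDerivWithinAt (fun s : ℝ => (s : ℂ)) 1 (Icc 0 h) s := fun s =>
    Complex.ofRealCLM.hasDerivAt.hasDerivWithinAt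
  -- Successive derivatives in the mesh width of the defect; levels 0 to 3 vanish at 0, and the last
  -- one is bounded by 2M.
  let ψ : ℕ → ℝ → ℂ := fun i s => match i with
    | 0 => v 0 (x + s) + v 0 (x - s) - 2 * v 0 x - (s : ℂ) ^ 2 * v 2 x
    | 1 => v 1 (x + s) - v 1 (x - s) - 2 * (s : ℂ) * v 2 x
    | 2 => v 2 (x + s) + v 2 (x - s) - 2 * v 2 x
    | 3 => v 3 (x + s) - v 3 (x - s)
    | _ => v 4 (x + s) + v 4 (x - s)
  have key := norm_le_of_iterated_deriv hh (C := 2 * M) (by positivity) 4 ψ ?_ ?_ ?_ h ⟨hh, le_rfl⟩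
  · exact key
  · intro i hi s hs
    interval_cases i
    · refine ((((dp 0 (by norm_num) s hs).add (dm 0 (by norm_num) s hs)).sub_const _).sub
        (((ds s).pow 2).mul_const _)).congr_deriv ?_
      simp only [ψ]; push_cast; ring
    · refine (((dp 1 (by norm_num) s hs).sub (dm 1 (by norm_num) s hs)).sub
        (((ds s).const_mul 2).mul_const _)).congr_deriv ?_
      simp only [ψ]; push_cast; ring
    · refine (((dp 2 (by norm_num) s hs).add (dm 2 (by norm_num) s hs)).sub_const _).congr_deriv ?_
      simp only [ψ]; ring
    · refine ((dp 3 (by norm_num) s hs).sub (dm 3 (by norm_num) s hs)).congr_deriv ?_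
      simp only [ψ]; ring
  · intro i hi
    interval_cases i <;> simp [ψ]
    all_goals ring
  · intro s hs
    simp only [ψ]
    refine (norm_add_le _ _).trans ?_
    linarith [hv4 _ (hp s hs), hv4 _ (hm s hs)]

/-- Consistency bounds the Laplacian of R pointwise, and the elliptic estimate does the rest. The
x-derivatives are passed as a sequence v, so that time differences of u are covered as well, by
linearity. -/
theorem seminormH1_le_of_consistency {v : ℕ → ℝ → ℂ} {M : ℝ} (hM : 0 ≤ M)
    (hv : ∀ i < 4, ∀ x ∈ P.I, HasDerivWithinAt (v i) (v (i + 1) x) P.I x)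
    (hv4 : ∀ x ∈ P.I, ‖v 4 x‖ ≤ M) {J : ℕ} {R : Grid J} (hR : VanishesAtEnds R)
    (hlap : laplacian (P.h J) R
      = sampleInterior P J (v 2) - laplacian (P.h J) (sample P J (v 0))) :
    seminormH1 (P.h J) R ≤ P.L * √P.L * (2 * M * P.h J ^ 2) := by
  have hh := P.h_pos J
  refine seminormH1_le_laplacian hh (P.h_mul J) (by positivity) hR fun i => ?_
  have hp : P.x J i.succ.succ = P.x J i.succ.castSucc + P.h J := x_succ P J i.succ
  have hm : P.x J i.castSucc.castSucc = P.x J i.succ.castSucc - P.h J := by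
    rw [eq_sub_iff_add_eq, ← x_succ]; rfl
  have key := norm_centralDiff_le hM hv hv4 hh.le (x := P.x J i.succ.castSucc)
    (by rw [← hm]; exact x_mem P J _) (by rw [← hp]; exact x_mem P J _)
  rw [← hm, ← hp] at key
  have hc : (P.h J : ℂ) ≠ 0 := by exact_mod_cast hh.ne'
  have e : laplacian (P.h J) R i.succ.castSucc
      = -(v 0 (P.x J i.succ.succ) + v 0 (P.x J i.castSucc.castSucc)
        - 2 * v 0 (P.x J i.succ.castSucc) - (P.h J : ℂ) ^ 2 * v 2 (P.x J i.succ.castSucc))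
        / (P.h J : ℂ) ^ 2 := by
    rw [hlap, Pi.sub_apply, sampleInterior, extendZero_interior, laplacian, extendZero_interior]
    simp only [sample]
    field_simp
    ring
  rw [e, norm_div, norm_neg, norm_pow, Complex.norm_real, Real.norm_of_nonneg hh.le,
    div_le_iff₀ (by positivity)]
  exact key.trans (le_of_eq (by ring))

end Derivatives

/-! ### Consistency -/

section Consistency

variable {P : Problem} {u : ℝ → ℝ → ℂ}

/-- The function `g(|u|²)`. -/
noncomputable def gOf (P : Problem) (u : ℝ → ℝ → ℂ) : ℝ → ℝ → ℂ := fun t x =>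
  ((P.g (‖u t x‖ ^ 2) : ℝ) : ℂ)

theorem contDiffOn_gOf (hu : ContDiffOn ℝ 6 (Function.uncurry u) P.Q)
    (hg : ContDiffOn ℝ 5 P.g (Ici 0)) : ContDiffOn ℝ 5 (Function.uncurry (gOf P u)) P.Q := by
  have h1 : ContDiffOn ℝ 5 (fun q => ‖Function.uncurry u q‖ ^ 2) P.Q :=
    (hu.of_le (by norm_num)).norm_sq ℝ
  have h2 := hg.comp h1 (fun q _ => mem_Ici.2 (sq_nonneg _))
  exact Complex.ofRealCLM.contDiff.comp_contDiffOn h2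

theorem sampleInterior_sub (P : Problem) (J : ℕ) (v w : ℝ → ℂ) :
    sampleInterior P J (fun x => v x - w x) = sampleInterior P J v - sampleInterior P J w :=
  grid_ext (by simp [sampleInterior]) (fun i => by simp [sampleInterior])
    (by simp [sampleInterior])

theorem sample_sub (P : Problem) (J : ℕ) (v w : ℝ → ℂ) :
    sample P J (fun x => v x - w x) = sample P J v - sample P J w := rfl

theorem exists_projection_error (P : Problem) (u : ℝ → ℝ → ℂ) :
    ∃ ρ : ∀ J : ℕ, ℝ → Grid J, ∀ J t, VanishesAtEnds (ρ J t) ∧ laplacian (P.h J) (ρ J t)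
      = sampleInterior P J ((Dx P)^[2] u t) - laplacian (P.h J) (sample P J (u t)) := by
  have : ∀ (J : ℕ) (t : ℝ), ∃ v : Grid J, VanishesAtEnds v ∧ laplacian (P.h J) v
      = sampleInterior P J ((Dx P)^[2] u t) - laplacian (P.h J) (sample P J (u t)) := fun J t =>
    exists_laplacian_eq (P.h_pos J)
      ((vanishesAtEnds_extendZero _).sub (vanishesAtEnds_laplacian _))
  choose ρ hρ using this
  exact ⟨ρ, hρ⟩

/-- The error of the elliptic projection and of its time differences. -/
theorem projection_error_le (hu : ContDiffOn ℝ 6 (Function.uncurry u) P.Q)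
    {ρ : ∀ J : ℕ, ℝ → Grid J} (hρ : ∀ J t, VanishesAtEnds (ρ J t) ∧ laplacian (P.h J) (ρ J t)
      = sampleInterior P J ((Dx P)^[2] u t) - laplacian (P.h J) (sample P J (u t))) :
    ∃ K, 0 ≤ K ∧ ∀ J, (∀ t ∈ Icc 0 P.T, gridNorm (P.h J) (ρ J t) ≤ K * P.h J ^ 2) ∧
      (∀ t a, 0 ≤ t → 0 ≤ a → t + a ≤ P.T →
        gridNorm (P.h J) (ρ J (t + a) - ρ J t) ≤ K * (a * P.h J ^ 2)) ∧
      ∀ t a, 0 ≤ t → 0 ≤ a → t + a + a ≤ P.T →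
        gridNorm (P.h J) (ρ J (t + a + a) - ρ J (t + a) - (ρ J (t + a) - ρ J t))
          ≤ K * (a ^ 2 * P.h J ^ 2) := by
  -- Four space derivatives for consistency and two time derivatives for two time differences: this
  -- uses all of u ∈ C⁶.
  obtain ⟨C, hC0, hC⟩ := exists_curve_apply (P := P) (w := (Dx P)^[4] u) 2
    (contDiffOn_iterate_Dx 4 (by exact_mod_cast hu))
  have hv : ∀ t ∈ Icc 0 P.T, ∀ i < 4, ∀ x ∈ P.I,
      HasDerivWithinAt ((Dx P)^[i] u t) ((Dx P)^[i + 1] u t x) P.I x := by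
    intro t ht i hi x hx
    rw [Function.iterate_succ_apply']
    refine hasDerivWithinAt_Dx (k := 5 - i) (contDiffOn_iterate_Dx i ?_) ht hx
    rw [show 5 - i + 1 + i = 6 by omega]; exact_mod_cast hu
  have hL := P.L_pos
  have final : ∀ (J : ℕ) (R : Grid J) (M : ℝ), VanishesAtEnds R →
      seminormH1 (P.h J) R ≤ P.L * √P.L * (2 * (C * M) * P.h J ^ 2) →
      gridNorm (P.h J) R ≤ (√P.L + 1) * (P.L * √P.L * (2 * C)) * (M * P.h J ^ 2) := by
    intro J R M hR h
    refine (gridNorm_le_of_vanishesAtEnds (P.h_pos J) (P.h_mul J) hR).trans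
      ((mul_le_mul_of_nonneg_left h (by positivity)).trans (le_of_eq (by ring)))
  refine ⟨(√P.L + 1) * (P.L * √P.L * (2 * C)), by positivity, fun J => ⟨fun t ht => ?_,
    fun t a ht ha hta => ?_, fun t a ht ha hta => ?_⟩⟩
  · have := final J (ρ J t) 1 (hρ J t).1 (seminormH1_le_of_consistency (v := fun i => (Dx P)^[i] u t)
      (by positivity) (hv t ht) (fun x hx => by
        simpa using (hC x hx).2 0 (by norm_num) t ht) (hρ J t).1 (hρ J t).2)
    rwa [one_mul] at this
  · have h0 : t ∈ Icc 0 P.T := ⟨ht, by linarith⟩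
    have h1 : t + a ∈ Icc 0 P.T := ⟨by linarith, hta⟩
    refine final J _ a ((hρ J _).1.sub (hρ J _).1) (seminormH1_le_of_consistency
      (v := fun i x => (Dx P)^[i] u (t + a) x - (Dx P)^[i] u t x) (by positivity)
      (fun i hi x hx => (hv _ h1 i hi x hx).sub (hv _ h0 i hi x hx)) (fun x hx => ?_)
      ((hρ J _).1.sub (hρ J _).1) ?_)
    · exact ((hC x hx).fwd (k := 1) ha).2 0 (by norm_num) t ⟨ht, by linarith⟩
    · rw [laplacian_sub, (hρ J _).2, (hρ J _).2, sampleInterior_sub, sample_sub, laplacian_sub]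
      simp only [Function.iterate_zero, id_eq]
      abel
  · have h0 : t ∈ Icc 0 P.T := ⟨ht, by linarith⟩
    have h1 : t + a ∈ Icc 0 P.T := ⟨by linarith, by linarith⟩
    have h2 : t + a + a ∈ Icc 0 P.T := ⟨by linarith, hta⟩
    have hmem := ((hρ J (t + a + a)).1.sub (hρ J (t + a)).1).sub
      ((hρ J (t + a)).1.sub (hρ J t).1)
    refine final J _ (a ^ 2) hmem (seminormH1_le_of_consistency
      (v := fun i x => ((Dx P)^[i] u (t + a + a) x - (Dx P)^[i] u (t + a) x)
        - ((Dx P)^[i] u (t + a) x - (Dx P)^[i] u t x)) (by positivity)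
      (fun i hi x hx => ((hv _ h2 i hi x hx).sub (hv _ h1 i hi x hx)).sub
        ((hv _ h1 i hi x hx).sub (hv _ h0 i hi x hx))) (fun x hx => ?_) hmem ?_)
    · have := (((hC x hx).fwd (k := 1) ha).fwd (k := 0) ha).2 0 le_rfl t ⟨ht, by linarith⟩
      rw [sq, ← mul_assoc]
      exact this
    · rw [laplacian_sub, laplacian_sub, laplacian_sub, (hρ J _).2, (hρ J _).2, (hρ J _).2,
        sampleInterior_sub, sampleInterior_sub, sampleInterior_sub, sample_sub, sample_sub,
        sample_sub, laplacian_sub, laplacian_sub, laplacian_sub]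
      simp only [Function.iterate_zero, id_eq]
      abel

/-- Bounds of the exact solution, of its time differences and of the errors of the trapezoidal rule
and the elliptic projection, uniform in the mesh. -/
structure ConsistencyBounds (P : Problem) (u : ℝ → ℝ → ℂ) (ρ : ∀ J : ℕ, ℝ → Grid J) (K : ℝ)
    (J : ℕ) : Prop where
  norm_le : ∀ v : Grid J, VanishesAtEnds v → gridNorm (P.h J) v ≤ K * seminormH1 (P.h J) v
  u_le : ∀ t ∈ Icc 0 P.T, gridNorm (P.h J) (sample P J (u t)) ≤ K
  u_diff : ∀ t a, 0 ≤ t → 0 ≤ a → t + a ≤ P.T →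
    gridNorm (P.h J) (sample P J (u (t + a)) - sample P J (u t)) ≤ K * a
  u_diff₂ : ∀ t a b, 0 ≤ t → 0 ≤ a → 0 ≤ b → t + a + b ≤ P.T →
    gridNorm (P.h J) (sample P J (u (t + a + b)) - sample P J (u (t + a))
      - (sample P J (u (t + b)) - sample P J (u t))) ≤ K * b * a
  g_le : ∀ t ∈ Icc 0 P.T, gridNorm (P.h J) (sample P J (gOf P u t)) ≤ K
  g_diff : ∀ t a, 0 ≤ t → 0 ≤ a → t + a ≤ P.T →
    gridNorm (P.h J) (sample P J (gOf P u (t + a)) - sample P J (gOf P u t)) ≤ K * a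
  g_diff₂ : ∀ t a b, 0 ≤ t → 0 ≤ a → 0 ≤ b → t + a + b ≤ P.T →
    gridNorm (P.h J) (sample P J (gOf P u (t + a + b)) - sample P J (gOf P u (t + a))
      - (sample P J (gOf P u (t + b)) - sample P J (gOf P u t))) ≤ K * b * a
  g_diff₃ : ∀ t a b c, 0 ≤ t → 0 ≤ a → 0 ≤ b → 0 ≤ c → t + a + b + c ≤ P.T →
    gridNorm (P.h J) (sample P J (gOf P u (t + a + b + c)) - sample P J (gOf P u (t + a + b))
      - (sample P J (gOf P u (t + a + c)) - sample P J (gOf P u (t + a)))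
      - (sample P J (gOf P u (t + b + c)) - sample P J (gOf P u (t + b))
        - (sample P J (gOf P u (t + c)) - sample P J (gOf P u t)))) ≤ K * c * b * a
  trap : ∀ t a, 0 ≤ t → 0 ≤ a → t + a ≤ P.T →
    gridNorm (P.h J) (sample P J (u (t + a)) - sample P J (u t)
      - ((a / 2 : ℝ) : ℂ) • (sample P J (Dt P u (t + a)) + sample P J (Dt P u t))) ≤ K * a ^ 3
  trap_diff : ∀ t a b, 0 ≤ t → 0 ≤ a → 0 ≤ b → t + a + b ≤ P.T →
    gridNorm (P.h J) ((sample P J (u (t + a + b)) - sample P J (u (t + b))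
      - ((a / 2 : ℝ) : ℂ) • (sample P J (Dt P u (t + a + b)) + sample P J (Dt P u (t + b))))
      - (sample P J (u (t + a)) - sample P J (u t)
      - ((a / 2 : ℝ) : ℂ) • (sample P J (Dt P u (t + a)) + sample P J (Dt P u t))))
      ≤ K * b * a ^ 3
  ρ_mem : ∀ t, VanishesAtEnds (ρ J t)
  ρ_lap : ∀ t, laplacian (P.h J) (ρ J t)
      = sampleInterior P J ((Dx P)^[2] u t) - laplacian (P.h J) (sample P J (u t))
  ρ_le : ∀ t ∈ Icc 0 P.T, gridNorm (P.h J) (ρ J t) ≤ K * P.h J ^ 2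
  ρ_diff : ∀ t a, 0 ≤ t → 0 ≤ a → t + a ≤ P.T →
        gridNorm (P.h J) (ρ J (t + a) - ρ J t) ≤ K * (a * P.h J ^ 2)
  ρ_diff₂ : ∀ t a, 0 ≤ t → 0 ≤ a → t + a + a ≤ P.T →
        gridNorm (P.h J) (ρ J (t + a + a) - ρ J (t + a) - (ρ J (t + a) - ρ J t))
          ≤ K * (a ^ 2 * P.h J ^ 2)

theorem Curve.mono {F : Type*} [NormedAddCommGroup F] [NormedSpace ℝ F] {k : ℕ} {T C C' : ℝ}
    {d : ℕ → ℝ → F} (H : Curve k T C d) (h : C ≤ C') : Curve k T C' d :=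
  ⟨H.1, fun i hi t ht => (H.2 i hi t ht).trans h⟩

theorem exists_consistencyBounds (hu : ContDiffOn ℝ 6 (Function.uncurry u) P.Q)
    (hg : ContDiffOn ℝ 5 P.g (Ici 0)) :
    ∃ (ρ : ∀ J : ℕ, ℝ → Grid J) (K : ℝ), 1 ≤ K ∧ ∀ J, ConsistencyBounds P u ρ K J := by
  obtain ⟨ρ, hρ⟩ := exists_projection_error P u
  obtain ⟨A, hA0, hA⟩ := projection_error_le hu hρ
  -- Four time derivatives: three for the trapezoidal rule, one more for its time difference. The H¹
  -- seminorm takes an additional space derivative.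
  obtain ⟨B, hB0, hB⟩ := exists_curve_sample (P := P) (w := u) 4
    (by exact_mod_cast hu.of_le (by norm_num))
  -- Three time differences of g(|u|²): two form the second difference in the relaxation defect, the
  -- third its time increment.
  obtain ⟨D, hD0, hD⟩ := exists_curve_sample (P := P) (w := gOf P u) 3
    (by exact_mod_cast (contDiffOn_gOf hu hg).of_le (by norm_num))
  set K := 1 + √P.L + A + B + D with hK
  have hsq := Real.sqrt_nonneg P.L
  have hK0 : 0 ≤ K := by positivity
  refine ⟨ρ, K, by linarith, fun J => ?_⟩
  have hh := P.h_pos J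
  have cu : Curve 4 P.T K (sampleCurve P J u) := (hB J).mono (by linarith)
  have cg : Curve 3 P.T K (sampleCurve P J (gOf P u)) := (hD J).mono (by linarith)
  have hAK : A ≤ K := by linarith
  have e0 : ∀ (w : ℝ → ℝ → ℂ) t, sampleCurve P J w 0 t = gridEmb (P.h J) J (sample P J (w t)) :=
    fun _ _ => rfl
  have e1 : ∀ (w : ℝ → ℝ → ℂ) t,
      sampleCurve P J w 1 t = gridEmb (P.h J) J (sample P J (Dt P w t)) := fun _ _ => rfl
  have es : ∀ (c : ℝ) (v : Grid J), c • gridEmb (P.h J) J v = gridEmb (P.h J) J ((c : ℂ) • v) :=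
    fun c v => by rw [map_smul]; rfl
  constructor
  · intro v hv
    exact (gridNorm_le_of_vanishesAtEnds hh (P.h_mul J) hv).trans
      (mul_le_mul_of_nonneg_right (by linarith) (seminormH1_nonneg _))
  · intro t ht
    have := cu.2 0 (by norm_num) t ht
    rwa [e0, norm_gridEmb hh.le] at this
  · intro t a ht ha hta
    have := (cu.fwd ha).2 0 (by norm_num) t ⟨ht, by linarith⟩
    rwa [fwd, e0, e0, ← map_sub, norm_gridEmb hh.le] at this
  · intro t a b ht ha hb hta
    have := ((cu.fwd hb).fwd ha).2 0 (by norm_num) t ⟨ht, by linarith⟩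
    simp only [fwd, e0, ← map_sub] at this
    rwa [norm_gridEmb hh.le] at this
  · intro t ht
    have := cg.2 0 (by norm_num) t ht
    rwa [e0, norm_gridEmb hh.le] at this
  · intro t a ht ha hta
    have := (cg.fwd ha).2 0 (by norm_num) t ⟨ht, by linarith⟩
    rwa [fwd, e0, e0, ← map_sub, norm_gridEmb hh.le] at this
  · intro t a b ht ha hb hta
    have := ((cg.fwd hb).fwd ha).2 0 (by norm_num) t ⟨ht, by linarith⟩
    simp only [fwd, e0, ← map_sub] at this
    rwa [norm_gridEmb hh.le] at this
  · intro t a b c ht ha hb hc hta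
    have := (((cg.fwd hc).fwd hb).fwd ha).2 0 (by norm_num) t ⟨ht, by linarith⟩
    simp only [fwd, e0, ← map_sub] at this
    rwa [norm_gridEmb hh.le] at this
  · intro t a ht ha hta
    have c3 : Curve 3 P.T K (sampleCurve P J u) :=
      ⟨fun i hi => cu.1 i (by omega), fun i hi => cu.2 i (by omega)⟩
    have := c3.trapezoid hK0 ht ha hta
    simp only [e0, e1, ← map_sub, ← map_add, es] at this
    rwa [norm_gridEmb hh.le] at this
  · intro t a b ht ha hb hta
    have := (cu.fwd hb).trapezoid (by positivity) ht ha (by linarith)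
    simp only [fwd, e0, e1, ← map_sub, ← map_add, es] at this
    rw [norm_gridEmb hh.le] at this
    refine le_trans (le_of_eq ?_) this
    congr 1
    module
  · exact fun t => (hρ J t).1
  · exact fun t => (hρ J t).2
  · intro t ht
    exact ((hA J).1 t ht).trans (mul_le_mul_of_nonneg_right hAK (by positivity))
  · intro t a ht ha hta
    exact ((hA J).2.1 t a ht ha hta).trans (mul_le_mul_of_nonneg_right hAK (by positivity))
  · intro t a ht ha hta
    exact ((hA J).2.2 t a ht ha hta).trans (mul_le_mul_of_nonneg_right hAK (by positivity))

theorem iteratedDerivWithin_two_eq (hu : ContDiffOn ℝ 6 (Function.uncurry u) P.Q) {t x : ℝ}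
    (ht : t ∈ Icc 0 P.T) (hx : x ∈ P.I) :
    iteratedDerivWithin 2 (u t) P.I x = (Dx P)^[2] u t x := by
  have hI : UniqueDiffOn ℝ P.I := uniqueDiffOn_Icc P.xa_lt_xb
  have h1 : ∀ y ∈ P.I, derivWithin (u t) P.I y = Dx P u t y := fun y hy =>
    (hasDerivWithinAt_Dx (k := 5) (by exact_mod_cast hu) ht hy).derivWithin (hI y hy)
  have h2 : HasDerivWithinAt (Dx P u t) ((Dx P)^[2] u t x) P.I x :=
    hasDerivWithinAt_Dx (k := 4) (contDiffOn_Dx (k := 5) (by exact_mod_cast hu)) ht hx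
  rw [iteratedDerivWithin_succ, iteratedDerivWithin_one]
  rw [← h2.derivWithin (hI x hx)]
  refine derivWithin_congr (fun y hy => ?_) ?_
  · exact h1 y hy
  · exact h1 x hx

/-- Eliminating f by the differential equation lets the defects be estimated through u and g alone,
so that no smoothness of f has to be assumed. -/
theorem f_eq (hsol : IsSolution P u) (hu : ContDiffOn ℝ 6 (Function.uncurry u) P.Q) {t x : ℝ}
    (ht : t ∈ Icc 0 P.T) (hx : x ∈ P.I) :
    P.f t x = Dt P u t x - Complex.I * (Dx P)^[2] u t x - Complex.I * (gOf P u t x * u t x) := by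
  have h1 := hsol.pde t ht x hx
  have h2 := hasDerivWithinAt_Dt (k := 5) (by exact_mod_cast hu) ht hx
  have := (uniqueDiffOn_Icc P.T_pos t ht).eq_deriv _ h2 h1
  rw [this, iteratedDerivWithin_two_eq hu ht hx, gOf]
  ring

theorem vanishesAtEnds_sample (hsol : IsSolution P u) (J : ℕ) {t : ℝ} (ht : t ∈ Icc 0 P.T) :
    VanishesAtEnds (sample P J (u t)) := by
  refine ⟨?_, ?_⟩
  · rw [sample, x_zero]; exact (hsol.boundary t ht).1
  · rw [sample, x_last]; exact (hsol.boundary t ht).2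

/-- The boundary values vanish at all times, hence so does their time derivative. This matches the
sampling of f, which is extended by zero at the end nodes. -/
theorem vanishesAtEnds_sample_Dt (hsol : IsSolution P u)
    (hu : ContDiffOn ℝ 6 (Function.uncurry u) P.Q) (J : ℕ) {t : ℝ} (ht : t ∈ Icc 0 P.T) :
    VanishesAtEnds (sample P J (Dt P u t)) := by
  have key : ∀ x ∈ P.I, (∀ s ∈ Icc 0 P.T, u s x = 0) → Dt P u t x = 0 := by
    intro x hx h0
    have h1 := hasDerivWithinAt_Dt (k := 5) (by exact_mod_cast hu) ht hx
    exact (uniqueDiffOn_Icc P.T_pos t ht).eq_deriv _ h1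
      ((hasDerivWithinAt_const t _ 0).congr h0 (h0 t ht))
  refine ⟨?_, ?_⟩
  · rw [sample, x_zero]
    exact key _ (left_mem_Icc.2 P.xa_lt_xb.le) fun s hs => (hsol.boundary s hs).1
  · rw [sample, x_last]
    exact key _ (right_mem_Icc.2 P.xa_lt_xb.le) fun s hs => (hsol.boundary s hs).2

theorem sampleInterior_f (hsol : IsSolution P u) (hu : ContDiffOn ℝ 6 (Function.uncurry u) P.Q)
    (J : ℕ) {t : ℝ} (ht : t ∈ Icc 0 P.T) :
    sampleInterior P J (P.f t) = sample P J (Dt P u t)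
      - Complex.I • sampleInterior P J ((Dx P)^[2] u t)
      - Complex.I • (sample P J (gOf P u t) * sample P J (u t)) := by
  have h1 := vanishesAtEnds_sample hsol J ht
  have h2 := vanishesAtEnds_sample_Dt hsol hu J ht
  refine grid_ext ?_ (fun i => ?_) ?_
  · simp [sampleInterior, h1.1, h2.1]
  · simp only [sampleInterior, Pi.sub_apply, Pi.smul_apply, Pi.mul_apply, smul_eq_mul,
      extendZero_interior]
    exact f_eq hsol hu ht (x_mem P J _)
  · simp [sampleInterior, h1.2, h2.2]

/-- The equation for the error of one step. -/
theorem Step.error_eq (hsol : IsSolution P u) (hu : ContDiffOn ℝ 6 (Function.uncurry u) P.Q)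
    {J : ℕ} {ρ : ∀ J : ℕ, ℝ → Grid J} {K : ℝ} (B : ConsistencyBounds P u ρ K J) {s k : ℝ}
    (hs : s ∈ Icc 0 P.T) (hsk : s + k ∈ Icc 0 P.T) {V₀ V₁ M : Grid J} (H : Step P s k V₀ V₁ M) :
    (sample P J (u (s + k)) + ρ J (s + k) - V₁) - (sample P J (u s) + ρ J s - V₀)
      = (Complex.I * k) • laplacian (P.h J)
          (avg (sample P J (u (s + k)) + ρ J (s + k) - V₁) (sample P J (u s) + ρ J s - V₀))
        + (Complex.I * k) • (avg (sample P J (gOf P u (s + k)) * sample P J (u (s + k)))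
            (sample P J (gOf P u s) * sample P J (u s)) - M)
        + ((ρ J (s + k) - ρ J s) + (sample P J (u (s + k)) - sample P J (u s)
          - ((k / 2 : ℝ) : ℂ) • (sample P J (Dt P u (s + k)) + sample P J (Dt P u s)))) := by
  have hf : sampleInterior P J (fun x => (P.f (s + k) x + P.f s x) / 2)
      = (1 / 2 : ℂ) • (sampleInterior P J (P.f (s + k)) + sampleInterior P J (P.f s)) :=
    grid_ext (by simp [sampleInterior]) (fun i => by simp [sampleInterior]; ring)
      (by simp [sampleInterior])
  unfold Step at H
  rw [hf, sampleInterior_f hsol hu J hs, sampleInterior_f hsol hu J hsk] at H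
  have e1 : avg (sample P J (u (s + k)) + ρ J (s + k) - V₁) (sample P J (u s) + ρ J s - V₀)
      = (1 / 2 : ℂ) • ((sample P J (u (s + k)) + ρ J (s + k)) + (sample P J (u s) + ρ J s))
        - avg V₁ V₀ := by
    rw [avg_eq, avg_eq]; module
  rw [e1, laplacian_sub, laplacian_smul, laplacian_add, laplacian_add, laplacian_add, B.ρ_lap,
    B.ρ_lap, avg_eq (sample P J (gOf P u (s + k)) * sample P J (u (s + k)))]
  ext j
  have hj := congrFun H j
  simp only [Pi.add_apply, Pi.sub_apply, Pi.smul_apply, Pi.mul_apply, smul_eq_mul] at hj ⊢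
  push_cast
  linear_combination -hj

end Consistency

/-! ### The errors of the scheme form an error system -/

section Errors

variable {P : Problem} {u : ℝ → ℝ → ℂ} {ρ : ∀ J : ℕ, ℝ → Grid J} {K : ℝ} {J N : ℕ}

theorem t_succ (P : Problem) (N n : ℕ) : P.t N (n + 1) = P.t N n + P.τ N := by
  simp [Problem.t]; ring

theorem tmid_succ (P : Problem) (N n : ℕ) : P.tmid N (n + 1) = P.tmid N n + P.τ N := by
  simp [Problem.tmid, t_succ]; ring

theorem t_nonneg (P : Problem) (hN : 1 ≤ N) (n : ℕ) : 0 ≤ P.t N n :=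
  mul_nonneg (Nat.cast_nonneg _) (P.τ_pos hN).le

theorem t_le (P : Problem) (hN : 1 ≤ N) {n : ℕ} (hn : n ≤ N) : P.t N n ≤ P.T := by
  rw [← P.mul_τ hN]
  exact mul_le_mul_of_nonneg_right (by exact_mod_cast hn) (P.τ_pos hN).le

theorem t_mem (P : Problem) (hN : 1 ≤ N) {n : ℕ} (hn : n ≤ N) : P.t N n ∈ Icc 0 P.T :=
  ⟨t_nonneg P hN n, t_le P hN hn⟩

theorem tmid_mem (P : Problem) (hN : 1 ≤ N) {n : ℕ} (hn : n < N) : P.tmid N n ∈ Icc 0 P.T := by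
  have h1 := t_nonneg P hN n
  have h2 := t_le P hN hn
  have h3 := P.τ_pos hN
  rw [t_succ] at h2
  exact ⟨by unfold Problem.tmid; linarith, by unfold Problem.tmid; linarith⟩

/-- Both u(0) + ρ(0) and the starting value vanish at the ends and have the same discrete Laplacian.
Thus θ starts at exactly 0. -/
theorem projection_eq (B : ConsistencyBounds P u ρ K J) (hsol : IsSolution P u)
    (hu : ContDiffOn ℝ 6 (Function.uncurry u) P.Q) {W₀ : Grid J}
    (h0 : IsEllipticProjection P P.u₀ W₀) : sample P J (u 0) + ρ J 0 - W₀ = 0 := by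
  have h00 : (0 : ℝ) ∈ Icc 0 P.T := ⟨le_rfl, P.T_pos.le⟩
  refine sub_eq_zero.2 (eq_of_laplacian_eq (P.h_pos J)
    ((vanishesAtEnds_sample hsol J h00).add (B.ρ_mem 0)) h0.1 ?_)
  rw [laplacian_add, B.ρ_lap, h0.2, add_sub_cancel]
  refine grid_ext (by simp [sampleInterior]) (fun i => ?_) (by simp [sampleInterior])
  rw [sampleInterior, sampleInterior, extendZero_interior, extendZero_interior,
    ← iteratedDerivWithin_two_eq hu h00 (x_mem P J _)]
  exact iteratedDerivWithin_congr (fun x hx => hsol.initial x hx) (x_mem P J _)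

/-- The error of the half step. -/
theorem half_error_le (B : ConsistencyBounds P u ρ K J) (hK : 1 ≤ K) (hsol : IsSolution P u)
    (hu : ContDiffOn ℝ 6 (Function.uncurry u) P.Q) (hN : 1 ≤ N) (hτ : K ^ 2 * P.τ N ≤ 1)
    {W₀ Wh : Grid J} (h0 : IsEllipticProjection P P.u₀ W₀) (hW : VanishesAtEnds Wh)
    (H : Step P 0 (P.τ N / 2) W₀ Wh
      fun j => (P.g (‖P.u₀ (P.x J j)‖ ^ 2) : ℂ) * avg Wh W₀ j) :
    gridNorm (P.h J) (sample P J (u (P.tmid N 0)) - Wh)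
      ≤ 6 * K ^ 3 * (P.τ N ^ 2 + P.h J ^ 2) := by
  have hh := P.h_pos J
  have hτ0 := P.τ_pos hN
  have h00 : (0 : ℝ) ∈ Icc 0 P.T := ⟨le_rfl, P.T_pos.le⟩
  have emid : P.tmid N 0 = 0 + P.τ N / 2 := by simp [Problem.tmid, Problem.t]
  have hk := tmid_mem P hN (n := 0) (by omega)
  rw [emid] at hk ⊢
  set k := P.τ N / 2 with hkdef
  have hk0 : 0 < k := by positivity
  have hkT : 0 + k ≤ P.T := hk.2
  have hθ0 := projection_eq B hsol hu h0
  have herr := H.error_eq hsol hu B h00 hk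
  set U₀ := sample P J (u 0)
  set Uh := sample P J (u (0 + k)) with hUh
  set G₀ := sample P J (gOf P u 0)
  set Gh := sample P J (gOf P u (0 + k))
  have hM : (fun j => (P.g (‖P.u₀ (P.x J j)‖ ^ 2) : ℂ) * avg Wh W₀ j) = G₀ * avg Wh W₀ := by
    ext j
    simp [G₀, sample, gOf, hsol.initial _ (x_mem P J j)]
  rw [hM] at herr
  -- Freezing the coefficient at the initial time is only first order accurate, but in a single step
  -- the defect is multiplied by k, which leaves O(k²).
  have e1 : avg (Gh * Uh) (G₀ * U₀) - G₀ * avg Wh W₀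
      = (1 / 2 : ℂ) • ((Gh - G₀) * Uh) + G₀ * avg (Uh - Wh) (U₀ - W₀) := by
    ext j; simp [avg]; ring
  rw [e1] at herr
  set B₁ := Uh - U₀ - ((k / 2 : ℝ) : ℂ) • (sample P J (Dt P u (0 + k)) + sample P J (Dt P u 0))
  set b := (Complex.I * (k : ℂ)) • ((1 / 2 : ℂ) • ((Gh - G₀) * Uh) + G₀ * avg (Uh - Wh) (U₀ - W₀))
    + ((ρ J (0 + k) - ρ J 0) + B₁) with hb
  have h1 := seminormH1_step_le hh (κ := k) (z := U₀ + ρ J 0 - W₀) (z' := Uh + ρ J (0 + k) - Wh)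
    (b := b) (p := 0) (by rw [sub_zero, sub_eq_iff_eq_add, herr, hb]; abel)
  have hz : seminormH1 (P.h J) (0 : Grid J) = 0 := by simp [seminormH1, diffQuot]
  rw [hθ0, hz, mul_zero, add_zero, zero_add (seminormH1 _ b)] at h1
  set e := gridNorm (P.h J) (Uh - Wh) with he
  have he0 : gridNorm (P.h J) (U₀ - W₀) ≤ K * P.h J ^ 2 := by
    have : U₀ - W₀ = (U₀ + ρ J 0 - W₀) - ρ J 0 := by abel
    rw [this, hθ0, gridNorm_sub_comm hh.le, sub_zero]
    exact B.ρ_le 0 h00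
  have hb' : gridNorm (P.h J) b ≤ k * (K * k * K / 2 + K * ((e + K * P.h J ^ 2) / 2))
      + (K * (k * P.h J ^ 2) + K * k ^ 3) := by
    rw [hb]
    refine (gridNorm_add_le hh.le _ _).trans (add_le_add ?_ ((gridNorm_add_le hh.le _ _).trans
      (add_le_add (B.ρ_diff 0 k le_rfl hk0.le hkT) (B.trap 0 k le_rfl hk0.le hkT))))
    rw [gridNorm_smul hh.le, ErrorSystem.norm_I_mul hk0]
    refine mul_le_mul_of_nonneg_left ?_ hk0.le
    refine (gridNorm_add_le hh.le _ _).trans (add_le_add ?_ ?_)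
    · rw [gridNorm_smul hh.le]
      have t1 := (gridNorm_mul_le hh.le (Gh - G₀) Uh).trans
        (mul_le_mul (B.g_diff 0 k le_rfl hk0.le hkT) (B.u_le _ hk) (gridNorm_nonneg _)
          (by positivity))
      norm_num
      linarith
    · refine (gridNorm_mul_le hh.le _ _).trans (mul_le_mul (B.g_le 0 h00) ?_ (gridNorm_nonneg _)
        (by positivity))
      refine (gridNorm_avg_le hh.le _ _).trans ?_
      linarith
  have hem : e ≤ K * seminormH1 (P.h J) (Uh + ρ J (0 + k) - Wh) + K * P.h J ^ 2 := by
    have : Uh - Wh = (Uh + ρ J (0 + k) - Wh) - ρ J (0 + k) := by abel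
    rw [he, this]
    exact (gridNorm_sub_le hh.le _ _).trans (add_le_add (B.norm_le _
      (((vanishesAtEnds_sample hsol J hk).add (B.ρ_mem _)).sub hW)) (B.ρ_le _ hk))
  have h2 := (h1.trans (seminormH1_le_gridNorm _)).trans hb'
  have h3 := mul_le_mul_of_nonneg_left h2 (by positivity : 0 ≤ K)
  have hkK : K ^ 2 * k ≤ 1 / 2 := by rw [hkdef]; linarith
  have hk1 : k ≤ 1 := by
    have : 1 * k ≤ K ^ 2 * k := mul_le_mul_of_nonneg_right (by nlinarith) hk0.le
    linarith
  have he00 : 0 ≤ e := gridNorm_nonneg _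
  have hτk : P.τ N = 2 * k := by rw [hkdef]; ring
  rw [hτk]
  set H2 := P.h J ^ 2
  have hH2 : 0 ≤ H2 := sq_nonneg _
  have q1 : K ≤ K ^ 3 := le_self_pow₀ hK (by norm_num)
  have q2 : K ^ 2 ≤ K ^ 3 := pow_le_pow_right₀ hK (by norm_num)
  have s1 : K ^ 2 * k * e ≤ 1 / 2 * e := mul_le_mul_of_nonneg_right hkK he00
  have s2 : K ^ 2 * k * (K * H2) ≤ 1 / 2 * (K * H2) :=
    mul_le_mul_of_nonneg_right hkK (by positivity)
  have s3 : K ^ 2 * k * H2 ≤ 1 / 2 * H2 := mul_le_mul_of_nonneg_right hkK hH2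
  have s4 : K ^ 2 * k * k ^ 2 ≤ 1 / 2 * k ^ 2 := mul_le_mul_of_nonneg_right hkK (sq_nonneg _)
  have s5 : K * H2 ≤ K ^ 3 * H2 := mul_le_mul_of_nonneg_right q1 hH2
  have s6 : H2 ≤ K ^ 3 * H2 := le_mul_of_one_le_left hH2 (hK.trans q1)
  have s7 : k ^ 2 ≤ K ^ 3 * k ^ 2 := le_mul_of_one_le_left (sq_nonneg _) (hK.trans q1)
  have s8 : K ^ 2 * (k * H2) ≤ K ^ 3 * H2 := by
    calc K ^ 2 * (k * H2) ≤ K ^ 3 * (1 * H2) := by gcongr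
      _ = _ := by ring
  nlinarith

theorem exists_relax_lipschitz (P : Problem) (hg : ContDiffOn ℝ 5 P.g (Ici 0)) (R : ℝ) :
    ∃ M, 0 ≤ M ∧ ∀ (J : ℕ) (h : ℝ), 0 < h → ∀ u v : Grid J, gridNorm h u ≤ R → gridNorm h v ≤ R →
      gridNorm h (nonlin P.g u - nonlin P.g v) ≤ M * gridNorm h (u - v) := by
  obtain ⟨M, hM0, hM⟩ := exists_nonlin_bounds (hg.of_le (by norm_num)) R
  exact ⟨M, hM0, fun J h hh => (hM J h hh).1⟩

theorem η_le (P : Problem) {N J : ℕ} (hN : 1 ≤ N) :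
    P.τ N ^ 2 + P.h J ^ 2 ≤ P.T ^ 2 + P.L ^ 2 := by
  have h1 : P.τ N ≤ P.T := div_le_self P.T_pos.le (by exact_mod_cast hN)
  have h2 : P.h J ≤ P.L := div_le_self P.L_pos.le (by linarith [Nat.cast_nonneg (α := ℝ) J])
  have := P.τ_pos hN
  have := P.h_pos J
  gcongr

/-- The consistency error of the averaged nonlinear term. -/
noncomputable def avgError (P : Problem) (u : ℝ → ℝ → ℂ) (J : ℕ) (t a : ℝ) : Grid J :=
  avg (sample P J (gOf P u (t + a + a)) * sample P J (u (t + a + a)))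
      (sample P J (gOf P u t) * sample P J (u t))
    - sample P J (gOf P u (t + a)) * avg (sample P J (u (t + a + a))) (sample P J (u t))

/-- Exhibits second order smallness: a second difference of g(|u|²), plus a product of two first
differences. -/
theorem avgError_eq (t a : ℝ) : avgError P u J t a = (1 / 2 : ℂ) •
    ((sample P J (gOf P u (t + a + a)) - sample P J (gOf P u (t + a))
        - (sample P J (gOf P u (t + a)) - sample P J (gOf P u t))) * sample P J (u (t + a + a))
      + (sample P J (gOf P u (t + a)) - sample P J (gOf P u t))
        * (sample P J (u (t + a + a)) - sample P J (u t))) := by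
  ext j; simp [avgError, avg]; ring

theorem gridNorm_avgError_le (B : ConsistencyBounds P u ρ K J) (hK : 0 ≤ K) {t a : ℝ}
    (ht : 0 ≤ t) (ha : 0 ≤ a) (hta : t + a + a ≤ P.T) :
    gridNorm (P.h J) (avgError P u J t a) ≤ 2 * K ^ 2 * a ^ 2 := by
  have hh := (P.h_pos J).le
  rw [avgError_eq, gridNorm_smul hh]
  have h1 := (gridNorm_mul_le hh _ _).trans (mul_le_mul (B.g_diff₂ t a a ht ha ha hta)
    (B.u_le (t + a + a) ⟨by linarith, hta⟩) (gridNorm_nonneg _) (by positivity))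
  have hu2 := B.u_diff t (a + a) ht (by linarith) (by linarith)
  rw [← add_assoc] at hu2
  have h2 := (gridNorm_mul_le hh _ _).trans (mul_le_mul (B.g_diff t a ht ha (by linarith)) hu2
    (gridNorm_nonneg _) (by positivity))
  have h3 := (gridNorm_add_le hh _ _).trans (add_le_add h1 h2)
  norm_num
  nlinarith [mul_nonneg (sq_nonneg K) (sq_nonneg a)]

/-- With a = τ/2 the shift 2a is one full time step. The product rule puts one additional difference
on a factor of each term, which gains the factor a. -/
theorem gridNorm_avgError_diff_le (B : ConsistencyBounds P u ρ K J) (hK : 0 ≤ K) {t a : ℝ}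
    (ht : 0 ≤ t) (ha : 0 ≤ a) (hta : t + 2 * a + a + a ≤ P.T) :
    gridNorm (P.h J) (avgError P u J (t + 2 * a) a - avgError P u J t a)
      ≤ 8 * K ^ 2 * a ^ 3 := by
  have hh := (P.h_pos J).le
  have c1 : t + 2 * a + a + a = t + a + a + 2 * a := by ring
  have c2 : t + 2 * a + a = t + a + 2 * a := by ring
  rw [c1] at hta
  have g3 := B.g_diff₃ t (2 * a) a a ht (by linarith) ha ha (by linarith)
  have g2 := B.g_diff₂ t a a ht ha ha (by linarith)
  have g2' := B.g_diff₂ t (2 * a) a ht (by linarith) ha (by linarith)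
  have g1 := B.g_diff t a ht ha (by linarith)
  have u0 := B.u_le (t + a + a + 2 * a) ⟨by linarith, hta⟩
  have u1 := B.u_diff (t + a + a) (2 * a) (by linarith) (by linarith) hta
  have u2 := B.u_diff₂ t (2 * a) (a + a) ht (by linarith) (by linarith) (by linarith)
  have u1' := B.u_diff (t + 2 * a) (a + a) (by linarith) (by linarith) (by linarith)
  rw [← add_assoc, c1] at u1'
  rw [← add_assoc, ← add_assoc, c1] at u2
  rw [c1, c2] at g3
  rw [c2] at g2'
  rw [avgError_eq, avgError_eq, ← smul_sub, gridNorm_smul hh, c1, c2]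
  set A := sample P J (gOf P u (t + a + a + 2 * a))
  set A' := sample P J (gOf P u (t + a + 2 * a))
  set A'' := sample P J (gOf P u (t + 2 * a))
  set D := sample P J (gOf P u (t + a + a))
  set D' := sample P J (gOf P u (t + a))
  set D'' := sample P J (gOf P u t)
  set U := sample P J (u (t + a + a + 2 * a))
  set U'' := sample P J (u (t + 2 * a))
  set V := sample P J (u (t + a + a))
  set V'' := sample P J (u t)
  have e : (A - A' - (A' - A'')) * U + (A' - A'') * (U - U'')
        - ((D - D' - (D' - D'')) * V + (D' - D'') * (V - V''))
      = ((A - A' - (A' - A'') - (D - D' - (D' - D''))) * U + (D - D' - (D' - D'')) * (U - V))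
        + ((A' - A'' - (D' - D'')) * (U - U'') + (D' - D'') * (U - U'' - (V - V''))) := by ring
  rw [e]
  have h1 := (gridNorm_mul_le hh _ _).trans (mul_le_mul g3 u0 (gridNorm_nonneg _) (by positivity))
  have h2 := (gridNorm_mul_le hh _ _).trans (mul_le_mul g2 u1 (gridNorm_nonneg _) (by positivity))
  have h3 := (gridNorm_mul_le hh _ _).trans (mul_le_mul g2' u1' (gridNorm_nonneg _) (by positivity))
  have h4 := (gridNorm_mul_le hh _ _).trans (mul_le_mul g1 u2 (gridNorm_nonneg _) (by positivity))
  have h5 := (gridNorm_add_le hh _ _).trans (add_le_add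
    ((gridNorm_add_le hh _ _).trans (add_le_add h1 h2))
    ((gridNorm_add_le hh _ _).trans (add_le_add h3 h4)))
  norm_num
  nlinarith [mul_nonneg (sq_nonneg K) (pow_nonneg ha 3)]

/-- The errors of the relaxation scheme form an error system, with bounds uniform in the mesh. -/
theorem exists_errorSystem (hsol : IsSolution P u) (hu : ContDiffOn ℝ 6 (Function.uncurry u) P.Q)
    (hg : ContDiffOn ℝ 5 P.g (Ici 0)) :
    ∃ K τ₁ : ℝ, 1 ≤ K ∧ 0 < τ₁ ∧ ∀ N J : ℕ, 1 ≤ N → P.τ N ≤ τ₁ →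
      ∀ (W : ℕ → Grid J) (Wh : Grid J) (Φ : ℕ → Fin (J + 2) → ℝ), IsRFD P N J W Wh Φ →
      gridNorm (P.h J) (sample P J (u (P.tmid N 0)) - Wh) ≤ K * (P.τ N ^ 2 + P.h J ^ 2) ∧
      ∃ ρ c r : ℕ → Grid J, ErrorSystem P.g J (P.h J) K (P.τ N) (P.τ N ^ 2 + P.h J ^ 2) N
        (fun n => sample P J (u (P.t N n))) W ρ (fun n => sample P J (gOf P u (P.tmid N n)))
        (fun n => sample P J (gOf P u (P.tmid N n)) - toGrid (Φ n)) c r := by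
  obtain ⟨ρ, K, hK, hB⟩ := exists_consistencyBounds hu hg
  -- The radius covers the exact solution and the half step approximation, whose error is at most
  -- 6K³η with η ≤ T² + L² on every mesh.
  obtain ⟨M, hM0, hM⟩ := exists_relax_lipschitz P hg (K + 6 * K ^ 3 * (P.T ^ 2 + P.L ^ 2))
  have k12 : K ≤ K ^ 2 := le_self_pow₀ hK (by norm_num)
  have k23 : K ^ 2 ≤ K ^ 3 := pow_le_pow_right₀ hK (by norm_num)
  set K' := 6 * K ^ 3 * (1 + M) with hK'
  have hK'6 : 6 * K ^ 3 ≤ K' := le_mul_of_one_le_right (by positivity) (by linarith)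
  have hMK' : M * (6 * K ^ 3) ≤ K' := by
    rw [hK']
    have : 0 ≤ 6 * K ^ 3 := by positivity
    linarith
  have hKK' : K ≤ K' := by linarith
  refine ⟨K', 1 / K ^ 2, by linarith, by positivity, fun N J hN hτ W Wh Φ H => ?_⟩
  have B := hB J
  have hh := P.h_pos J
  have hτ0 := P.τ_pos hN
  have hτK : K ^ 2 * P.τ N ≤ 1 := by
    rw [le_div_iff₀ (by positivity)] at hτ; linarith
  set η := P.τ N ^ 2 + P.h J ^ 2 with hη
  have hη0 : 0 ≤ η := by positivity
  have hhalf := half_error_le B hK hsol hu hN hτK H.initial H.ends_half H.half_step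
  refine ⟨hhalf.trans (mul_le_mul_of_nonneg_right hK'6 hη0), fun n => ρ J (P.t N n),
    -- The relaxation defect is the second difference of g(|u|²) centred at t_{n+1} with spacing
    -- τ/2.
    fun n => sample P J (gOf P u (P.tmid N (n + 1))) + sample P J (gOf P u (P.tmid N n))
      - (2 : ℂ) • sample P J (gOf P u (P.t N (n + 1))),
    -- In the error system r is multiplied by τ, hence the division of the projection and quadrature
    -- errors.
    fun n => ((P.τ N : ℂ)⁻¹) • ((ρ J (P.t N n + P.τ N) - ρ J (P.t N n))
        + (sample P J (u (P.t N n + P.τ N)) - sample P J (u (P.t N n))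
          - ((P.τ N / 2 : ℝ) : ℂ) • (sample P J (Dt P u (P.t N n + P.τ N))
            + sample P J (Dt P u (P.t N n)))))
      + Complex.I • avgError P u J (P.t N n) (P.τ N / 2), ?_⟩
  set τ := P.τ N with hτdef
  have tsum : ∀ n < N, P.t N n + τ ≤ P.T := fun n hn => by
    rw [hτdef, ← t_succ]; exact t_le P hN hn
  have tsum2 : ∀ n, n + 1 < N → P.t N n + τ + τ ≤ P.T := fun n hn => by
    have := tsum (n + 1) hn
    rwa [t_succ] at this
  have tsum3 : ∀ n, n + 2 < N → P.t N n + τ + τ + τ ≤ P.T := fun n hn => by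
    have := tsum2 (n + 1) hn
    rwa [t_succ] at this
  have tn := t_nonneg P hN
  have hτc : (τ : ℂ) ≠ 0 := by exact_mod_cast hτ0.ne'
  have hτi : ‖(τ : ℂ)⁻¹‖ = τ⁻¹ := by
    rw [norm_inv, Complex.norm_real, Real.norm_of_nonneg hτ0.le]
  have emid : ∀ n, P.tmid N n = P.t N n + τ / 2 := fun n => rfl
  have ehalf : ∀ s : ℝ, s + τ = s + τ / 2 + τ / 2 := fun s => by ring
  have mono : ∀ {a b : ℝ}, a ≤ K * b → 0 ≤ b → a ≤ K' * b := fun h hb =>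
    h.trans (mul_le_mul_of_nonneg_right hKK' hb)
  have hτη : τ * P.h J ^ 2 ≤ τ * η := by rw [hη]; nlinarith [pow_pos hτ0 3]
  have hh2η : P.h J ^ 2 ≤ η := by rw [hη]; nlinarith [sq_nonneg τ]
  have hτ2η : τ ^ 2 ≤ η := by rw [hη]; nlinarith [sq_nonneg (P.h J)]
  constructor
  · exact hh
  · exact hτ0
  · exact hη0
  · exact fun v hv => mono (B.norm_le v hv) (seminormH1_nonneg _)
  · exact H.ends
  · exact fun n hn => ((vanishesAtEnds_sample hsol J (t_mem P hN hn)).add (B.ρ_mem _)).sub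
      (H.ends n hn)
  · exact fun n hn => (B.u_le _ (t_mem P hN hn)).trans hKK'
  · intro n hn
    simp only [t_succ]
    exact mono (B.u_diff _ _ (tn n) hτ0.le (tsum n hn)) hτ0.le
  · exact fun n hn => (B.g_le _ (tmid_mem P hN hn)).trans hKK'
  · intro n hn
    simp only [tmid_succ]
    refine mono (B.g_diff _ _ (tmid_mem P hN (by omega)).1 hτ0.le ?_) hτ0.le
    rw [← hτdef, ← tmid_succ]; exact (tmid_mem P hN hn).2
  · exact fun n hn => mono ((B.ρ_le _ (t_mem P hN hn)).trans
      (mul_le_mul_of_nonneg_left hh2η (by linarith))) hη0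
  · intro n hn
    simp only [t_succ]
    exact mono ((B.ρ_diff _ _ (tn n) hτ0.le (tsum n hn)).trans
      (mul_le_mul_of_nonneg_left hτη (by linarith))) (by positivity)
  · intro n hn
    have h1 := B.ρ_diff _ _ (tn n) hτ0.le (tsum n hn)
    have h2 := B.trap _ _ (tn n) hτ0.le (tsum n hn)
    have h3 := gridNorm_avgError_le B (by linarith) (tn n) (by positivity : 0 ≤ τ / 2)
      (by rw [← ehalf]; exact tsum n hn)
    refine (gridNorm_add_le hh.le _ _).trans ?_
    rw [gridNorm_smul hh.le, gridNorm_smul hh.le, Complex.norm_I, one_mul, hτi]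
    have h4 := mul_le_mul_of_nonneg_left ((gridNorm_add_le hh.le _ _).trans (add_le_add h1 h2))
      (inv_nonneg.2 hτ0.le)
    have e : τ⁻¹ * (K * (τ * P.h J ^ 2) + K * τ ^ 3) = K * η := by
      rw [hη]; field_simp; ring
    rw [e] at h4
    have h5 : 2 * K ^ 2 * (τ / 2) ^ 2 ≤ K ^ 3 * η := by
      calc 2 * K ^ 2 * (τ / 2) ^ 2 ≤ K ^ 2 * τ ^ 2 := by
            nlinarith [mul_nonneg (sq_nonneg K) (sq_nonneg τ)]
        _ ≤ _ := by gcongr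
    have h6 : K * η + K ^ 3 * η ≤ K' * η := by
      rw [← add_mul]; exact mul_le_mul_of_nonneg_right (by linarith) hη0
    linarith
  · intro n hn
    simp only [t_succ]
    rw [← hτdef]
    have h1 := B.ρ_diff₂ _ _ (tn n) hτ0.le (tsum2 n hn)
    have h2 := B.trap_diff _ _ τ (tn n) hτ0.le hτ0.le (tsum2 n hn)
    have h3 := gridNorm_avgError_diff_le B (by linarith) (tn n) (by positivity : 0 ≤ τ / 2)
      (by rw [mul_div_cancel₀ τ (by norm_num : (2 : ℝ) ≠ 0), add_assoc, add_halves]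
          exact tsum2 n hn)
    rw [mul_div_cancel₀ τ (by norm_num : (2 : ℝ) ≠ 0)] at h3
    have e1 : ∀ a b c d : Grid J, ∀ x y : ℂ, (x • a + y • b) - (x • c + y • d)
        = x • (a - c) + y • (b - d) := fun a b c d x y => by module
    rw [e1, add_sub_add_comm]
    refine (gridNorm_add_le hh.le _ _).trans ?_
    rw [gridNorm_smul hh.le, gridNorm_smul hh.le, Complex.norm_I, one_mul, hτi]
    have h4 := mul_le_mul_of_nonneg_left ((gridNorm_add_le hh.le _ _).trans (add_le_add h1 h2))
      (inv_nonneg.2 hτ0.le)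
    have e : τ⁻¹ * (K * (τ ^ 2 * P.h J ^ 2) + K * τ * τ ^ 3) = K * (τ * η) := by
      rw [hη]; field_simp; ring
    rw [e] at h4
    have h5 : 8 * K ^ 2 * (τ / 2) ^ 3 ≤ K ^ 3 * (τ * η) := by
      calc 8 * K ^ 2 * (τ / 2) ^ 3 = K ^ 2 * (τ * τ ^ 2) := by ring
        _ ≤ _ := by gcongr
    have h6 : K * (τ * η) + K ^ 3 * (τ * η) ≤ K' * (τ * η) := by
      rw [← add_mul]; exact mul_le_mul_of_nonneg_right (by linarith) (by positivity)
    linarith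
  · intro n hn
    have h1 := B.g_diff₂ (P.tmid N n) (τ / 2) (τ / 2) (tmid_mem P hN (by omega)).1 (by positivity)
      (by positivity) (by rw [← ehalf, hτdef, ← tmid_succ]; exact (tmid_mem P hN hn).2)
    have e1 : P.t N (n + 1) = P.tmid N n + τ / 2 := by rw [t_succ, emid, ← hτdef, ehalf]
    have e2 : P.tmid N (n + 1) = P.tmid N n + τ / 2 + τ / 2 := by
      rw [tmid_succ, ← hτdef, ehalf]
    simp only [e1, e2]
    have e3 : ∀ a b c : Grid J, a + c - (2 : ℂ) • b = a - b - (b - c) := fun a b c => by module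
    rw [e3]
    have h2 : K * (τ / 2) * (τ / 2) ≤ K * η := by
      rw [mul_assoc]
      refine mul_le_mul_of_nonneg_left ?_ (by linarith)
      nlinarith
    exact mono (h1.trans h2) hη0
  · intro n hn
    have e1 : P.t N (n + 1) = P.tmid N n + τ / 2 := by rw [t_succ, emid, ← hτdef, ehalf]
    have e2 : P.tmid N (n + 1) = P.tmid N n + τ / 2 + τ / 2 := by
      rw [tmid_succ, ← hτdef, ehalf]
    have e1' : P.t N (n + 1 + 1) = P.tmid N n + τ + τ / 2 := by
      rw [t_succ, e1, ← hτdef]; ring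
    have e2' : P.tmid N (n + 1 + 1) = P.tmid N n + τ + τ / 2 + τ / 2 := by
      rw [tmid_succ, e2, ← hτdef]; ring
    have e2'' : P.tmid N (n + 1) = P.tmid N n + τ := tmid_succ P N n
    have h1 := B.g_diff₃ (P.tmid N n) τ (τ / 2) (τ / 2) (tmid_mem P hN (by omega)).1 hτ0.le
      (by positivity) (by positivity) (by rw [← e2']; exact (tmid_mem P hN (by omega)).2)
    have e3 : ∀ a b c a' b' c' : Grid J, a + c - (2 : ℂ) • b - (a' + c' - (2 : ℂ) • b')
        = a - b - (b - c) - (a' - b' - (b' - c')) := fun a b c a' b' c' => by module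
    simp only [e2', e1', e1, e3]
    rw [e2''] 
    rw [← ehalf (P.tmid N n)] at h1
    refine mono (h1.trans ?_) (by positivity)
    have : K * (τ / 2) * (τ / 2) * τ = K * (τ * (τ ^ 2 / 4)) := by ring
    rw [this]
    gcongr
    linarith [sq_nonneg τ]
  · intro n hn
    have herr := (H.step n hn).error_eq hsol hu B (t_mem P hN hn.le)
      (by rw [← t_succ]; exact t_mem P hN hn)
    simp only [t_succ]
    rw [← hτdef] at herr ⊢
    have hM' : (fun j => (Φ n j : ℂ) * avg (W (n + 1)) (W n) j)
        = toGrid (Φ n) * avg (W (n + 1)) (W n) := rfl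
    rw [hM'] at herr
    have e : P.t N n + τ = P.t N n + τ / 2 + τ / 2 := ehalf _
    rw [smul_add, smul_smul, smul_smul, mul_inv_cancel₀ hτc, one_smul]
    refine herr.trans ?_
    rw [avgError, ← e, ← emid]
    ext j
    simp only [Pi.add_apply, Pi.sub_apply, Pi.smul_apply, Pi.mul_apply, smul_eq_mul]
    ring
  · intro n hn
    ext j
    have h1 := H.Φ_succ n hn j
    have h2 : ((Φ (n + 1) j : ℝ) : ℂ) = 2 * ((P.g (‖W (n + 1) j‖ ^ 2) : ℝ) : ℂ) - Φ n j := by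
      rw [h1]; push_cast; ring
    simp only [Pi.add_apply, Pi.sub_apply, Pi.smul_apply, smul_eq_mul, toGrid, nonlin, sample, h2,
      gOf]
    ring
  · have : P.t N 0 = 0 := by simp [Problem.t]
    rw [this]
    exact projection_eq B hsol hu H.initial
  · have e : sample P J (gOf P u (P.tmid N 0)) - toGrid (Φ 0)
        = nonlin P.g (sample P J (u (P.tmid N 0))) - nonlin P.g Wh := by
      ext j
      simp [sample, gOf, nonlin, toGrid, H.Φ_zero j]
    have hu0 := B.u_le _ (tmid_mem P hN (n := 0) (by omega))
    have hηR := η_le P (J := J) hN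
    have hpos : 0 ≤ 6 * K ^ 3 * (P.T ^ 2 + P.L ^ 2) := by positivity
    have hWh : gridNorm (P.h J) Wh ≤ K + 6 * K ^ 3 * (P.T ^ 2 + P.L ^ 2) := by
      have : Wh = sample P J (u (P.tmid N 0)) - (sample P J (u (P.tmid N 0)) - Wh) := by abel
      rw [this]
      refine (gridNorm_sub_le hh.le _ _).trans (add_le_add hu0 (hhalf.trans ?_))
      exact mul_le_mul_of_nonneg_left hηR (by positivity)
    rw [e]
    refine (hM J _ hh _ _ (by linarith) hWh).trans
      ((mul_le_mul_of_nonneg_left hhalf hM0).trans ?_)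
    rw [← mul_assoc]
    exact mul_le_mul_of_nonneg_right hMK' hη0

end Errors

/-! ### The modified scheme on fine meshes -/

section Fine

variable {P : Problem} {u : ℝ → ℝ → ℂ} {N J : ℕ} {δ : ℝ}

/-- The errors of the approximations are at most `E`. -/
structure ErrorsLE (P : Problem) (u : ℝ → ℝ → ℂ) (N J : ℕ) (V : ℕ → Grid J) (Vhalf : Grid J)
    (Φ : ℕ → Fin (J + 2) → ℝ) (E : ℝ) : Prop where
  half : gridNorm (P.h J) (sample P J (u (P.tmid N 0)) - Vhalf) ≤ E
  node : ∀ n ≤ N, gridNorm (P.h J) (sample P J (u (P.t N n)) - V n) ≤ E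
  relax : ∀ n < N, gridNorm (P.h J) (sample P J (gOf P u (P.tmid N n)) - toGrid (Φ n)) ≤ E

theorem ErrorsLE.mono {V : ℕ → Grid J} {Vhalf : Grid J} {Φ : ℕ → Fin (J + 2) → ℝ} {E E' : ℝ}
    (H : ErrorsLE P u N J V Vhalf Φ E) (h : E ≤ E') : ErrorsLE P u N J V Vhalf Φ E' :=
  ⟨H.half.trans h, fun n hn => (H.node n hn).trans h, fun n hn => (H.relax n hn).trans h⟩

/-- Convergence of the relaxation scheme for small mesh sizes. -/
theorem exists_rfd_bound (hsol : IsSolution P u) (hu : ContDiffOn ℝ 6 (Function.uncurry u) P.Q)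
    (hg : ContDiffOn ℝ 5 P.g (Ici 0)) :
    ∃ C τ₀ η₀ : ℝ, 0 < C ∧ 0 < τ₀ ∧ 0 < η₀ ∧ ∀ N J : ℕ, 1 ≤ N → P.τ N ≤ τ₀ →
      P.τ N ^ 2 + P.h J ^ 2 ≤ η₀ → ∀ (W : ℕ → Grid J) (Wh : Grid J) (Φ : ℕ → Fin (J + 2) → ℝ),
      IsRFD P N J W Wh Φ → ErrorsLE P u N J W Wh Φ (C * (P.τ N ^ 2 + P.h J ^ 2)) := by
  obtain ⟨K, τ₁, hK, hτ₁, hS⟩ := exists_errorSystem hsol hu hg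
  obtain ⟨C, τ₀, η₀, hC, hτ₀, hη₀, hB⟩ := ErrorSystem.exists_bound (hg.of_le (by norm_num)) hK
    P.T_pos.le
  refine ⟨max C K, min τ₀ τ₁, η₀, lt_max_of_lt_left hC, lt_min hτ₀ hτ₁, hη₀,
    fun N J hN hτ hη W Wh Φ H => ?_⟩
  have hη0 : 0 ≤ P.τ N ^ 2 + P.h J ^ 2 := by positivity
  obtain ⟨hh, ρ, c, r, S⟩ := hS N J hN (hτ.trans (min_le_right _ _)) W Wh Φ H
  obtain ⟨h1, h2⟩ := hB J _ _ _ N _ W ρ _ _ c r S (hτ.trans (min_le_left _ _)) hη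
    (P.mul_τ hN).le
  have m1 := mul_le_mul_of_nonneg_right (le_max_left C K) hη0
  exact ⟨hh.trans (mul_le_mul_of_nonneg_right (le_max_right _ _) hη0),
    fun n hn => (h1 n hn).trans m1, fun n hn => (h2 n hn).trans m1⟩

theorem le_half_of_uMax_gMax (hu : ContDiffOn ℝ 6 (Function.uncurry u) P.Q)
    (hg : ContDiffOn ℝ 5 P.g (Ici 0)) (hδ : 2 * max (uMax P u) (gMax P u) ≤ δ) {t x : ℝ}
    (ht : t ∈ Icc 0 P.T) (hx : x ∈ P.I) :
    ‖u t x‖ ≤ δ / 2 ∧ |P.g (‖u t x‖ ^ 2)| ≤ δ / 2 := by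
  have hq : (t, x) ∈ P.Q := mk_mem_prod ht hx
  have b1 : BddAbove ((fun q : ℝ × ℝ => ‖u q.1 q.2‖) '' P.Q) :=
    (isCompact_Q P).bddAbove_image hu.continuousOn.norm
  have b2 : BddAbove ((fun q : ℝ × ℝ => |P.g (‖u q.1 q.2‖ ^ 2)|) '' P.Q) := by
    refine (isCompact_Q P).bddAbove_image
      ((contDiffOn_gOf hu hg).continuousOn.norm.congr fun q _ => ?_)
    simp [Function.uncurry, gOf]
  have h1 : ‖u t x‖ ≤ uMax P u := le_csSup b1 ⟨(t, x), hq, rfl⟩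
  have h2 : |P.g (‖u t x‖ ^ 2)| ≤ gMax P u := le_csSup b2 ⟨(t, x), hq, rfl⟩
  have h3 := le_max_left (uMax P u) (gMax P u)
  have h4 := le_max_right (uMax P u) (gMax P u)
  exact ⟨by linarith, by linarith⟩

/-- The cut-offs are inactive as long as the approximations stay close to the solution. -/
theorem isRFD_iff_isMRFD (hN : 1 ≤ N)
    (hb : ∀ t ∈ Icc 0 P.T, ∀ x ∈ P.I, ‖u t x‖ ≤ δ / 2 ∧ |P.g (‖u t x‖ ^ 2)| ≤ δ / 2)
    {V : ℕ → Grid J} {Vhalf : Grid J} {Φ : ℕ → Fin (J + 2) → ℝ}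
    (hhalf : ∀ j, ‖u (P.tmid N 0) (P.x J j) - Vhalf j‖ ≤ δ / 2)
    (hnode : ∀ n ≤ N, ∀ j, ‖u (P.t N n) (P.x J j) - V n j‖ ≤ δ / 2)
    (hrelax : ∀ n < N, ∀ j, |P.g (‖u (P.tmid N n) (P.x J j)‖ ^ 2) - Φ n j| ≤ δ / 2) :
    IsRFD P N J V Vhalf Φ ↔ IsMRFD P δ N J V Vhalf Φ := by
  have key : ∀ {a b : ℂ}, ‖a‖ ≤ δ / 2 → ‖a - b‖ ≤ δ / 2 → ‖b‖ ≤ δ := fun {a b} h1 h2 => by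
    have := norm_sub_le a (a - b)
    rw [sub_sub_cancel] at this
    linarith
  have h1 : ∀ j, ‖Vhalf j‖ ≤ δ := fun j =>
    key (hb _ (tmid_mem P hN (by omega)) _ (x_mem P J j)).1 (hhalf j)
  have h2 : ∀ n ≤ N, ∀ j, ‖V n j‖ ≤ δ := fun n hn j =>
    key (hb _ (t_mem P hN hn) _ (x_mem P J j)).1 (hnode n hn j)
  have h3 : ∀ n < N, ∀ j, ‖avg (V (n + 1)) (V n) j‖ ≤ δ := fun n hn j => by
    rw [avg, norm_div, Complex.norm_two]
    have := norm_add_le (V (n + 1) j) (V n j)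
    linarith [h2 _ hn j, h2 n hn.le j]
  have h4 : ∀ n < N, ∀ j, |Φ n j| ≤ δ := fun n hn j => by
    have e1 := (hb _ (tmid_mem P hN hn) _ (x_mem P J j)).2
    have e2 := hrelax n hn j
    rw [abs_le] at e1 e2 ⊢
    constructor <;> linarith
  rw [isRFD_iff, isMRFD_iff]
  exact ⟨fun H => H.congr (fun j => (cmollifier_of_norm_le (h1 j)).symm)
      (fun n hn j => (cmollifier_of_norm_le (h2 n hn j)).symm)
      (fun n hn j => (cmollifier_of_norm_le (h3 n hn j)).symm)
      (fun n hn j => (mollifier_of_abs_le (h4 n hn j)).symm),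
    fun H => H.congr (fun j => cmollifier_of_norm_le (h1 j))
      (fun n hn j => cmollifier_of_norm_le (h2 n hn j))
      (fun n hn j => cmollifier_of_norm_le (h3 n hn j))
      (fun n hn j => mollifier_of_abs_le (h4 n hn j))⟩

theorem ErrorsLE.isRFD_iff_isMRFD (hN : 1 ≤ N)
    (hb : ∀ t ∈ Icc 0 P.T, ∀ x ∈ P.I, ‖u t x‖ ≤ δ / 2 ∧ |P.g (‖u t x‖ ^ 2)| ≤ δ / 2)
    {V : ℕ → Grid J} {Vhalf : Grid J} {Φ : ℕ → Fin (J + 2) → ℝ} {E : ℝ}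
    (H : ErrorsLE P u N J V Vhalf Φ E) (hE : E ≤ δ / 2) :
    IsRFD P N J V Vhalf Φ ↔ IsMRFD P δ N J V Vhalf Φ := by
  refine RFD.isRFD_iff_isMRFD hN hb (fun j => ?_) (fun n hn j => ?_) (fun n hn j => ?_)
  · exact ((norm_apply_le_gridNorm (sample P J (u (P.tmid N 0)) - Vhalf) j).trans H.half).trans hE
  · exact ((norm_apply_le_gridNorm (sample P J (u (P.t N n)) - V n) j).trans (H.node n hn)).trans hE
  · have := ((norm_apply_le_gridNorm _ j).trans (H.relax n hn)).trans hE
    rwa [Pi.sub_apply, sample, gOf, toGrid, ← Complex.ofReal_sub, Complex.norm_real,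
      Real.norm_eq_abs] at this

/-- A step of the modified scheme has at most one solution if `τ` is small. -/
theorem Step.unique_mollified {B s k : ℝ} (hk : 0 ≤ k) (hB1 : ∀ y, |mollifier δ y| ≤ B)
    (hB2 : ∀ y z, ‖cmollifier δ y - cmollifier δ z‖ ≤ B * ‖y - z‖) (hkB : k * B ^ 2 ≤ 1)
    {V₀ V₁ V₁' : Grid J} {Φ : Fin (J + 2) → ℝ} (h1 : VanishesAtEnds V₁)
    (h1' : VanishesAtEnds V₁')
    (H : Step P s k V₀ V₁ fun j => (mollifier δ (Φ j) : ℂ) * cmollifier δ (avg V₁ V₀ j))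
    (H' : Step P s k V₀ V₁' fun j => (mollifier δ (Φ j) : ℂ) * cmollifier δ (avg V₁' V₀ j)) :
    V₁ = V₁' := by
  refine sub_eq_zero.1 (eq_zero_of_small (P.h_pos J) (h1.sub h1') (H.sub_eq H') fun j => ?_)
  have e : avg V₁ V₀ j - avg V₁' V₀ j = (V₁ - V₁') j / 2 := by simp [avg]; ring
  simp only [Pi.smul_apply, Pi.sub_apply, smul_eq_mul]
  rw [← mul_sub, norm_mul, norm_mul, norm_mul, Complex.norm_I, one_mul, Complex.norm_real,
    Complex.norm_real, Real.norm_of_nonneg hk, Real.norm_eq_abs]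
  have h2 := hB2 (avg V₁ V₀ j) (avg V₁' V₀ j)
  rw [e, norm_div, Complex.norm_two] at h2
  have hB0 : 0 ≤ B := (abs_nonneg _).trans (hB1 0)
  calc k * (|mollifier δ (Φ j)| * ‖cmollifier δ (avg V₁ V₀ j) - cmollifier δ (avg V₁' V₀ j)‖)
      ≤ k * (B * (B * (‖(V₁ - V₁') j‖ / 2))) := by
        gcongr
        exact hB1 _
    _ = k * B ^ 2 * (‖(V₁ - V₁') j‖ / 2) := by ring
    _ ≤ 1 * (‖(V₁ - V₁') j‖ / 2) := by gcongr
    _ = _ := one_mul _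

theorem IsMRFD.unique {B : ℝ} (hN : 1 ≤ N) (hB1 : ∀ y, |mollifier δ y| ≤ B)
    (hB2 : ∀ y z, ‖cmollifier δ y - cmollifier δ z‖ ≤ B * ‖y - z‖) (hτ : P.τ N * B ^ 2 ≤ 1)
    {V V' : ℕ → Grid J} {Vhalf Vhalf' : Grid J}
    {Φ Φ' : ℕ → Fin (J + 2) → ℝ} (H : IsMRFD P δ N J V Vhalf Φ)
    (H' : IsMRFD P δ N J V' Vhalf' Φ') :
    Vhalf = Vhalf' ∧ (∀ n ≤ N, V n = V' n) ∧ ∀ n < N, Φ n = Φ' n :=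
  IsScheme.unique (fun _ _ _ _ _ _ h1 h1' s s' =>
    Step.unique_mollified (P.τ_pos hN).le hB1 hB2 hτ h1 h1' s s')
    (isMRFD_iff.1 H) (isMRFD_iff.1 H')

theorem ErrorsLE.congr {V V' : ℕ → Grid J} {Vhalf Vhalf' : Grid J}
    {Φ Φ' : ℕ → Fin (J + 2) → ℝ} {E : ℝ} (H : ErrorsLE P u N J V Vhalf Φ E)
    (h : Vhalf = Vhalf' ∧ (∀ n ≤ N, V n = V' n) ∧ ∀ n < N, Φ n = Φ' n) :
    ErrorsLE P u N J V' Vhalf' Φ' E :=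
  ⟨h.1 ▸ H.half, fun n hn => h.2.1 n hn ▸ H.node n hn, fun n hn => h.2.2 n hn ▸ H.relax n hn⟩

/-- Convergence of the modified scheme for small mesh sizes. -/
theorem exists_mrfd_bound_fine (hsol : IsSolution P u)
    (hu : ContDiffOn ℝ 6 (Function.uncurry u) P.Q) (hg : ContDiffOn ℝ 5 P.g (Ici 0)) (hδ : 0 < δ)
    (hb : ∀ t ∈ Icc 0 P.T, ∀ x ∈ P.I, ‖u t x‖ ≤ δ / 2 ∧ |P.g (‖u t x‖ ^ 2)| ≤ δ / 2) :
    ∃ C τ₀ h₀ : ℝ, 0 < C ∧ 0 < τ₀ ∧ 0 < h₀ ∧ ∀ N J : ℕ, 1 ≤ N → P.τ N ≤ τ₀ → P.h J ≤ h₀ →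
      (∃ V Vhalf Φ, IsMRFD P δ N J V Vhalf Φ) ∧
      ∀ (V : ℕ → Grid J) (Vhalf : Grid J) (Φ : ℕ → Fin (J + 2) → ℝ), IsMRFD P δ N J V Vhalf Φ →
        ErrorsLE P u N J V Vhalf Φ (C * (P.τ N ^ 2 + P.h J ^ 2)) := by
  obtain ⟨C, τ₀, η₀, hC, hτ₀, hη₀, H⟩ := exists_rfd_bound hsol hu hg
  obtain ⟨B, hB, hB1, -, hB2⟩ := exists_cmollifier_bounds hδ
  -- η ≤ κ ensures both convergence and an error of at most δ/2, at which the cut-offs are inactive.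
  set κ := min η₀ (δ / (2 * C)) with hκ
  have hκ0 : 0 < κ := lt_min hη₀ (by positivity)
  have hsq : √(κ / 2) ^ 2 = κ / 2 := Real.sq_sqrt (by positivity)
  refine ⟨C, min (min τ₀ (1 / B ^ 2)) √(κ / 2), √(κ / 2), hC,
    lt_min (lt_min hτ₀ (by positivity)) (by positivity), by positivity, fun N J hN hτ hh => ?_⟩
  have hτ0 := P.τ_pos hN
  have hh0 := P.h_pos J
  have hτ1 : P.τ N ≤ τ₀ := hτ.trans ((min_le_left _ _).trans (min_le_left _ _))
  have hτ2 : P.τ N * B ^ 2 ≤ 1 := by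
    rw [← le_div_iff₀ (by positivity)]
    exact hτ.trans ((min_le_left _ _).trans (min_le_right _ _))
  have hη : P.τ N ^ 2 + P.h J ^ 2 ≤ κ := by
    have h1 := pow_le_pow_left₀ hτ0.le (hτ.trans (min_le_right _ _)) 2
    have h2 := pow_le_pow_left₀ hh0.le hh 2
    linarith
  have hsmall : C * (P.τ N ^ 2 + P.h J ^ 2) ≤ δ / 2 := by
    calc C * (P.τ N ^ 2 + P.h J ^ 2) ≤ C * (δ / (2 * C)) := by
          gcongr; exact hη.trans (min_le_right _ _)
      _ = δ / 2 := by field_simp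
  -- The relaxation approximations always exist and converge. Once recognised as modified
  -- approximations they give existence, and uniqueness carries their bounds to all other modified
  -- approximations.
  obtain ⟨W, Wh, Φ, hW⟩ := exists_isRFD P N J
  have hE := H N J hN hτ1 (hη.trans (min_le_left _ _)) W Wh Φ hW
  have hW' := (hE.isRFD_iff_isMRFD hN hb hsmall).1 hW
  exact ⟨⟨W, Wh, Φ, hW'⟩, fun V Vhalf Ψ hV => hE.congr (hW'.unique hN hB1 hB2 hτ2 hV)⟩

/-- A modified approximation close to the solution in the discrete `H¹` norm is a relaxation
approximation. -/
theorem IsMRFD.isRFD (hsol : IsSolution P u) (hN : 1 ≤ N)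
    (hb : ∀ t ∈ Icc 0 P.T, ∀ x ∈ P.I, ‖u t x‖ ≤ δ / 2 ∧ |P.g (‖u t x‖ ^ 2)| ≤ δ / 2)
    {V : ℕ → Grid J} {Vhalf : Grid J} {Φ : ℕ → Fin (J + 2) → ℝ}
    (H : IsMRFD P δ N J V Vhalf Φ) {E : ℝ} (hE : √P.L * E ≤ δ / 2)
    (hhalf : halfError P u N J Vhalf ≤ E) (hnode : nodeError P u N J V ≤ E)
    (hrelax : relaxError P u N J Φ ≤ E) : IsRFD P N J V Vhalf Φ := by
  have key : ∀ v : Grid J, v 0 = 0 → normH1 (P.h J) v ≤ E → ∀ j, ‖v j‖ ≤ δ / 2 :=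
    fun v hv hvE j => ((norm_apply_le_sqrt_mul_seminormH1 (P.h_pos J) (P.h_mul J) hv j).trans
      (mul_le_mul_of_nonneg_left ((seminormH1_le_normH1 v).trans hvE) (Real.sqrt_nonneg _))).trans hE
  have hc0 : cmollifier δ 0 = 0 := by simp [cmollifier, mollifier, Complex.ext_iff]
  -- At the left end Φ stays equal to g(0), since 2g(0) − g(0) = g(0). The relaxation error
  -- therefore vanishes there, as the Sobolev inequality requires.
  have hΦ0 : ∀ n < N, Φ n 0 = P.g 0 := by
    intro n
    induction n with
    | zero => intro _; rw [H.Φ_zero, H.ends_half.1, hc0]; simp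
    | succ n ih =>
      intro hn
      rw [H.Φ_succ n hn, (H.ends _ hn.le).1, hc0, ih (by omega)]
      simp; ring
  refine (RFD.isRFD_iff_isMRFD hN hb (fun j => ?_) (fun n hn j => ?_) (fun n hn j => ?_)).2 H
  · exact key _ ((vanishesAtEnds_sample hsol J (tmid_mem P hN (by omega))).sub H.ends_half).1
      hhalf j
  · refine key _ ((vanishesAtEnds_sample hsol J (t_mem P hN hn)).sub (H.ends n hn)).1 ?_ j
    exact (le_ciSup (f := fun m : Fin (N + 1) =>
      normH1 (P.h J) (sample P J (u (P.t N m)) - V m)) (Set.finite_range _).bddAbove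
      ⟨n, by omega⟩).trans hnode
  · have h1 := key (fun j => ((P.g (‖u (P.tmid N n) (P.x J j)‖ ^ 2) - Φ n j : ℝ) : ℂ))
      (by simp [hΦ0 n hn, x_zero, (hsol.boundary _ (tmid_mem P hN hn)).1]) 
      ((le_ciSup (f := fun m : Fin N => normH1 (P.h J)
        fun j => ((P.g (‖u (P.tmid N m) (P.x J j)‖ ^ 2) - Φ m j : ℝ) : ℂ))
        (Set.finite_range _).bddAbove ⟨n, hn⟩).trans hrelax) j
    rwa [Complex.norm_real, Real.norm_eq_abs] at h1

/-- Error bounds in terms of the norms of the statement. -/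
theorem ErrorsLE.errors_le (hN : 1 ≤ N) {V : ℕ → Grid J} {Vhalf : Grid J}
    {Φ : ℕ → Fin (J + 2) → ℝ} {E : ℝ} (H : ErrorsLE P u N J V Vhalf Φ E) :
    halfError P u N J Vhalf + nodeError P u N J V ≤ 2 * (√(2 * P.L) + 1) * E ∧
      relaxError P u N J Φ ≤ (√(2 * P.L) + 1) * E := by
  have key : ∀ {v : Grid J}, gridNorm (P.h J) v ≤ E → normH1 (P.h J) v ≤ (√(2 * P.L) + 1) * E :=
    fun {v} hv => (normH1_le_gridNorm (P.h_pos J) (P.h_mul J) v).trans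
      (mul_le_mul_of_nonneg_left hv (by positivity))
  have h1 : nodeError P u N J V ≤ (√(2 * P.L) + 1) * E :=
    ciSup_le fun m => key (H.node m (Nat.lt_succ_iff.1 m.2))
  have : Nonempty (Fin N) := ⟨⟨0, hN⟩⟩
  have h2 : relaxError P u N J Φ ≤ (√(2 * P.L) + 1) * E := by
    refine ciSup_le fun m => ?_
    have e : (fun j => ((P.g (‖u (P.tmid N m) (P.x J j)‖ ^ 2) - Φ m j : ℝ) : ℂ))
        = sample P J (gOf P u (P.tmid N m)) - toGrid (Φ m) := by
      ext j
      simp [sample, gOf, toGrid]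
    rw [e]
    exact key (H.relax m m.2)
  have h3 : halfError P u N J Vhalf ≤ (√(2 * P.L) + 1) * E := key H.half
  exact ⟨by linarith, h2⟩

end Fine

/-! ### The modified scheme on coarse meshes -/

section Coarse

variable {P : Problem} {u : ℝ → ℝ → ℂ} {N J : ℕ} {δ : ℝ}

theorem discrete_gronwall {a : ℕ → ℝ} {c d τ : ℝ} (hc : 0 ≤ c) (hd : 0 ≤ d) (hτ : 0 ≤ τ)
    (h0 : 0 ≤ a 0) (H : ∀ n < N, a (n + 1) ≤ (1 + c * τ) * a n + d * τ) :
    ∀ n ≤ N, a n ≤ Real.exp (c * (n * τ)) * (a 0 + d * (n * τ)) := by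
  intro n
  induction n with
  | zero => intro _; simp
  | succ n ih =>
    intro hn
    have h1 : 1 + c * τ ≤ Real.exp (c * τ) := by
      rw [add_comm]; exact Real.add_one_le_exp _
    have h2 : 1 ≤ Real.exp (c * ((n + 1 : ℕ) * τ)) := Real.one_le_exp (by positivity)
    have e : Real.exp (c * τ) * Real.exp (c * (n * τ)) = Real.exp (c * ((n + 1 : ℕ) * τ)) := by
      rw [← Real.exp_add]; congr 1; push_cast; ring
    calc a (n + 1) ≤ (1 + c * τ) * a n + d * τ := H n hn
      _ ≤ (1 + c * τ) * (Real.exp (c * (n * τ)) * (a 0 + d * (n * τ))) + 1 * (d * τ) := by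
          rw [one_mul]
          gcongr
          exact ih (by omega)
      _ ≤ Real.exp (c * τ) * (Real.exp (c * (n * τ)) * (a 0 + d * (n * τ)))
          + Real.exp (c * ((n + 1 : ℕ) * τ)) * (d * τ) := by gcongr
      _ = _ := by rw [← mul_assoc, e]; push_cast; ring

/-- For h bounded below the Laplacian is a bounded operator in the maximum norm, so the scheme can
be treated like an ordinary differential equation. -/
theorem norm_laplacian_le {h h₀ : ℝ} (h0 : 0 < h₀) (hh : h₀ ≤ h) (v : Grid J) :
    ‖laplacian h v‖ ≤ 4 / h₀ ^ 2 * ‖v‖ := by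
  have hp : 0 < h := h0.trans_le hh
  have hv := norm_nonneg v
  refine (pi_norm_le_iff_of_nonneg (by positivity)).2 (forall_grid.2 ⟨?_, fun i => ?_, ?_⟩)
  · rw [laplacian_zero_node, norm_zero]; positivity
  · rw [laplacian, extendZero_interior, norm_div, norm_pow, Complex.norm_real,
      Real.norm_of_nonneg hp.le]
    have h1 : ‖v i.castSucc.castSucc - 2 * v i.succ.castSucc + v i.succ.succ‖ ≤ 4 * ‖v‖ := by
      have t1 := norm_add_le (v i.castSucc.castSucc - 2 * v i.succ.castSucc) (v i.succ.succ)
      have t2 := norm_sub_le (v i.castSucc.castSucc) (2 * v i.succ.castSucc)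
      rw [norm_mul, Complex.norm_two] at t2
      have s1 := norm_le_pi_norm v i.castSucc.castSucc
      have s2 := norm_le_pi_norm v i.succ.castSucc
      have s3 := norm_le_pi_norm v i.succ.succ
      linarith
    calc _ ≤ 4 * ‖v‖ / h ^ 2 := by gcongr
      _ ≤ 4 * ‖v‖ / h₀ ^ 2 := by gcongr
      _ = _ := by ring
  · rw [laplacian_last_node, norm_zero]; positivity

theorem gridNorm_le_norm {h h₀ L : ℝ} (h0 : 0 < h₀) (hh : h₀ ≤ h) (hL : h * (J + 1) = L)
    (v : Grid J) : gridNorm h v ≤ (1 + √L * (2 / h₀)) * ‖v‖ := by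
  have hp : 0 < h := h0.trans_le hh
  have hv := norm_nonneg v
  have h1 : seminormH1 h v ≤ √L * (2 / h₀ * ‖v‖) := by
    refine seminormH1_le_of_bound hp.le hL (by positivity) fun j => ?_
    rw [diffQuot, norm_div, Complex.norm_real, Real.norm_of_nonneg hp.le]
    have h2 : ‖v j.succ - v j.castSucc‖ ≤ 2 * ‖v‖ := by
      have := norm_sub_le (v j.succ) (v j.castSucc)
      have := norm_le_pi_norm v j.succ
      have := norm_le_pi_norm v j.castSucc
      linarith
    calc _ ≤ 2 * ‖v‖ / h := by gcongr
      _ ≤ 2 * ‖v‖ / h₀ := by gcongr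
      _ = _ := by ring
  unfold gridNorm
  linarith

theorem norm_avg_le (v w : Grid J) : ‖avg v w‖ ≤ (‖v‖ + ‖w‖) / 2 := by
  rw [avg_eq, norm_smul]
  have := norm_add_le v w
  norm_num
  linarith

theorem exists_norm_sampleInterior_le (P : Problem) : ∃ F, 0 ≤ F ∧ ∀ J : ℕ,
    ∀ s ∈ Icc 0 P.T, ∀ s' ∈ Icc 0 P.T,
      ‖sampleInterior P J fun x => (P.f s x + P.f s' x) / 2‖ ≤ F := by
  obtain ⟨F, hF⟩ := (isCompact_Q P).exists_bound_of_continuousOn P.f_continuous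
  refine ⟨max F 0, le_max_right _ _, fun J s hs s' hs' => ?_⟩
  refine (pi_norm_le_iff_of_nonneg (le_max_right _ _)).2 (forall_grid.2 ⟨?_, fun i => ?_, ?_⟩)
  · simp [sampleInterior]
  · rw [sampleInterior, extendZero_interior, norm_div, Complex.norm_two]
    have h1 := (hF (s, _) (mk_mem_prod hs (x_mem P J i.succ.castSucc))).trans (le_max_left F 0)
    have h2 := (hF (s', _) (mk_mem_prod hs' (x_mem P J i.succ.castSucc))).trans (le_max_left F 0)
    have h3 := norm_add_le (P.f s (P.x J i.succ.castSucc)) (P.f s' (P.x J i.succ.castSucc))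
    simp only [Function.uncurry] at h1 h2
    linarith
  · simp [sampleInterior]

theorem Step.norm_sub_le {s k κ F m : ℝ} (hk : 0 < k) (hκ0 : 0 ≤ κ)
    (hκ : ∀ v : Grid J, ‖laplacian (P.h J) v‖ ≤ κ * ‖v‖)
    (hF : ‖sampleInterior P J fun x => (P.f (s + k) x + P.f s x) / 2‖ ≤ F)
    {V₀ V₁ M : Grid J} (hM : ‖M‖ ≤ m) (H : Step P s k V₀ V₁ M) :
    ‖V₁ - V₀‖ ≤ k * (κ * ((‖V₁‖ + ‖V₀‖) / 2) + (m + F)) := by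
  rw [Step] at H
  rw [H]
  have h1 := (hκ (avg V₁ V₀)).trans (mul_le_mul_of_nonneg_left (norm_avg_le V₁ V₀) hκ0)
  have h2 : ∀ v : Grid J, ‖(Complex.I * (k : ℂ)) • v‖ = k * ‖v‖ := fun v => by
    rw [norm_smul, ErrorSystem.norm_I_mul hk]
  refine (norm_add₃_le).trans ?_
  rw [h2, h2, norm_smul, Complex.norm_real, Real.norm_of_nonneg hk.le]
  have a1 := mul_le_mul_of_nonneg_left h1 hk.le
  have a2 := mul_le_mul_of_nonneg_left hM hk.le
  have a3 := mul_le_mul_of_nonneg_left hF hk.le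
  linarith

/-- Solvability of a step of the modified scheme for small time steps. -/
theorem exists_mollified_step {s k κ B : ℝ} (hk : 0 < k)
    (hκ : ∀ v : Grid J, ‖laplacian (P.h J) v‖ ≤ κ * ‖v‖) (hB1 : ∀ y, |mollifier δ y| ≤ B)
    (hB2 : ∀ y z, ‖cmollifier δ y - cmollifier δ z‖ ≤ B * ‖y - z‖) (hc0 : cmollifier δ 0 = 0)
    (hkB : k * (κ + B ^ 2) ≤ 1) (hκ0 : 0 ≤ κ) {V₀ : Grid J} (h0 : VanishesAtEnds V₀)
    (Φ : Fin (J + 2) → ℝ) :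
    ∃ V₁, VanishesAtEnds V₁ ∧ Step P s k V₀ V₁
      fun j => (mollifier δ (Φ j) : ℂ) * cmollifier δ (avg V₁ V₀ j) := by
  have hB0 : 0 ≤ B := (abs_nonneg _).trans (hB1 0)
  let M : Grid J → Grid J := fun v j => (mollifier δ (Φ j) : ℂ) * cmollifier δ (avg v V₀ j)
  let A : Grid J → Grid J := fun v => V₀ + ((Complex.I * (k : ℂ)) • laplacian (P.h J) (avg v V₀)
    + (Complex.I * (k : ℂ)) • M v
    + (k : ℂ) • sampleInterior P J fun x => (P.f (s + k) x + P.f s x) / 2)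
  have hIk : ∀ v : Grid J, ‖(Complex.I * (k : ℂ)) • v‖ = k * ‖v‖ := fun v => by
    rw [norm_smul, ErrorSystem.norm_I_mul hk]
  have havg : ∀ v w j, avg v V₀ j - avg w V₀ j = (v - w) j / 2 := fun v w j => by
    simp [avg]; ring
  have hM : ∀ v w, ‖M v - M w‖ ≤ B ^ 2 / 2 * ‖v - w‖ := fun v w => by
    refine (pi_norm_le_iff_of_nonneg (by positivity)).2 fun j => ?_
    have h1 := hB2 (avg v V₀ j) (avg w V₀ j)
    rw [havg, norm_div, Complex.norm_two] at h1
    have h2 := norm_le_pi_norm (v - w) j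
    simp only [M, Pi.sub_apply] at h2 ⊢
    rw [← mul_sub, norm_mul, Complex.norm_real, Real.norm_eq_abs]
    calc _ ≤ B * (B * (‖v - w‖ / 2)) := by
          gcongr
          · exact hB1 _
          · exact h1.trans (by simp only [Pi.sub_apply]; gcongr)
      _ = _ := by ring
  -- The Laplacian and the nonlinearity each act on half of the difference, so k(κ + B²) ≤ 1 gives
  -- contraction with factor 1/2 and Banach's theorem a solution.
  have hA : ∀ v w, ‖A v - A w‖ ≤ 1 / 2 * ‖v - w‖ := fun v w => by
    have e : A v - A w = (Complex.I * (k : ℂ)) • laplacian (P.h J) (avg v V₀ - avg w V₀)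
        + (Complex.I * (k : ℂ)) • (M v - M w) := by
      rw [laplacian_sub]; simp only [A]; module
    have e2 : avg v V₀ - avg w V₀ = (1 / 2 : ℂ) • (v - w) := by
      rw [avg_eq, avg_eq]; module
    rw [e, e2]
    refine (norm_add_le _ _).trans ?_
    rw [hIk, hIk]
    have h1 := hκ ((1 / 2 : ℂ) • (v - w))
    rw [norm_smul] at h1
    norm_num at h1
    have h2 := mul_le_mul_of_nonneg_left h1 hk.le
    have h3 := mul_le_mul_of_nonneg_left (hM v w) hk.le
    have h4 := mul_le_mul_of_nonneg_right hkB (norm_nonneg (v - w))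
    norm_num
    linarith
  have hcon : ContractingWith (1 / 2) A := by
    refine ⟨by norm_num, LipschitzWith.of_dist_le_mul fun v w => ?_⟩
    rw [dist_eq_norm, dist_eq_norm]
    simpa using hA v w
  obtain ⟨v, hv⟩ : ∃ v, A v = v := ⟨_, hcon.fixedPoint_isFixedPt⟩
  -- The contraction lives on all grid functions. At an end node the fixed point equation contains
  -- only the nonlinear term, whose Lipschitz constant is at most 1/2, so the value there is 0.
  have hend : ∀ j, V₀ j = 0 → laplacian (P.h J) (avg v V₀) j = 0 →
      (sampleInterior P J fun x => (P.f (s + k) x + P.f s x) / 2) j = 0 → v j = 0 := by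
    intro j j1 j2 j3
    have h1 : v j = Complex.I * k * ((mollifier δ (Φ j) : ℂ) * cmollifier δ (v j / 2)) := by
      have := congrFun hv j
      simp only [A, M, Pi.add_apply, Pi.smul_apply, smul_eq_mul, j1, j2, j3, avg, add_zero,
        mul_zero, zero_add] at this
      exact this.symm
    have h2 := hB2 (v j / 2) 0
    rw [hc0, sub_zero, sub_zero, norm_div, Complex.norm_two] at h2
    have h3 : ‖v j‖ ≤ k * (B * (B * (‖v j‖ / 2))) := by
      conv_lhs => rw [h1, norm_mul, ErrorSystem.norm_I_mul hk, norm_mul, Complex.norm_real,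
        Real.norm_eq_abs]
      gcongr
      exact hB1 _
    have h4 : k * B ^ 2 ≤ 1 := by nlinarith
    have h5 := mul_le_mul_of_nonneg_right h4 (norm_nonneg (v j))
    have h6 : ‖v j‖ ≤ 0 := by linarith
    exact norm_le_zero_iff.1 h6
  refine ⟨v, ⟨hend _ h0.1 rfl rfl, hend _ h0.2 (by simp) (by simp [sampleInterior])⟩, ?_⟩
  rw [Step]
  conv_lhs => rw [← hv]
  simp only [A, M, add_sub_cancel_left]

/-- Bounds of the modified approximations on coarse meshes. -/
theorem IsMRFD.norm_le {κ B F A₀ G D : ℝ} (hN : 1 ≤ N) (hκ0 : 0 ≤ κ)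
    (hκ : ∀ v : Grid J, ‖laplacian (P.h J) v‖ ≤ κ * ‖v‖) (hB1 : ∀ y, |mollifier δ y| ≤ B)
    (hB3 : ∀ z, ‖cmollifier δ z‖ ≤ B)
    (hB2 : ∀ y z, ‖cmollifier δ y - cmollifier δ z‖ ≤ B * ‖y - z‖)
    (hτ : P.τ N * κ ≤ 1) (hF0 : 0 ≤ F)
    (hF : ∀ s ∈ Icc 0 P.T, ∀ s' ∈ Icc 0 P.T,
      ‖sampleInterior P J fun x => (P.f s x + P.f s' x) / 2‖ ≤ F)
    (hG0 : 0 ≤ G) (hG : ∀ x ∈ Icc 0 (B ^ 2), |P.g x| ≤ G) (hD0 : 0 ≤ D)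
    (hD : ∀ x ∈ Icc 0 (B ^ 2), ∀ y ∈ Icc 0 (B ^ 2), |P.g x - P.g y| ≤ D * |x - y|)
    {V : ℕ → Grid J} {Vhalf : Grid J} {Φ : ℕ → Fin (J + 2) → ℝ} (hA₀ : ‖V 0‖ ≤ A₀)
    (H : IsMRFD P δ N J V Vhalf Φ) {R : ℝ}
    (hR : R = Real.exp (2 * κ * P.T) * (A₀ + 2 * (B ^ 2 + F) * P.T)) :
    (∀ n ≤ N, ‖V n‖ ≤ R) ∧ ∀ n < N, ∀ j,
      |Φ n j| ≤ 3 * G + 4 * D * B ^ 2 * (κ * R + (B ^ 2 + F)) * P.T := by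
  have hτ0 := P.τ_pos hN
  have hB0 : 0 ≤ B := (abs_nonneg _).trans (hB1 0)
  have hstep : ∀ n < N, ‖V (n + 1) - V n‖
      ≤ P.τ N * (κ * ((‖V (n + 1)‖ + ‖V n‖) / 2) + (B ^ 2 + F)) := fun n hn => by
    refine Step.norm_sub_le hτ0 hκ0 hκ (hF _ ?_ _ (t_mem P hN hn.le)) ?_ (H.step n hn)
    · rw [← t_succ]; exact t_mem P hN hn
    · refine (pi_norm_le_iff_of_nonneg (by positivity)).2 fun j => ?_
      rw [norm_mul, Complex.norm_real, Real.norm_eq_abs, sq]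
      exact mul_le_mul (hB1 _) (hB3 _) (norm_nonneg _) hB0
  have hnT : ∀ n ≤ N, (n : ℝ) * P.τ N ≤ P.T := fun n hn => (t_mem P hN hn).2
  have hVR : ∀ n ≤ N, ‖V n‖ ≤ R := by
    intro n hn
    have h1 := discrete_gronwall (a := fun n => ‖V n‖) (c := 2 * κ) (d := 2 * (B ^ 2 + F))
      (by positivity) (by positivity) hτ0.le (norm_nonneg _) (fun n hn => ?_) n hn
    · refine h1.trans ?_
      rw [hR]
      have := hnT n hn
      have hT := P.T_pos
      have : 0 ≤ A₀ := (norm_nonneg _).trans hA₀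
      gcongr
    · have h1 := hstep n hn
      have h2 : ‖V (n + 1)‖ ≤ ‖V (n + 1) - V n‖ + ‖V n‖ := by
        simpa using norm_add_le (V (n + 1) - V n) (V n)
      set a' := ‖V (n + 1)‖
      have ha : 0 ≤ ‖V n‖ := norm_nonneg _
      set a := ‖V n‖
      set x := P.τ N * κ / 2 with hx
      have hx0 : 0 ≤ x := by positivity
      have hx1 : x ≤ 1 / 2 := by rw [hx]; linarith
      have hE : 0 ≤ P.τ N * (B ^ 2 + F) := by positivity
      set E := P.τ N * (B ^ 2 + F) with hE'
      have h3 : (1 - x) * a' ≤ (1 + x) * a + E := by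
        have : P.τ N * (κ * ((a' + a) / 2) + (B ^ 2 + F)) = x * a' + x * a + E := by
          rw [hx, hE']; ring
        linarith
      -- Solves the implicit inequality for a': for x ≤ 1/2 the factor 1 + 4x and the constant 2
      -- dominate the quotients by 1 − x.
      have h4 : (1 + x) * a + E ≤ (1 - x) * ((1 + 4 * x) * a + 2 * E) := by
        nlinarith [mul_nonneg (mul_nonneg hx0 (by linarith : 0 ≤ 1 - 2 * x)) ha,
          mul_nonneg hE (by linarith : 0 ≤ 1 - 2 * x)]
      have h5 := le_of_mul_le_mul_left (h3.trans h4) (by linarith : 0 < 1 - x)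
      refine h5.trans (le_of_eq ?_)
      rw [hx, hE']; ring
  have hdiff : ∀ n < N, ‖V (n + 1) - V n‖ ≤ P.τ N * (κ * R + (B ^ 2 + F)) := fun n hn => by
    refine (hstep n hn).trans ?_
    have h1 := hVR _ hn
    have h2 := hVR n hn.le
    gcongr
    linarith
  have hR0 : 0 ≤ R := (norm_nonneg _).trans (hVR 0 (Nat.zero_le _))
  have hsq : ∀ z, ‖cmollifier δ z‖ ^ 2 ∈ Icc 0 (B ^ 2) := fun z =>
    ⟨by positivity, pow_le_pow_left₀ (norm_nonneg _) (hB3 z) 2⟩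
  refine ⟨hVR, fun n hn j => ?_⟩
  set E := 4 * D * B ^ 2 * (κ * R + (B ^ 2 + F)) with hE
  have hE0 : 0 ≤ E := by positivity
  -- Φ_{n+2} − Φ_n is twice a time increment of g(|γ(V)|²), hence O(τ). The even and the odd
  -- subsequence thus grow at most linearly in time; the pair of claims carries both through the
  -- induction.
  have key : ∀ n, (n < N → |Φ n j| ≤ 3 * G + E * (n * P.τ N)) ∧
      (n + 1 < N → |Φ (n + 1) j| ≤ 3 * G + E * ((n + 1 : ℕ) * P.τ N)) := by
    intro n
    induction n with
    | zero =>
      have h1 : |Φ 0 j| ≤ G := by rw [H.Φ_zero]; exact hG _ (hsq _)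
      refine ⟨fun _ => by simp; linarith, fun hn => ?_⟩
      have h2 : |Φ 1 j| ≤ 3 * G := by
        rw [H.Φ_succ 0 hn]
        have := hG _ (hsq (V 1 j))
        rw [abs_le] at h1 this ⊢
        simp only [zero_add]
        constructor <;> linarith
      have : 0 ≤ E * ((0 + 1 : ℕ) * P.τ N) := by positivity
      simp only [zero_add] at this ⊢
      linarith
    | succ n ih =>
      refine ⟨ih.2, fun hn => ?_⟩
      have h1 := ih.1 (by omega)
      have e1 := H.Φ_succ n (by omega) j
      have e2 := H.Φ_succ (n + 1) hn j
      have h2 := hD _ (hsq (V (n + 1 + 1) j)) _ (hsq (V (n + 1) j))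
      have h3 : |‖cmollifier δ (V (n + 1 + 1) j)‖ ^ 2 - ‖cmollifier δ (V (n + 1) j)‖ ^ 2|
          ≤ 2 * B * (B * (P.τ N * (κ * R + (B ^ 2 + F)))) := by
        have e : ∀ a b : ℝ, a ^ 2 - b ^ 2 = (a + b) * (a - b) := fun a b => by ring
        rw [e, abs_mul]
        refine mul_le_mul ?_ ?_ (abs_nonneg _) (by positivity)
        · rw [abs_of_nonneg (by positivity)]
          linarith [hB3 (V (n + 1 + 1) j), hB3 (V (n + 1) j)]
        · refine (abs_norm_sub_norm_le _ _).trans ((hB2 _ _).trans ?_)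
          exact mul_le_mul_of_nonneg_left ((norm_le_pi_norm (V (n + 1 + 1) - V (n + 1)) j).trans
            (hdiff _ (by omega))) hB0
      have h4 := h2.trans (mul_le_mul_of_nonneg_left h3 hD0)
      have e3 : E * ((n + 1 + 1 : ℕ) * P.τ N) = E * (n * P.τ N)
          + 4 * (D * (2 * B * (B * (P.τ N * (κ * R + (B ^ 2 + F)))))) := by
        rw [hE]; push_cast; ring
      have h5 := (abs_nonneg _).trans h4
      rw [e3, e2, e1]
      rw [abs_le] at h1 h4 ⊢
      constructor <;> linarith
  refine ((key n).1 hn).trans ?_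
  have := hnT n hn.le
  gcongr

/-- The modified scheme with small time steps on coarse meshes. -/
theorem exists_mrfd_bound_coarse (hsol : IsSolution P u)
    (hu : ContDiffOn ℝ 6 (Function.uncurry u) P.Q) (hg : ContDiffOn ℝ 5 P.g (Ici 0)) (hδ : 0 < δ)
    (hb : ∀ t ∈ Icc 0 P.T, ∀ x ∈ P.I, ‖u t x‖ ≤ δ / 2 ∧ |P.g (‖u t x‖ ^ 2)| ≤ δ / 2)
    {h₀ : ℝ} (h0 : 0 < h₀) :
    ∃ E τ₀ : ℝ, 0 < E ∧ 0 < τ₀ ∧ ∀ N J : ℕ, 1 ≤ N → P.τ N ≤ τ₀ → h₀ ≤ P.h J →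
      (∃ V Vhalf Φ, IsMRFD P δ N J V Vhalf Φ) ∧
      ∀ (V : ℕ → Grid J) (Vhalf : Grid J) (Φ : ℕ → Fin (J + 2) → ℝ), IsMRFD P δ N J V Vhalf Φ →
        ErrorsLE P u N J V Vhalf Φ E := by
  obtain ⟨B, hB, hB1, hB3, hB2⟩ := exists_cmollifier_bounds hδ
  obtain ⟨ρ, K, hK, hC⟩ := exists_consistencyBounds hu hg
  obtain ⟨F, hF0, hF⟩ := exists_norm_sampleInterior_le P
  obtain ⟨g, hgc, hgeq⟩ := exists_contDiff_extension 1 P.g (hg.of_le (by norm_num))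
  obtain ⟨G, hG0, hG⟩ := exists_bound_on_Icc hgc.continuous (B ^ 2)
  obtain ⟨D, hD0, hD⟩ := exists_lipschitz_on_Icc
    (fun x => (hgc.differentiable (by norm_num) x).hasDerivAt) (hgc.continuous_deriv (by norm_num))
    (B ^ 2)
  have hIcc : ∀ x ∈ Icc 0 (B ^ 2), x ∈ Icc (-(B ^ 2)) (B ^ 2) := fun x hx =>
    ⟨by linarith [hx.1, hx.2], hx.2⟩
  set κ := 4 / h₀ ^ 2 with hκ
  set A₀ := K + K * P.L ^ 2 with hA₀
  set R := Real.exp (2 * κ * P.T) * (A₀ + 2 * (B ^ 2 + F) * P.T) with hR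
  set S := 3 * G + 4 * D * B ^ 2 * (κ * R + (B ^ 2 + F)) * P.T with hS
  set c := 1 + √P.L * (2 / h₀) with hc
  have hT := P.T_pos
  have hκ0 : 0 < κ := by positivity
  have hR0 : 0 ≤ R := by positivity
  have hS0 : 0 ≤ S := by positivity
  have hc0 : 0 < c := by positivity
  have hm0 : cmollifier δ 0 = 0 := by simp [cmollifier, mollifier, Complex.ext_iff]
  -- For nodes and relaxation values the exact quantities (at most δ/2) and the approximations (at
  -- most R or S) are bounded separately. The half step uses its own error estimate.
  refine ⟨c * (δ / 2 + R + S) + 6 * K ^ 3 * (P.T ^ 2 + P.L ^ 2),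
    min (1 / (κ + B ^ 2)) (1 / K ^ 2), by positivity, by positivity, fun N J hN hτ hh => ?_⟩
  have hτ0 := P.τ_pos hN
  have hτ1 : P.τ N * (κ + B ^ 2) ≤ 1 := by
    rw [← le_div_iff₀ (by positivity)]; exact hτ.trans (min_le_left _ _)
  have hτ2 : K ^ 2 * P.τ N ≤ 1 := by
    rw [mul_comm, ← le_div_iff₀ (by positivity)]; exact hτ.trans (min_le_right _ _)
  have hlap : ∀ v : Grid J, ‖laplacian (P.h J) v‖ ≤ κ * ‖v‖ := norm_laplacian_le h0 hh
  refine ⟨?_, fun V Vhalf Φ H => ?_⟩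
  · simp only [isMRFD_iff]
    exact exists_scheme fun n _ V₀ Φ hV₀ =>
      exists_mollified_step hτ0 hlap hB1 hB2 hm0 hτ1 hκ0.le hV₀ Φ
  · have Cb := hC J
    have hV0 : ‖V 0‖ ≤ A₀ := by
      have e := sub_eq_zero.1 (projection_eq Cb hsol hu H.initial)
      have h00 : (0 : ℝ) ∈ Icc 0 P.T := ⟨le_rfl, P.T_pos.le⟩
      have h1 := (norm_le_gridNorm _).trans (Cb.u_le 0 h00)
      have h2 := (norm_le_gridNorm _).trans (Cb.ρ_le 0 h00)
      have h3 : P.h J ≤ P.L :=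
        div_le_self P.L_pos.le (by linarith [Nat.cast_nonneg (α := ℝ) J])
      have h4 : K * P.h J ^ 2 ≤ K * P.L ^ 2 := by
        have := P.h_pos J
        gcongr
      rw [← e]
      exact (norm_add_le _ _).trans (by linarith)
    obtain ⟨hV, hΦ⟩ := H.norm_le hN hκ0.le hlap hB1 hB3 hB2 (by nlinarith) hF0 (hF J) hG0
      (fun x hx => by rw [← hgeq x hx.1]; exact hG x (hIcc x hx)) hD0
      (fun x hx y hy => by
        rw [← hgeq x hx.1, ← hgeq y hy.1]; exact hD x (hIcc x hx) y (hIcc y hy)) hV0 hR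
    have hgrid : ∀ v : Grid J, gridNorm (P.h J) v ≤ c * ‖v‖ :=
      gridNorm_le_norm h0 hh (P.h_mul J)
    have hrest : 0 ≤ 6 * K ^ 3 * (P.T ^ 2 + P.L ^ 2) := by positivity
    refine ⟨?_, fun n hn => ?_, fun n hn => ?_⟩
    · refine (half_error_le Cb hK hsol hu hN hτ2 H.initial H.ends_half H.half_step).trans ?_
      have h1 := mul_le_mul_of_nonneg_left (η_le P (J := J) hN) (by positivity : 0 ≤ 6 * K ^ 3)
      have h2 : 0 ≤ c * (δ / 2 + R + S) := by positivity
      linarith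
    · refine (hgrid _).trans ?_
      have h1 : ‖sample P J (u (P.t N n)) - V n‖ ≤ δ / 2 + R + S := by
        refine (norm_sub_le _ _).trans ?_
        have := (pi_norm_le_iff_of_nonneg (by positivity)).2 fun j =>
          (hb _ (t_mem P hN hn) _ (x_mem P J j)).1
        have h2 : ‖sample P J (u (P.t N n))‖ ≤ δ / 2 := this
        linarith [hV n hn]
      linarith [mul_le_mul_of_nonneg_left h1 hc0.le]
    · refine (hgrid _).trans ?_
      have h1 : ‖sample P J (gOf P u (P.tmid N n)) - toGrid (Φ n)‖ ≤ δ / 2 + R + S := by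
        refine (pi_norm_le_iff_of_nonneg (by positivity)).2 fun j => ?_
        have h2 := (hb _ (tmid_mem P hN hn) _ (x_mem P J j)).2
        have h3 := hΦ n hn j
        rw [Pi.sub_apply, sample, gOf, toGrid, ← Complex.ofReal_sub, Complex.norm_real,
          Real.norm_eq_abs]
        exact (abs_sub _ _).trans (by linarith)
      linarith [mul_le_mul_of_nonneg_left h1 hc0.le]

/-- Convergence of the modified scheme for small time steps. -/
theorem exists_mrfd_bound (hsol : IsSolution P u)
    (hu : ContDiffOn ℝ 6 (Function.uncurry u) P.Q) (hg : ContDiffOn ℝ 5 P.g (Ici 0)) (hδ : 0 < δ)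
    (hb : ∀ t ∈ Icc 0 P.T, ∀ x ∈ P.I, ‖u t x‖ ≤ δ / 2 ∧ |P.g (‖u t x‖ ^ 2)| ≤ δ / 2) :
    ∃ C τ₀ : ℝ, 0 < C ∧ 0 < τ₀ ∧ ∀ N J : ℕ, 1 ≤ N → P.τ N ≤ τ₀ →
      (∃ V Vhalf Φ, IsMRFD P δ N J V Vhalf Φ) ∧
      ∀ (V : ℕ → Grid J) (Vhalf : Grid J) (Φ : ℕ → Fin (J + 2) → ℝ), IsMRFD P δ N J V Vhalf Φ →
        ErrorsLE P u N J V Vhalf Φ (C * (P.τ N ^ 2 + P.h J ^ 2)) := by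
  obtain ⟨C, τ₀, h₀, hC, hτ₀, hh₀, hfine⟩ := exists_mrfd_bound_fine hsol hu hg hδ hb
  obtain ⟨E, τ₁, hE, hτ₁, hcoarse⟩ := exists_mrfd_bound_coarse hsol hu hg hδ hb hh₀
  refine ⟨max C (E / h₀ ^ 2), min τ₀ τ₁, lt_max_of_lt_left hC, lt_min hτ₀ hτ₁,
    fun N J hN hτ => ?_⟩
  rcases le_total (P.h J) h₀ with hh | hh
  · obtain ⟨h1, h2⟩ := hfine N J hN (hτ.trans (min_le_left _ _)) hh
    exact ⟨h1, fun V Vhalf Φ H => (h2 V Vhalf Φ H).mono (by gcongr; exact le_max_left _ _)⟩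
  · obtain ⟨h1, h2⟩ := hcoarse N J hN (hτ.trans (min_le_right _ _)) hh
    refine ⟨h1, fun V Vhalf Φ H => (h2 V Vhalf Φ H).mono ?_⟩
    -- On coarse meshes no smallness is needed, because h² is bounded below by h₀².
    calc E = E / h₀ ^ 2 * h₀ ^ 2 := by field_simp
      _ ≤ max C (E / h₀ ^ 2) * (P.τ N ^ 2 + P.h J ^ 2) := by
          have h3 := pow_le_pow_left₀ hh₀.le hh 2
          have h4 := sq_nonneg (P.τ N)
          gcongr
          · exact le_max_right _ _
          · linarith

end Coarse

end RFD

/-! ### The main theorem -/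

theorem mainTheorem1 (P : RFD.Problem) (u : ℝ → ℝ → ℂ)
    (hsol : RFD.IsSolution P u)
    (hu : ContDiffOn ℝ 6 (Function.uncurry u) P.Q)
    (hg : ContDiffOn ℝ 5 P.g (Set.Ici 0))
    (δ : ℝ) (hδ_pos : 0 < δ)
    (hδ : 2 * max (RFD.uMax P u) (RFD.gMax P u) ≤ δ) :
    (∃ CA CB CC : ℝ, RFD.IsMRFDConstants P u δ CA CB CC) ∧
    ∀ CA CB CC : ℝ, RFD.IsMRFDConstants P u δ CA CB CC →
      ∃ C : ℝ, 0 < C ∧ ∀ N J : ℕ, 1 ≤ N → 1 ≤ J →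
        P.τ N * CA ≤ 1 / 2 →
        max CB CC * √P.L * (P.τ N ^ 2 + P.h J ^ 2) ≤ δ / 2 →
        (∃ W Whalf Φ, RFD.IsRFD P N J W Whalf Φ) ∧
        ∀ W Whalf Φ, RFD.IsRFD P N J W Whalf Φ →
          RFD.relaxError P u N J Φ + RFD.halfError P u N J Whalf + RFD.nodeError P u N J W
            ≤ C * (P.τ N ^ 2 + P.h J ^ 2) := by
  have hb : ∀ t ∈ Icc 0 P.T, ∀ x ∈ P.I, ‖u t x‖ ≤ δ / 2 ∧ |P.g (‖u t x‖ ^ 2)| ≤ δ / 2 :=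
    fun t ht x hx => RFD.le_half_of_uMax_gMax hu hg hδ ht hx
  refine ⟨?_, fun CA CB CC ⟨_, hCB, hCC, H⟩ => ⟨CB + CC, by positivity,
    fun N J hN hJ hτ hsmall => ⟨RFD.exists_isRFD P N J, fun W Whalf Φ hW => ?_⟩⟩⟩
  · obtain ⟨C, τ₀, hC, hτ₀, H⟩ := RFD.exists_mrfd_bound hsol hu hg hδ_pos hb
    -- With this CA the condition τ·CA ≤ 1/2 says τ ≤ τ₀. The factor √(2L) + 1 passes from
    -- `gridNorm` to the discrete H¹ norm, and CB is doubled because it bounds a sum of two errors.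
    refine ⟨1 / (2 * τ₀), 2 * (√(2 * P.L) + 1) * C, (√(2 * P.L) + 1) * C, by positivity,
      by positivity, by positivity, fun N J hN _ hτ => ?_⟩
    have hτ' : P.τ N ≤ τ₀ := by
      rw [mul_one_div, div_le_iff₀ (by positivity)] at hτ
      linarith
    obtain ⟨h1, h2⟩ := H N J hN hτ'
    refine ⟨h1, fun V Vhalf Φ hV => ?_⟩
    obtain ⟨h3, h4⟩ := (h2 V Vhalf Φ hV).errors_le hN
    exact ⟨h3.trans (le_of_eq (by ring)), h4.trans (le_of_eq (by ring))⟩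
  · obtain ⟨⟨V, Vhalf, Ψ, hV⟩, herr⟩ := H N J hN hJ hτ
    obtain ⟨h1, h2⟩ := herr V Vhalf Ψ hV
    set η := P.τ N ^ 2 + P.h J ^ 2
    have hη : 0 ≤ η := by positivity
    have hhalf0 : 0 ≤ RFD.halfError P u N J Vhalf := Real.sqrt_nonneg _
    have hnode0 : 0 ≤ RFD.nodeError P u N J V := Real.iSup_nonneg fun _ => Real.sqrt_nonneg _
    have m1 : CB * η ≤ max CB CC * η := by gcongr; exact le_max_left _ _
    have m2 : CC * η ≤ max CB CC * η := by gcongr; exact le_max_right _ _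
    have hRFD := hV.isRFD hsol hN hb (E := max CB CC * η) (by linarith) (by linarith)
      (by linarith) (by linarith)
    obtain ⟨e1, e2, e3⟩ := hW.unique hRFD
    have r1 : RFD.relaxError P u N J Φ = RFD.relaxError P u N J Ψ := by
      unfold RFD.relaxError; exact iSup_congr fun m => by rw [e3 m m.2]
    have r2 : RFD.nodeError P u N J W = RFD.nodeError P u N J V := by
      unfold RFD.nodeError; exact iSup_congr fun m => by rw [e2 m (Nat.lt_succ_iff.1 m.2)]
    rw [r1, r2, e1]
    linarith
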